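/- Let $\mathbb S^2\subset\mathbb R^3$ be the unit sphere with its normalized surface measure $\mu$, let $Y_{\ell,m}$ ($\ell\ge 0$, $|m|\le\ell$) be the standard complex spherical harmonics, orthonormal in $L_2(\mathbb S^2,\mu)$, let $\lambda_\ell=\ell(\ell+1)$, and let $\Delta_{\mathbb S^2}$ be the (weak) Laplace–Beltrami operator in $L_2(\mathbb S^2)$. Let $0<\alpha\le 1$, let $E_\alpha(z)=\sum_{k\ge0} z^k/\Gamma(\alpha k+1)$ be the Mittag-Leffler function, and for $0\le\beta<1$ let $$D_t^{\beta}g(t)=\frac{d}{dt}\int_0^t\frac{(t-s)^{-\beta}}{\Gamma(1-\beta)}\,g(s)\,ds,\qquad t>0,$$ be the Riemann–Liouville derivative, where for a function $g$ with values in $L_2(\Omega\times\mathbb S^2)$ the derivative is taken in the $L_2(\Omega\times\mathbb S^2)$ norm and $\int_0^t$ means $\lim_{\varepsilon\to0+}\int_\varepsilon^t$ (Bochner integrals). Let $(\Omega,\mathcal F,\mathbb P)$ be a probability space and let $\xi\in L_2(\Omega\times\mathbb S^2)$ be a real-valued, jointly measurable, centered, strongly isotropic Gaussian random field on $\mathbb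 S^2$, with Fourier coefficients $\widehat\xi_{\ell,m}=\int_{\mathbb S^2}\xi\,\overline{Y_{\ell,m}}\,d\mu$ and angular power spectrum $\mathcal C_\ell=\mathbb E|\widehat\xi_{\ell,m}|^2$ (which does not depend on $m$). Assume $$\sum_{\ell=0}^\infty(2\ell+1)\,\mathcal C_\ell<\infty .$$ Then for every $t\ge0$ the series $$U^H(t)=\sum_{\ell=0}^\infty\sum_{m=-\ell}^{\ell}E_\alpha(-\lambda_\ell t^\alpha)\,\widehat\xi_{\ell,m}\,Y_{\ell,m}$$ converges in $L_2(\Omega\times\mathbb S^2)$ to a real-valued field; $U^H(0)=\xi$, and $U^H(t)\to\xi$ in $L_2(\Omega\times\mathbb S^2)$ as $t\to0+$. For every $t>0$ the derivative $\frac{d}{dt}U^H(t)$, the field $\Delta_{\mathbb S^2}U^H(t)$ and the fractional derivative $D_t^{1-\alpha}\Delta_{\mathbb S^2}U^H(t)$ exist in $L_2(\Omega\times\mathbb S^2)$ (for $\alpha<1$ the integrand in the fractional derivative is Bochner integrable on $(0,t)$), and $U^H$ solves the homogeneous equation $dU-D_t^{1-\alpha}\Delta_{\mathbb S^2}U\,dt=0$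 in the sense that $$\sup_{t>0}\Big\|\tfrac{d}{dt}U^H(t)-D_t^{1-\alpha}\Delta_{\mathbb S^2}U^H(t)\Big\|_{L_2(\Omega\times\mathbb S^2)}^2=0 .$$ In particular, for every $t_0>0$, $$\sup_{t\ge t_0}\mathbb E\Big[\Big\|\tfrac{d}{dt}U^H(t)-D_t^{1-\alpha}\Delta_{\mathbb S^2}U^H(t)\Big\|_{L_2(\mathbb S^2)}^2\Big]=0 .$$ -/

import Mathlib

open MeasureTheory ProbabilityTheory Filter Topology
open scoped ENNReal

namespace SphereField

noncomputable section

/-! ### The unit sphere, spherical coordinates, surface measure -/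

/-- Three-dimensional Euclidean space. -/
abbrev E3 : Type := EuclideanSpace ℝ (Fin 3)

/-- The unit sphere of three-dimensional Euclidean space. -/
abbrev S2 : Type := Metric.sphere (0 : E3) 1

theorem sphPoint_mem (θ φ : ℝ) :
    (!₂[Real.sin θ * Real.cos φ, Real.sin θ * Real.sin φ, Real.cos θ] : E3) ∈
      Metric.sphere (0 : E3) 1 := by
  have h : (Real.sin θ * Real.cos φ) ^ 2 + (Real.sin θ * Real.sin φ) ^ 2 + Real.cos θ ^ 2 = 1 := by
    nlinarith [Real.sin_sq_add_cos_sq θ, Real.sin_sq_add_cos_sq φ]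
  simp [EuclideanSpace.norm_eq, Fin.sum_univ_three, h]

/-- The point of the sphere with colatitude `θ` and longitude `φ`. -/
def sphPoint (θ φ : ℝ) : S2 :=
  ⟨!₂[Real.sin θ * Real.cos φ, Real.sin θ * Real.sin φ, Real.cos θ], sphPoint_mem θ φ⟩

theorem continuous_sphPoint : Continuous fun p : ℝ × ℝ => sphPoint p.1 p.2 := by
  refine Continuous.subtype_mk ?_ _
  refine (PiLp.continuous_toLp 2 _).comp ?_
  refine continuous_pi fun i => ?_
  fin_cases i <;> simp <;> fun_prop

/-- The colatitude of a point of the sphere, in `[0, π]`. -/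
def colatitude (x : S2) : ℝ := Real.arccos (x.1 2)

/-- The longitude of a point of the sphere, normalized to `(-π, π]`. -/
def longitude (x : S2) : ℝ := Complex.arg ⟨x.1 0, x.1 1⟩

/-- The measure `(4π)⁻¹ sin θ dθ dφ` on the coordinate rectangle
`(0, π) × (-π, π]`. -/
def coordMeasure : Measure (ℝ × ℝ) :=
  (volume.restrict (Set.Ioo 0 Real.pi ×ˢ Set.Ioc (-Real.pi) Real.pi)).withDensity
    fun p => ENNReal.ofReal (Real.sin p.1 / (4 * Real.pi))

/-- The normalized surface measure `(4π)⁻¹ sin θ dθ dφ` on the sphere. -/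
def sphereMeasure : Measure S2 := coordMeasure.map fun p => sphPoint p.1 p.2

theorem coordMeasure_univ : coordMeasure Set.univ = 1 := by
  have hpi := Real.pi_pos
  rw [coordMeasure, withDensity_apply _ MeasurableSet.univ, Measure.restrict_univ,
    Measure.volume_eq_prod, ← Measure.prod_restrict,
    lintegral_prod _ (by fun_prop)]
  simp only [lintegral_const, Measure.restrict_apply MeasurableSet.univ, Set.univ_inter,
    Real.volume_Ioc]
  rw [lintegral_mul_const _ (by fun_prop), restrict_Ioo_eq_restrict_Ioc,
    ← ofReal_integral_eq_lintegral_ofReal, ← intervalIntegral.integral_of_le hpi.le,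
    ← ENNReal.ofReal_mul]
  · rw [intervalIntegral.integral_div, integral_sin, ← ENNReal.ofReal_one]
    congr 1
    simp
    field_simp
    norm_num
  · exact intervalIntegral.integral_nonneg hpi.le fun u hu =>
      div_nonneg (Real.sin_nonneg_of_nonneg_of_le_pi hu.1 hu.2) (by positivity)
  · exact (Continuous.integrableOn_Ioc (by fun_prop))
  · refine (ae_restrict_iff' measurableSet_Ioc).2 (ae_of_all _ fun u hu => ?_)
    exact div_nonneg (Real.sin_nonneg_of_nonneg_of_le_pi hu.1.le hu.2) (by positivity)

instance : IsProbabilityMeasure sphereMeasure :=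
  ⟨by rw [sphereMeasure, Measure.map_apply continuous_sphPoint.measurable MeasurableSet.univ,
    Set.preimage_univ, coordMeasure_univ]⟩

/-! ### Spherical harmonics -/

/-- The Legendre polynomial `2⁻ˡ (l!)⁻¹ (d/dt)ˡ (t² - 1)ˡ`. -/
def legendreP (l : ℕ) : Polynomial ℝ :=
  Polynomial.C ((2 ^ l * (l.factorial : ℝ))⁻¹) *
    Polynomial.derivative^[l] ((Polynomial.X ^ 2 - 1) ^ l)

/-- The associated Legendre function `(-1)ᵐ (1 - t²)^(m/2) (d/dt)ᵐ P_l(t)`, for `-1 ≤ t ≤ 1`. -/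
def assocLegendre (l m : ℕ) (t : ℝ) : ℝ :=
  (-1) ^ m * Real.sqrt (1 - t ^ 2) ^ m * (Polynomial.derivative^[m] (legendreP l)).eval t

/-- The spherical harmonic of degree `l` and order `0 ≤ m ≤ l` in spherical coordinates. -/
def harmonicCoord (l m : ℕ) (θ φ : ℝ) : ℂ :=
  (Real.sqrt ((2 * l + 1) * ((l - m).factorial : ℝ) / ((l + m).factorial : ℝ)) : ℂ) *
    (assocLegendre l m (Real.cos θ) : ℂ) * Complex.exp (Complex.I * m * φ)

/-- The spherical harmonic `Y_{l,m}`, `-l ≤ m ≤ l`, with `Y_{l,m} = (-1)ᵐ conj Y_{l,-m}` for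
negative `m`. -/
def sphHarmonic (l : ℕ) (m : ℤ) (x : S2) : ℂ :=
  if 0 ≤ m then harmonicCoord l m.natAbs (colatitude x) (longitude x)
  else (-1) ^ m.natAbs *
    (starRingEnd ℂ) (harmonicCoord l m.natAbs (colatitude x) (longitude x))

/-- The eigenvalue `l (l + 1)` of the negative Laplace-Beltrami operator. -/
def eigval (l : ℕ) : ℝ := l * (l + 1)

/-! ### The Laplace-Beltrami operator -/

/-- The Laplace-Beltrami operator
`(sin θ)⁻¹ ∂_θ (sin θ ∂_θ f) + (sin θ)⁻² ∂_φ² f` on smooth functions, in spherical coordinates.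
The value at the two poles, where the coordinates degenerate, is immaterial: it is only used under
an integral sign. -/
def classicalLaplacian (f : S2 → ℝ) (x : S2) : ℝ :=
  1 / Real.sin (colatitude x) *
      deriv (fun θ => Real.sin θ * deriv (fun θ' => f (sphPoint θ' (longitude x))) θ)
        (colatitude x) +
    (1 / Real.sin (colatitude x)) ^ 2 *
      iteratedDeriv 2 (fun φ => f (sphPoint (colatitude x) φ)) (longitude x)

/-- `g = Δ f` for the Laplace-Beltrami operator in `L²` of the sphere: both functions are square
integrable and `∫ f Δψ = ∫ g ψ` for every smooth `ψ` on the sphere (a smooth function on the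
sphere is the restriction of a smooth function on Euclidean space). -/
def IsLaplacianOf (g f : S2 → ℝ) : Prop :=
  MemLp f 2 sphereMeasure ∧ MemLp g 2 sphereMeasure ∧
    ∀ ψ : E3 → ℝ, ContDiff ℝ (⊤ : ℕ∞) ψ →
      ∫ x, f x * classicalLaplacian (fun y : S2 => ψ y) x ∂sphereMeasure =
        ∫ x, g x * ψ x ∂sphereMeasure

/-! ### Random fields on the sphere -/

/-- The action of a linear isometry of Euclidean space on the sphere. -/
def rotate (R : E3 ≃ₗᵢ[ℝ] E3) (x : S2) : S2 :=
  ⟨R x.1, by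
    have h := x.2
    rw [mem_sphere_zero_iff_norm] at h ⊢
    rw [R.norm_map, h]⟩

/-- A centered, strongly isotropic Gaussian random field on the sphere, jointly measurable and
square integrable on `Ω × S²`. -/
structure IsIsotropicGaussianField {Ω : Type*} [MeasurableSpace Ω] (P : Measure Ω)
    (ξ : Ω × S2 → ℝ) : Prop where
  measurable : Measurable ξ
  memLp : MemLp ξ 2 (P.prod sphereMeasure)
  gaussian : IsGaussianProcess (fun (x : S2) (ω : Ω) => ξ (ω, x)) P
  centered : ∀ x : S2, ∫ ω, ξ (ω, x) ∂P = 0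
  isotropic : ∀ (k : ℕ) (x : Fin k → S2) (R : E3 ≃ₗᵢ[ℝ] E3),
    LinearMap.det (R.toLinearEquiv : E3 →ₗ[ℝ] E3) = 1 →
      P.map (fun ω i => ξ (ω, x i)) = P.map (fun ω i => ξ (ω, rotate R (x i)))

/-- The random Fourier coefficient `∫ ξ conj Y_{l,m}`. -/
def fieldCoeff {Ω : Type*} (ξ : Ω × S2 → ℝ) (l : ℕ) (m : ℤ) (ω : Ω) : ℂ :=
  ∫ x, (ξ (ω, x) : ℂ) * (starRingEnd ℂ) (sphHarmonic l m x) ∂sphereMeasure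

/-- The angular power spectrum: the mean square of a Fourier coefficient of degree `l`. For an
isotropic field this mean square is the same for all orders `-l ≤ m ≤ l`, and `m = 0` is used
here. -/
def angularPowerSpectrum {Ω : Type*} [MeasurableSpace Ω] (P : Measure Ω) (ξ : Ω × S2 → ℝ)
    (l : ℕ) : ℝ :=
  ∫ ω, ‖fieldCoeff ξ l 0 ω‖ ^ 2 ∂P

/-- The space of real square integrable random fields on the sphere. -/
abbrev L2Field {Ω : Type*} [MeasurableSpace Ω] (P : Measure Ω) : Type _ :=
  Lp ℝ 2 (P.prod sphereMeasure)

/-- `V = Δ U` for random fields: realization by realization, almost surely. -/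
def IsFieldLaplacianOf {Ω : Type*} [MeasurableSpace Ω] (P : Measure Ω)
    (V U : L2Field P) : Prop :=
  ∀ᵐ ω ∂P, IsLaplacianOf (fun x => V (ω, x)) (fun x => U (ω, x))

/-! ### Mittag-Leffler function and fractional derivative -/

/-- The two-parametric Mittag-Leffler function `∑ zᵏ / Γ(α k + β)` at a real argument. -/
def mittagLeffler (α β z : ℝ) : ℝ := ∑' k : ℕ, z ^ k / Real.Gamma (α * k + β)

/-- The integrand `Γ(1-β)⁻¹ (t-s)^(-β) g(s)` of the Riemann-Liouville derivative of order `β`. -/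
def rlIntegrand {X : Type*} [NormedAddCommGroup X] [NormedSpace ℝ X] (β : ℝ) (g : ℝ → X)
    (t s : ℝ) : X :=
  (1 / Real.Gamma (1 - β) * (1 / (t - s) ^ β)) • g s

/-- The integral over `(0, t)` of `Γ(1-β)⁻¹ (t-s)^(-β) g(s)` converges to `J`. The function `g`
may be singular at `0`, and the integral is understood as the limit of the Bochner integrals over
`(ε, t)`; it is the Bochner integral over `(0, t)` whenever the integrand is integrable there. -/
def HasRLIntegral {X : Type*} [NormedAddCommGroup X] [NormedSpace ℝ X] (β : ℝ) (g : ℝ → X)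
    (t : ℝ) (J : X) : Prop :=
  (∀ ε ∈ Set.Ioo 0 t, IntervalIntegrable (rlIntegrand β g t) volume ε t) ∧
    Tendsto (fun ε => ∫ s in ε..t, rlIntegrand β g t s) (𝓝[>] 0) (𝓝 J)

/-- `D` is the Riemann-Liouville derivative of order `0 ≤ β < 1` of `g` at `t > 0`, i.e. the norm
derivative at `t` of `r ↦ ∫_0^r Γ(1-β)⁻¹ (r-s)^(-β) g(s) ds`. -/
def HasRLDerivAt {X : Type*} [NormedAddCommGroup X] [NormedSpace ℝ X] (β : ℝ) (g : ℝ → X)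
    (D : X) (t : ℝ) : Prop :=
  ∃ J : ℝ → X, (∀ r > 0, HasRLIntegral β g r (J r)) ∧ HasDerivAt J D t

/-- The truncation at degree `L` of the series
`∑_l ∑_{|m| ≤ l} E_α(-λ_l t^α) ξ̂_{l,m} Y_{l,m}`. -/
def truncatedField {Ω : Type*} (ξ : Ω × S2 → ℝ) (α : ℝ) (L : ℕ) (t : ℝ) (p : Ω × S2) : ℂ :=
  ∑ l ∈ Finset.range (L + 1), ∑ m ∈ Finset.Icc (-(l : ℤ)) l,
    (mittagLeffler α 1 (-eigval l * t ^ α) : ℂ) * fieldCoeff ξ l m p.1 * sphHarmonic l m p.2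

end

end SphereField

open SphereField

/-! The solution operator is diagonal in the degree `l`. Let `ζ l` be the component of `ξ` of degree
`l`. These components are pairwise orthogonal in `L²(Ω × S²)` and sum to `ξ`, so the sum of `‖ζ l‖²`
is finite. The field is `U(t) = ∑ u_l(t) ζ l` with `u_l(t) = E_α(-λ_l t^α)`, and every assertion
becomes a statement about scalar multipliers, provided the bounds are uniform in `l`. Pointwise
convergence with a uniform bound is then enough for norm convergence (`tendsto_diagSum`), and
similarly for differentiation and integration.

The scalar facts concern `E_α(-x)` for `x ≥ 0`: it lies in `[0, 1]`, `x E_α(-x) ≤ Γ(α + 1)`, and `|x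
(d/dx) E_α(-x)| ≤ 1`. Hence `|u_l| ≤ 1`, `|u_l'| ≤ α / t` and `λ_l u_l ≤ Γ(α + 1) t^(-α)`, uniformly
in `l`. For `α < 1` the signs of `u`, of `t u'` and of `-t u' - α` come from a maximum principle for
the Caputo derivative (`caputo_pser_of_isMax`); for `α = 1` the function is `exp(-x)`. The upper
bounds come from the Volterra equation `u = 1 - λ J^α u` (`mul_integral_mittagLeffler`).

The same Volterra equation is the evolution equation in integrated form: the fractional integral of
`ΔU` is `U(t) - U(0)` (`hasRLIntegral_evolGen`). Its derivative is therefore `dU/dt`, and the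
residual is zero.

That the multiplier `-λ_l` really is the weak Laplacian is a separate matter. The harmonics are an
orthonormal basis (Legendre equation for orthogonality, Stone-Weierstrass for completeness), they
satisfy Green's formula against smooth functions, and Parseval turns this into
`isLaplacianOf_of_coeff`. The expansion of a random field follows by applying Parseval to each
realization and dominated convergence in `ω`. -/

namespace SphereField

/-! ### Diagonal operators along an orthogonal sequence -/

section Diagonal

variable {H : Type*} [NormedAddCommGroup H] [InnerProductSpace ℝ H]

/-- The vector `∑ a l • ζ l`. -/
noncomputable def diagSum (ζ : ℕ → H) (a : ℕ → ℝ) : H := ∑' l, a l • ζ l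

theorem norm_sq_sum_smul_of_orthogonal {ζ : ℕ → H}
    (hζ : Pairwise fun i j => inner ℝ (ζ i) (ζ j) = 0) (a : ℕ → ℝ) (s : Finset ℕ) :
    ‖∑ l ∈ s, a l • ζ l‖ ^ 2 = ∑ l ∈ s, a l ^ 2 * ‖ζ l‖ ^ 2 := by
  rw [← real_inner_self_eq_norm_sq, sum_inner]
  refine Finset.sum_congr rfl fun i hi => ?_
  rw [inner_sum, Finset.sum_eq_single i]
  · rw [real_inner_smul_left, real_inner_smul_right, real_inner_self_eq_norm_sq]; ring
  · intro j _ hj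
    rw [real_inner_smul_left, real_inner_smul_right, hζ hj.symm]; ring
  · exact fun h => absurd hi h

theorem summable_sq_mul {E : Type*} [NormedAddCommGroup E] {ζ : ℕ → E}
    (hs : Summable fun l => ‖ζ l‖ ^ 2) {a : ℕ → ℝ} {C : ℝ} (ha : ∀ l, |a l| ≤ C) :
    Summable fun l => a l ^ 2 * ‖ζ l‖ ^ 2 := by
  refine (hs.mul_left (C ^ 2)).of_nonneg_of_le (fun l => by positivity) fun l => ?_
  gcongr ?_ * _
  exact sq_le_sq' (abs_le.1 (ha l)).1 (abs_le.1 (ha l)).2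

/-- By Pythagoras the squared norm of a finite block equals the same block of a convergent scalar
series, so the Cauchy criterion transfers. -/
theorem hasSum_diagSum [CompleteSpace H] {ζ : ℕ → H}
    (hζ : Pairwise fun i j => inner ℝ (ζ i) (ζ j) = 0)
    (hs : Summable fun l => ‖ζ l‖ ^ 2) {a : ℕ → ℝ} {C : ℝ} (ha : ∀ l, |a l| ≤ C) :
    HasSum (fun l => a l • ζ l) (diagSum ζ a) := by
  refine Summable.hasSum ?_
  rw [summable_iff_vanishing_norm]
  intro ε hε
  obtain ⟨s, hs'⟩ := summable_iff_vanishing_norm.1 (summable_sq_mul hs ha) (ε ^ 2) (by positivity)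
  refine ⟨s, fun t ht => ?_⟩
  have h := hs' t ht
  rw [← norm_sq_sum_smul_of_orthogonal hζ, Real.norm_of_nonneg (by positivity)] at h
  exact lt_of_pow_lt_pow_left₀ 2 hε.le h

variable [CompleteSpace H] {ζ : ℕ → H}

theorem norm_sq_diagSum (hζ : Pairwise fun i j => inner ℝ (ζ i) (ζ j) = 0)
    (hs : Summable fun l => ‖ζ l‖ ^ 2) {a : ℕ → ℝ} {C : ℝ} (ha : ∀ l, |a l| ≤ C) :
    ‖diagSum ζ a‖ ^ 2 = ∑' l, a l ^ 2 * ‖ζ l‖ ^ 2 := by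
  have h1 : Tendsto (fun s : Finset ℕ => ‖∑ l ∈ s, a l • ζ l‖ ^ 2) atTop
      (𝓝 (‖diagSum ζ a‖ ^ 2)) := (hasSum_diagSum hζ hs ha).norm.pow 2
  simp_rw [norm_sq_sum_smul_of_orthogonal hζ] at h1
  have h2 : HasSum (fun l => a l ^ 2 * ‖ζ l‖ ^ 2) (‖diagSum ζ a‖ ^ 2) := h1
  exact h2.tsum_eq.symm

theorem norm_diagSum_le (hζ : Pairwise fun i j => inner ℝ (ζ i) (ζ j) = 0)
    (hs : Summable fun l => ‖ζ l‖ ^ 2) {a : ℕ → ℝ} {C : ℝ} (ha : ∀ l, |a l| ≤ C) :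
    ‖diagSum ζ a‖ ≤ C * Real.sqrt (∑' l, ‖ζ l‖ ^ 2) := by
  have hC : 0 ≤ C := (abs_nonneg _).trans (ha 0)
  refine (sq_le_sq₀ (norm_nonneg _) (by positivity)).1 ?_
  rw [norm_sq_diagSum hζ hs ha, mul_pow, Real.sq_sqrt (tsum_nonneg fun l => by positivity),
    ← tsum_mul_left]
  refine (summable_sq_mul hs ha).tsum_le_tsum (fun l => ?_) (hs.mul_left _)
  gcongr ?_ * _
  exact sq_le_sq' (abs_le.1 (ha l)).1 (abs_le.1 (ha l)).2

omit [CompleteSpace H] in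
theorem norm_sum_range_smul_le (hζ : Pairwise fun i j => inner ℝ (ζ i) (ζ j) = 0)
    (hs : Summable fun l => ‖ζ l‖ ^ 2) {a : ℕ → ℝ} {C : ℝ} (ha : ∀ l, |a l| ≤ C) (n : ℕ) :
    ‖∑ l ∈ Finset.range n, a l • ζ l‖ ≤ C * Real.sqrt (∑' l, ‖ζ l‖ ^ 2) := by
  have hC : 0 ≤ C := (abs_nonneg _).trans (ha 0)
  refine (sq_le_sq₀ (norm_nonneg _) (by positivity)).1 ?_
  rw [norm_sq_sum_smul_of_orthogonal hζ, mul_pow,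
    Real.sq_sqrt (tsum_nonneg fun l => by positivity), ← tsum_mul_left]
  refine le_trans (Finset.sum_le_sum fun l _ => ?_)
    ((hs.mul_left (C ^ 2)).sum_le_tsum (Finset.range n) fun l _ => by positivity)
  gcongr ?_ * _
  exact sq_le_sq' (abs_le.1 (ha l)).1 (abs_le.1 (ha l)).2

theorem diagSum_sub (hζ : Pairwise fun i j => inner ℝ (ζ i) (ζ j) = 0)
    (hs : Summable fun l => ‖ζ l‖ ^ 2) {a b : ℕ → ℝ} {C D : ℝ} (ha : ∀ l, |a l| ≤ C)
    (hb : ∀ l, |b l| ≤ D) : diagSum ζ a - diagSum ζ b = diagSum ζ (fun l => a l - b l) := by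
  have h := (hasSum_diagSum hζ hs ha).sub (hasSum_diagSum hζ hs hb)
  simp_rw [← sub_smul] at h
  exact h.tsum_eq.symm

theorem diagSum_const_mul (hζ : Pairwise fun i j => inner ℝ (ζ i) (ζ j) = 0)
    (hs : Summable fun l => ‖ζ l‖ ^ 2) {a : ℕ → ℝ} {C : ℝ} (ha : ∀ l, |a l| ≤ C) (c : ℝ) :
    c • diagSum ζ a = diagSum ζ (fun l => c * a l) := by
  have h := (hasSum_diagSum hζ hs ha).const_smul c
  simp_rw [smul_smul] at h
  exact h.tsum_eq.symm

/-- Parseval turns the squared distance into a scalar series dominated by `(C + D)² ‖ζ l‖²`. No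
uniformity in `l` of the convergence of coefficients is needed, only a common bound. -/
theorem tendsto_diagSum (hζ : Pairwise fun i j => inner ℝ (ζ i) (ζ j) = 0)
    (hs : Summable fun l => ‖ζ l‖ ^ 2) {ι : Type*} {F : Filter ι} {a : ι → ℕ → ℝ} {b : ℕ → ℝ}
    {C D : ℝ} (ha : ∀ᶠ i in F, ∀ l, |a i l| ≤ C) (hb : ∀ l, |b l| ≤ D)
    (hab : ∀ l, Tendsto (fun i => a i l) F (𝓝 (b l))) :
    Tendsto (fun i => diagSum ζ (a i)) F (𝓝 (diagSum ζ b)) := by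
  rw [tendsto_iff_norm_sub_tendsto_zero]
  have key : Tendsto (fun i => ∑' l, (a i l - b l) ^ 2 * ‖ζ l‖ ^ 2) F
      (𝓝 (∑' l : ℕ, (0 : ℝ) ^ 2 * ‖ζ l‖ ^ 2)) := by
    refine tendsto_tsum_of_dominated_convergence (bound := fun l => (C + D) ^ 2 * ‖ζ l‖ ^ 2)
      (hs.mul_left _) (fun l => ?_) ?_
    · refine Tendsto.mul_const _ (Tendsto.pow ?_ 2)
      simpa using (hab l).sub_const (b l)
    · filter_upwards [ha] with i hi l
      rw [Real.norm_of_nonneg (by positivity)]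
      have h := (abs_sub (a i l) (b l)).trans (add_le_add (hi l) (hb l))
      gcongr ?_ * _
      exact sq_le_sq' (abs_le.1 h).1 (abs_le.1 h).2
  have key2 : Tendsto (fun i => ‖diagSum ζ (a i) - diagSum ζ b‖ ^ 2) F (𝓝 0) := by
    simp only [ne_eq, OfNat.ofNat_ne_zero, not_false_eq_true, zero_pow, zero_mul, tsum_zero] at key
    refine key.congr' ?_
    filter_upwards [ha] with i hi
    rw [diagSum_sub hζ hs hi hb, norm_sq_diagSum hζ hs (C := C + D)]
    exact fun l => (abs_sub (a i l) (b l)).trans (add_le_add (hi l) (hb l))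
  have := key2.sqrt
  simpa using this

/-- The difference quotient is again a diagonal sum. The mean value inequality on the ball bounds
all its coefficients by `C`, and `tendsto_diagSum` applies. -/
theorem hasDerivAt_diagSum (hζ : Pairwise fun i j => inner ℝ (ζ i) (ζ j) = 0)
    (hs : Summable fun l => ‖ζ l‖ ^ 2) {u d : ℝ → ℕ → ℝ} {t C D δ : ℝ} (hδ : 0 < δ)
    (hu : ∀ s ∈ Metric.ball t δ, ∀ l, |u s l| ≤ D)
    (hd : ∀ s ∈ Metric.ball t δ, ∀ l, |d s l| ≤ C)
    (hud : ∀ s ∈ Metric.ball t δ, ∀ l, HasDerivAt (fun s => u s l) (d s l) s) :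
    HasDerivAt (fun s => diagSum ζ (u s)) (diagSum ζ (d t)) t := by
  have ht : t ∈ Metric.ball t δ := Metric.mem_ball_self hδ
  rw [hasDerivAt_iff_tendsto_slope]
  have h1 : Tendsto (fun s => diagSum ζ (fun l => slope (fun s => u s l) t s)) (𝓝[≠] t)
      (𝓝 (diagSum ζ (d t))) := by
    refine tendsto_diagSum hζ hs (C := C) ?_ (hd t ht) fun l =>
      hasDerivAt_iff_tendsto_slope.1 (hud t ht l)
    have hmem : Metric.ball t δ ∈ 𝓝[≠] t := mem_nhdsWithin_of_mem_nhds (Metric.ball_mem_nhds t hδ)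
    filter_upwards [hmem, self_mem_nhdsWithin] with s hs' hne l
    have := (convex_ball t δ).norm_image_sub_le_of_norm_hasDerivWithin_le
      (f := fun s => u s l) (f' := fun s => d s l) (C := C)
      (fun x hx => (hud x hx l).hasDerivWithinAt) (fun x hx => hd x hx l) ht hs'
    rw [slope_def_field, abs_div, div_le_iff₀ (abs_pos.2 (sub_ne_zero.2 hne))]
    simpa using this
  refine h1.congr' ?_
  have hmem : Metric.ball t δ ∈ 𝓝[≠] t := mem_nhdsWithin_of_mem_nhds (Metric.ball_mem_nhds t hδ)
  filter_upwards [hmem] with s hs'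
  rw [slope, vsub_eq_sub, diagSum_sub hζ hs (hu s hs') (hu t ht),
    diagSum_const_mul hζ hs (C := D + D)]
  · rfl
  · exact fun l => (abs_sub _ _).trans (add_le_add (hu s hs' l) (hu t ht l))

/-- Integration of `s ↦ k s • ∑ a s l • ζ l` can be carried out coefficientwise. -/
theorem intervalIntegral_diagSum (hζ : Pairwise fun i j => inner ℝ (ζ i) (ζ j) = 0)
    (hs : Summable fun l => ‖ζ l‖ ^ 2) {k : ℝ → ℝ} {a : ℝ → ℕ → ℝ} {x y C D : ℝ} (hxy : x ≤ y)
    (hk : IntervalIntegrable k volume x y) (ha : ∀ s ∈ Set.Ioc x y, ∀ l, |a s l| ≤ C)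
    (hac : ∀ l, ContinuousOn (fun s => a s l) (Set.Ioc x y))
    (hG : ∀ l, |∫ s in x..y, k s * a s l| ≤ D) :
    ∫ s in x..y, k s • diagSum ζ (a s) = diagSum ζ (fun l => ∫ s in x..y, k s * a s l) := by
  have hint : ∀ l, IntegrableOn (fun s => k s * a s l) (Set.Ioc x y) volume := by
    intro l
    refine Integrable.mul_bdd (c := C) ((intervalIntegrable_iff_integrableOn_Ioc_of_le hxy).1 hk)
      ((hac l).aestronglyMeasurable measurableSet_Ioc) ?_
    exact (ae_restrict_iff' measurableSet_Ioc).2 (ae_of_all _ fun s hs' => ha s hs' l)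
  -- Both sides are limits of the same partial sums: the left by dominated convergence, using the
  -- bound of `norm_sum_range_smul_le`, which does not depend on `n`; the right because the
  -- integrated coefficients are bounded by `D`.
  have h1 : Tendsto (fun n => ∫ s in Set.Ioc x y, ∑ l ∈ Finset.range n, (k s * a s l) • ζ l)
      atTop (𝓝 (∫ s in Set.Ioc x y, k s • diagSum ζ (a s))) := by
    refine tendsto_integral_of_dominated_convergence
      (fun s => ‖k s‖ * (C * Real.sqrt (∑' l, ‖ζ l‖ ^ 2))) (fun n => ?_) ?_ (fun n => ?_) ?_
    · exact (integrable_finsetSum _ fun l _ =>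
        (hint l).smul_const (ζ l)).aestronglyMeasurable
    · exact ((intervalIntegrable_iff_integrableOn_Ioc_of_le hxy).1 hk).norm.mul_const _
    · refine (ae_restrict_iff' measurableSet_Ioc).2 (ae_of_all _ fun s hs' => ?_)
      simp_rw [mul_smul]
      rw [← Finset.smul_sum, norm_smul]
      gcongr
      exact norm_sum_range_smul_le hζ hs (ha s hs') n
    · refine (ae_restrict_iff' measurableSet_Ioc).2 (ae_of_all _ fun s hs' => ?_)
      simp_rw [mul_smul, ← Finset.smul_sum]
      exact ((hasSum_diagSum hζ hs (ha s hs')).tendsto_sum_nat).const_smul _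
  have h2 := (hasSum_diagSum hζ hs hG).tendsto_sum_nat
  rw [intervalIntegral.integral_of_le hxy]
  refine tendsto_nhds_unique h1 (h2.congr fun n => ?_)
  rw [integral_finsetSum _ fun l _ => (hint l).smul_const (ζ l)]
  refine Finset.sum_congr rfl fun l _ => ?_
  rw [integral_smul_const, intervalIntegral.integral_of_le hxy]

end Diagonal

/-! ### Entire power series of fractional powers -/

/-- The sum of the power series with coefficients `b`. -/
noncomputable def pser (b : ℕ → ℝ) (x : ℝ) : ℝ := ∑' k, b k * x ^ k

/-- The power series with coefficients `b` has infinite radius of convergence. -/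
def EntireCoeff (b : ℕ → ℝ) : Prop := ∀ r : ℝ, 0 ≤ r → Summable fun k => |b k| * r ^ k

theorem EntireCoeff.hasSum {b : ℕ → ℝ} (hb : EntireCoeff b) (x : ℝ) :
    HasSum (fun k => b k * x ^ k) (pser b x) := by
  refine Summable.hasSum (Summable.of_norm ?_)
  simpa [abs_mul, abs_pow] using hb |x| (abs_nonneg x)

theorem nat_succ_le_two_pow (k : ℕ) : (k : ℝ) + 1 ≤ 2 ^ k := by
  exact_mod_cast Nat.lt_two_pow_self (n := k)

/-- A geometric factor is harmless when the radius is infinite: it suffices to read `hb` at `R * r`.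
-/
theorem EntireCoeff.mono {b c : ℕ → ℝ} (hb : EntireCoeff b) {R : ℝ} (hR : 0 ≤ R)
    (h : ∀ k, |c k| ≤ |b k| * R ^ k) : EntireCoeff c := fun r hr => by
  refine (hb (R * r) (by positivity)).of_nonneg_of_le (fun k => by positivity) fun k => ?_
  rw [mul_pow, ← mul_assoc]
  exact mul_le_mul_of_nonneg_right (h k) (by positivity)

theorem EntireCoeff.succ {b : ℕ → ℝ} (hb : EntireCoeff b) : EntireCoeff fun k => b (k + 1) := by
  intro r hr
  rcases hr.eq_or_lt with rfl | hr
  · exact summable_of_ne_finset_zero (s := {0}) fun k hk => by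
      simp at hk; simp [hk]
  · have h := ((summable_nat_add_iff 1).2 (hb r hr.le)).mul_right r⁻¹
    refine h.congr fun k => ?_
    rw [pow_succ]
    field_simp

theorem EntireCoeff.deriv {b : ℕ → ℝ} (hb : EntireCoeff b) :
    EntireCoeff fun k => (k + 1 : ℝ) * b (k + 1) := by
  refine hb.succ.mono (R := 2) (by norm_num) fun k => ?_
  rw [abs_mul, mul_comm, abs_of_nonneg (by positivity : (0 : ℝ) ≤ k + 1)]
  exact mul_le_mul_of_nonneg_left (nat_succ_le_two_pow k) (abs_nonneg _)

theorem EntireCoeff.hasDerivAt {b : ℕ → ℝ} (hb : EntireCoeff b) (x : ℝ) :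
    HasDerivAt (pser b) (pser (fun k => (k + 1 : ℝ) * b (k + 1)) x) x := by
  have hd := hb.deriv
  set R : ℝ := |x| + 1
  have hR : 0 ≤ R := by positivity
  have hx : x ∈ Metric.ball (0 : ℝ) R := by simp [R]
  have h := hasDerivAt_tsum_of_isPreconnected
    -- The truncated exponent `k - 1` is immaterial at `k = 0`, where the factor `k` vanishes. That
    -- term is split off afterwards to reindex the series.
    (u := fun k : ℕ => (k : ℝ) * |b k| * R ^ (k - 1)) (t := Metric.ball (0 : ℝ) R)
    (g := fun k y => b k * y ^ k) (g' := fun k y => b k * (k * y ^ (k - 1))) (y₀ := 0) (y := x)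
    ?_ Metric.isOpen_ball (convex_ball 0 R).isPreconnected
    (fun k y _ => (hasDerivAt_pow k y).const_mul (b k)) (fun k y hy => ?_)
    (Metric.mem_ball_self (by positivity)) (hb.hasSum 0).summable hx
  · refine HasDerivAt.congr_deriv (f := pser b) h ?_
    rw [(?_ : Summable fun k : ℕ => b k * (k * x ^ (k - 1))).tsum_eq_zero_add]
    · simp only [Nat.cast_zero, zero_mul, mul_zero, zero_add, Nat.cast_add, Nat.cast_one,
        add_tsub_cancel_right, pser]
      exact tsum_congr fun k => by ring
    · rw [← summable_nat_add_iff 1]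
      refine (hd.hasSum x).summable.congr fun k => ?_
      push_cast
      ring
  · rw [← summable_nat_add_iff 1]
    refine (hd R hR).congr fun k => ?_
    push_cast
    rw [abs_mul, abs_of_nonneg (by positivity : (0 : ℝ) ≤ k + 1)]
  · rw [mem_ball_zero_iff, Real.norm_eq_abs] at hy
    rw [Real.norm_eq_abs, abs_mul, abs_mul, abs_pow, Nat.abs_cast]
    have : |y| ^ (k - 1) ≤ R ^ (k - 1) := pow_le_pow_left₀ (abs_nonneg y) hy.le _
    calc |b k| * (k * |y| ^ (k - 1)) = k * |b k| * |y| ^ (k - 1) := by ring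
      _ ≤ _ := by gcongr

theorem EntireCoeff.continuous {b : ℕ → ℝ} (hb : EntireCoeff b) : Continuous (pser b) :=
  continuous_iff_continuousAt.2 fun x => (hb.hasDerivAt x).continuousAt

theorem pser_neg (b : ℕ → ℝ) (x : ℝ) : pser (fun k => -b k) x = -pser b x := by
  simp [pser, tsum_neg]

theorem EntireCoeff.neg {b : ℕ → ℝ} (hb : EntireCoeff b) : EntireCoeff fun k => -b k := by
  intro r hr
  simpa using hb r hr

/-- Only the interval `(R, R + 1]` of Euler's integral is kept. As `R` is free, `Γ` outgrows every
geometric sequence, and no Stirling estimate is needed. -/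
theorem rpow_le_Gamma {x R : ℝ} (hx : 0 ≤ x) (hR : 0 < R) :
    R ^ x * Real.exp (-(R + 1)) ≤ Real.Gamma (x + 1) := by
  have hint := Real.GammaIntegral_convergent (s := x + 1) (by positivity)
  rw [Real.Gamma_eq_integral (by positivity)]
  have hsub : Set.Ioc R (R + 1) ⊆ Set.Ioi 0 := fun s hs => hR.trans hs.1
  calc R ^ x * Real.exp (-(R + 1))
      = ∫ _ in Set.Ioc R (R + 1), R ^ x * Real.exp (-(R + 1)) := by simp
    _ ≤ ∫ s in Set.Ioc R (R + 1), Real.exp (-s) * s ^ (x + 1 - 1) := by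
        refine setIntegral_mono_on (integrableOn_const (by simp)) (hint.mono_set hsub)
          measurableSet_Ioc
          fun s hs => ?_
        rw [mul_comm, add_sub_cancel_right]
        gcongr
        · exact hs.2
        · exact hs.1.le
    _ ≤ _ := by
        refine setIntegral_mono_set hint ?_ hsub.eventuallyLE
        refine (ae_restrict_iff' measurableSet_Ioi).2 (ae_of_all _ fun s hs => ?_)
        have : (0 : ℝ) < s := hs
        simp only [Pi.zero_apply]
        positivity

theorem entireCoeff_inv_Gamma {α : ℝ} (hα : 0 < α) :
    EntireCoeff fun k => (Real.Gamma (α * k + 1))⁻¹ := by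
  intro r hr
  -- Chosen so that `R ^ α = 2 r + 1`, which leaves a geometric series of ratio `r / (2 r + 1) < 1`.
  set R : ℝ := (2 * r + 1) ^ α⁻¹
  have hR : 0 < R := by positivity
  have hRα : R ^ α = 2 * r + 1 := by
    rw [← Real.rpow_mul (by positivity), inv_mul_cancel₀ hα.ne', Real.rpow_one]
  have hlt : r / (2 * r + 1) < 1 := by rw [div_lt_one (by positivity)]; linarith
  refine ((summable_geometric_of_lt_one (by positivity) hlt).mul_left
    (Real.exp (R + 1))).of_nonneg_of_le (fun k => by positivity) fun k => ?_
  have h := rpow_le_Gamma (x := α * k) (by positivity) hR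
  have hpos : 0 < R ^ (α * k) * Real.exp (-(R + 1)) := by positivity
  rw [abs_of_nonneg (inv_nonneg.2 (hpos.le.trans h))]
  have h2 : (Real.Gamma (α * k + 1))⁻¹ ≤ (R ^ (α * k) * Real.exp (-(R + 1)))⁻¹ :=
    inv_anti₀ hpos h
  refine (mul_le_mul_of_nonneg_right h2 (by positivity)).trans_eq ?_
  rw [Real.rpow_mul hR.le, hRα, Real.rpow_natCast, Real.exp_neg, div_pow]
  field_simp

/-! ### Beta integrals and fractional integration of power series. -/

theorem integral_beta {p q t : ℝ} (hp : 0 < p) (hq : 0 < q) (ht : 0 < t) :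
    ∫ s in (0 : ℝ)..t, (t - s) ^ (q - 1) * s ^ (p - 1) =
      t ^ (p + q - 1) * (Real.Gamma p * Real.Gamma q / Real.Gamma (p + q)) := by
  have h := Complex.betaIntegral_scaled p q ht
  rw [Complex.betaIntegral_eq_Gamma_mul_div _ _ (by simpa) (by simpa)] at h
  rw [← Complex.ofReal_inj, ← intervalIntegral.integral_ofReal]
  push_cast
  rw [← Complex.Gamma_ofReal, ← Complex.Gamma_ofReal, ← Complex.Gamma_ofReal,
    Complex.ofReal_cpow ht.le]
  push_cast
  rw [← h, intervalIntegral.integral_of_le ht.le, intervalIntegral.integral_of_le ht.le]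
  refine setIntegral_congr_fun measurableSet_Ioc fun s hs => ?_
  rw [Complex.ofReal_cpow (sub_nonneg.2 hs.2), Complex.ofReal_cpow hs.1.le, mul_comm]
  push_cast
  rfl

/-- The integral of a nonintegrable function is `0` by convention, whereas the value found in
`integral_beta` is positive. -/
theorem intervalIntegrable_beta {p q t : ℝ} (hp : 0 < p) (hq : 0 < q) (ht : 0 < t) :
    IntervalIntegrable (fun s => (t - s) ^ (q - 1) * s ^ (p - 1)) volume 0 t := by
  refine not_imp_comm.1 intervalIntegral.integral_undef ?_
  rw [integral_beta hp hq ht]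
  have := Real.Gamma_pos_of_pos hp
  have := Real.Gamma_pos_of_pos hq
  have := Real.Gamma_pos_of_pos (add_pos hp hq)
  positivity

theorem integrableOn_beta_mul {f : ℝ → ℝ} (hf : Continuous f) {p q t : ℝ} (hp : 0 < p)
    (hq : 0 < q) (ht : 0 < t) :
    IntervalIntegrable (fun s => (t - s) ^ (q - 1) * s ^ (p - 1) * f s) volume 0 t :=
  (intervalIntegrable_beta hp hq ht).mul_continuousOn hf.continuousOn

/-- Termwise integration, dominated on `(0, t]` by the Beta kernel times `|b k| (t^α)^k`. The case
`p = 1`, `q = α` gives the Volterra equation; `p = α`, `q = 1 - α` gives the Caputo derivative. -/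
theorem EntireCoeff.hasSum_integral_beta {b : ℕ → ℝ} (hb : EntireCoeff b) {α p q t : ℝ}
    (hα : 0 < α) (hp : 0 < p) (hq : 0 < q) (ht : 0 < t) :
    HasSum (fun k : ℕ => b k * (t ^ (α * k + p + q - 1) *
        (Real.Gamma (α * k + p) * Real.Gamma q / Real.Gamma (α * k + p + q))))
      (∫ s in (0 : ℝ)..t, (t - s) ^ (q - 1) * s ^ (p - 1) * pser b (s ^ α)) := by
  have hB := intervalIntegrable_beta hp hq ht
  have hα' : ∀ s ∈ Set.Ioc 0 t, s ^ α ≤ t ^ α := fun s hs =>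
    Real.rpow_le_rpow hs.1.le hs.2 hα.le
  have h := intervalIntegral.hasSum_integral_of_dominated_convergence (a := 0) (b := t)
    (μ := volume)
    (F := fun (k : ℕ) s => (t - s) ^ (q - 1) * s ^ (p - 1) * (b k * (s ^ α) ^ k))
    (f := fun s => (t - s) ^ (q - 1) * s ^ (p - 1) * pser b (s ^ α))
    (fun k s => (t - s) ^ (q - 1) * s ^ (p - 1) * (|b k| * (t ^ α) ^ k))
    (fun k => ?_) (fun k => ?_) ?_ ?_ ?_
  · refine Eq.subst (motive := fun f => HasSum f _) (funext fun k => Eq.symm ?_) h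
    rw [← integral_beta (by positivity) hq ht, ← intervalIntegral.integral_const_mul,
      intervalIntegral.integral_of_le ht.le, intervalIntegral.integral_of_le ht.le]
    refine setIntegral_congr_fun measurableSet_Ioc fun s hs => ?_
    have : s ^ (α * k + p - 1) = s ^ (p - 1) * (s ^ α) ^ k := by
      rw [← Real.rpow_natCast, ← Real.rpow_mul hs.1.le, ← Real.rpow_add hs.1]
      ring_nf
    simp only [this]
    ring
  · exact (integrableOn_beta_mul (f := fun s => b k * (s ^ α) ^ k)
      ((((continuous_id.rpow_const fun _ => Or.inr hα.le)).pow k).const_mul _) hp hq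
      ht).def'.aestronglyMeasurable
  · refine ae_of_all _ fun s hs => ?_
    rw [Set.uIoc_of_le ht.le] at hs
    have h0 : 0 ≤ (t - s) ^ (q - 1) * s ^ (p - 1) :=
      mul_nonneg (Real.rpow_nonneg (sub_nonneg.2 hs.2) _) (Real.rpow_nonneg hs.1.le _)
    rw [norm_mul, Real.norm_of_nonneg h0, norm_mul, norm_pow, Real.norm_eq_abs (b k),
      Real.norm_of_nonneg (Real.rpow_nonneg hs.1.le α)]
    exact mul_le_mul_of_nonneg_left (mul_le_mul_of_nonneg_left (pow_le_pow_left₀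
      (Real.rpow_nonneg hs.1.le α) (hα' s hs) k) (abs_nonneg _)) h0
  · exact ae_of_all _ fun s _ => (hb (t ^ α) (by positivity)).mul_left _
  · simp_rw [tsum_mul_left]
    exact hB.mul_const _
  · exact ae_of_all _ fun s _ => (hb.hasSum _).mul_left _

/-! ### A maximum principle for the Caputo derivative -/

/-- The derivative of `(t - s)^(-α) (w s - w t)` is `(t - s)^(-α) w' s` plus a term that is
nonpositive at a maximum. Using the integrated differential inequality, rather than integration by
parts, avoids any integrability question for the term with `(t - s)^(-α-1)`. -/
theorem le_integral_caputo_of_isMax {α t : ℝ} (hα : 0 < α) (hα₁ : α < 1) (ht : 0 < t)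
    {w w' : ℝ → ℝ} (hw : ContinuousOn w (Set.Icc 0 t))
    (hd : ∀ s, 0 < s → HasDerivAt w (w' s) s)
    (hint : IntervalIntegrable (fun s => (t - s) ^ (-α) * w' s) volume 0 t)
    (hmax : ∀ s ∈ Set.Icc 0 t, w s ≤ w t) :
    t ^ (-α) * (w t - w 0) ≤ ∫ s in (0 : ℝ)..t, (t - s) ^ (-α) * w' s := by
  have hcont : ContinuousOn (fun s => (t - s) ^ (-α) * (w s - w t)) (Set.Icc 0 t) := by
    intro s hs
    rcases hs.2.eq_or_lt with rfl | hst
    -- At the right endpoint differentiability of `w` makes the product `O((t - s)^(1 - α))`, which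
    -- tends to `0` because `α < 1`.
    · have hO : (fun r => w r - w s) =O[𝓝[Set.Icc 0 s] s] fun r => r - s :=
        (hd s ht).differentiableAt.isBigO_sub.mono nhdsWithin_le_nhds
      obtain ⟨C, hC⟩ := hO.bound
      rw [ContinuousWithinAt, sub_self (w s), mul_zero]
      have hlim : Tendsto (fun r => C * (s - r) ^ (1 - α)) (𝓝[Set.Icc 0 s] s) (𝓝 0) := by
        have : Continuous fun r : ℝ => C * (s - r) ^ (1 - α) :=
          ((continuous_const.sub continuous_id).rpow_const
            fun _ => Or.inr (by linarith)).const_mul _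
        have h2 := this.tendsto s
        rw [sub_self, Real.zero_rpow (by linarith), mul_zero] at h2
        exact h2.mono_left nhdsWithin_le_nhds
      refine squeeze_zero_norm' ?_ hlim
      filter_upwards [hC, self_mem_nhdsWithin] with r hr hrs
      rcases hrs.2.eq_or_lt with rfl | hlt
      · simp [Real.zero_rpow (by linarith : 1 - α ≠ 0)]
      · have hpos : 0 < s - r := sub_pos.2 hlt
        rw [norm_mul, Real.norm_of_nonneg (Real.rpow_nonneg hpos.le _)]
        rw [norm_sub_rev r s, Real.norm_of_nonneg hpos.le] at hr
        calc _ ≤ (s - r) ^ (-α) * (C * (s - r)) := by gcongr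
          _ = C * ((s - r) ^ (-α) * (s - r) ^ (1 : ℝ)) := by rw [Real.rpow_one]; ring
          _ = _ := by rw [← Real.rpow_add hpos]; ring_nf
    · refine ContinuousWithinAt.mul ?_ ((hw s hs).sub continuousWithinAt_const)
      exact ((continuousAt_const.sub continuousAt_id).rpow_const
        (Or.inl (sub_pos.2 hst).ne')).continuousWithinAt
  have h := intervalIntegral.sub_le_integral_of_hasDeriv_right_of_le ht.le hcont
    (g' := fun s => -(-α * (t - s) ^ (-α - 1)) * (w s - w t) + (t - s) ^ (-α) * w' s)
    (φ := fun s => (t - s) ^ (-α) * w' s) (fun s hs => ?_)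
    ((intervalIntegrable_iff_integrableOn_Icc_of_le ht.le).1 hint) (fun s hs => ?_)
  · refine le_trans (le_of_eq ?_) h
    simp only [sub_self, mul_zero, sub_zero]
    ring
  · have h1 : HasDerivAt (fun s => (t - s) ^ (-α)) (-(-α * (t - s) ^ (-α - 1))) s := by
      have h2 : HasDerivAt (fun s : ℝ => t - s) (-1) s := by
        simpa using (hasDerivAt_id s).const_sub t
      convert h2.rpow_const (p := -α) (Or.inl (sub_pos.2 hs.2).ne') using 1
      ring
    exact (h1.mul ((hd s hs.1).sub_const (w t))).hasDerivWithinAt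
  · have h1 : 0 ≤ α * (t - s) ^ (-α - 1) * (w t - w s) :=
      mul_nonneg (mul_nonneg hα.le (Real.rpow_nonneg (sub_pos.2 hs.2).le _))
        (sub_nonneg.2 (hmax s ⟨hs.1.le, hs.2.le⟩))
    linarith

/-- The Caputo derivative of `w(t) = ∑ β k (tᵅ)ᵏ / Γ(α k + 1)` is
`∑ β (k + 1) (tᵅ)ᵏ / Γ(α k + 1)`, which is nonnegative at a maximum. -/
theorem caputo_pser_of_isMax {α t : ℝ} (hα : 0 < α) (hα₁ : α < 1) (ht : 0 < t) {β : ℕ → ℝ}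
    (hβ : EntireCoeff fun k => β k * (Real.Gamma (α * k + 1))⁻¹)
    (hmax : ∀ s ∈ Set.Icc 0 t, pser (fun k => β k * (Real.Gamma (α * k + 1))⁻¹) (s ^ α) ≤
      pser (fun k => β k * (Real.Gamma (α * k + 1))⁻¹) (t ^ α)) :
    t ^ (-α) * (pser (fun k => β k * (Real.Gamma (α * k + 1))⁻¹) (t ^ α) - β 0) ≤
      Real.Gamma (1 - α) * pser (fun k => β (k + 1) * (Real.Gamma (α * k + 1))⁻¹) (t ^ α) := by
  set b : ℕ → ℝ := fun k => β k * (Real.Gamma (α * k + 1))⁻¹ with hb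
  have hb0 : pser b (0 ^ α) = β 0 := by
    rw [Real.zero_rpow hα.ne', pser, tsum_eq_single 0]
    · simp [b]
    · intro k hk; simp [hk]
  have hΓ : 0 < Real.Gamma (1 - α) := Real.Gamma_pos_of_pos (by linarith)
  set b' : ℕ → ℝ := fun k => (k + 1 : ℝ) * b (k + 1)
  have hd : ∀ s, 0 < s → HasDerivAt (fun s => pser b (s ^ α))
      (pser b' (s ^ α) * (α * s ^ (α - 1))) s := fun s hs =>
    HasDerivAt.comp (h₂ := pser b) (h := fun s => s ^ α) s (hβ.hasDerivAt (s ^ α))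
      (Real.hasDerivAt_rpow_const (Or.inl hs.ne'))
  have heq : ∀ s, (t - s) ^ (-α) * (pser b' (s ^ α) * (α * s ^ (α - 1))) =
      α * ((t - s) ^ ((1 - α) - 1) * s ^ (α - 1) * pser b' (s ^ α)) := by
    intro s
    rw [show (1 - α) - 1 = -α by ring]; ring
  have hcα : Continuous fun s : ℝ => s ^ α := continuous_id.rpow_const fun _ => Or.inr hα.le
  have h := le_integral_caputo_of_isMax hα hα₁ ht (w := fun s => pser b (s ^ α))
    (hβ.continuous.comp hcα).continuousOn hd ?_ hmax
  · rw [hb0] at h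
    refine h.trans_eq ?_
    simp_rw [heq]
    rw [intervalIntegral.integral_const_mul]
    have hS := ((hβ.deriv).hasSum_integral_beta hα hα (q := 1 - α) (by linarith) ht).mul_left α
    rw [← hS.tsum_eq, pser, ← tsum_mul_left]
    refine tsum_congr fun k => ?_
    -- The factor `α (k + 1)` produced by differentiating `s^(α (k + 1))` cancels here.
    have h1 : Real.Gamma (α * k + α + 1) = (α * k + α) * Real.Gamma (α * k + α) :=
      Real.Gamma_add_one (by positivity)
    have h2 : 0 < Real.Gamma (α * k + α) := Real.Gamma_pos_of_pos (by positivity)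
    have h3 : 0 < Real.Gamma (α * k + 1) := Real.Gamma_pos_of_pos (by positivity)
    have h4 : t ^ (α * k + α + (1 - α) - 1) = (t ^ α) ^ k := by
      rw [← Real.rpow_natCast, ← Real.rpow_mul ht.le]; ring_nf
    have h5 : α * k + α + (1 - α) = α * k + 1 := by ring
    have h6 : α * ((k + 1 : ℕ) : ℝ) + 1 = α * k + α + 1 := by push_cast; ring
    simp only [hb]
    rw [h4, h5, h6, h1]
    field_simp
  · simp_rw [heq]
    exact (integrableOn_beta_mul (hβ.deriv.continuous.comp hcα) hα (by linarith) ht).const_mul α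

/-! ### The Mittag-Leffler function on the negative half-line -/

/-- The coefficients of `x ↦ E_α(-x)`. -/
noncomputable def mlCoeff (α : ℝ) (k : ℕ) : ℝ := (-1) ^ k * (Real.Gamma (α * k + 1))⁻¹

/-- The derivative of `x ↦ E_α(-x)`. -/
noncomputable def mlDeriv (α : ℝ) : ℝ → ℝ := pser fun k => (k + 1 : ℝ) * mlCoeff α (k + 1)

theorem entireCoeff_mlCoeff {α : ℝ} (hα : 0 < α) : EntireCoeff (mlCoeff α) :=
  (entireCoeff_inv_Gamma hα).mono (R := 1) (by norm_num) fun k => by simp [mlCoeff, abs_mul]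

theorem mittagLeffler_neg (α x : ℝ) : mittagLeffler α 1 (-x) = pser (mlCoeff α) x := by
  refine tsum_congr fun k => ?_
  rw [mlCoeff, neg_pow, div_eq_mul_inv]
  ring

theorem mittagLeffler_zero (α : ℝ) : mittagLeffler α 1 0 = 1 := by
  rw [mittagLeffler, tsum_eq_single 0]
  · simp
  · intro k hk; simp [hk]

theorem hasDerivAt_mittagLeffler_neg {α : ℝ} (hα : 0 < α) (x : ℝ) :
    HasDerivAt (fun x => mittagLeffler α 1 (-x)) (mlDeriv α x) x := by
  simp_rw [mittagLeffler_neg]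
  exact (entireCoeff_mlCoeff hα).hasDerivAt x

theorem continuous_mittagLeffler_neg {α : ℝ} (hα : 0 < α) :
    Continuous fun x => mittagLeffler α 1 (-x) :=
  continuous_iff_continuousAt.2 fun x => (hasDerivAt_mittagLeffler_neg hα x).continuousAt

/-- `E_α(-λ tᵅ)` solves the Volterra equation `u = 1 - λ Jᵅ u`. -/
theorem mul_integral_mittagLeffler {α c t : ℝ} (hα : 0 < α) (ht : 0 < t) :
    c * ∫ s in (0 : ℝ)..t, (t - s) ^ (α - 1) * mittagLeffler α 1 (-(c * s ^ α)) =
      Real.Gamma α * (1 - mittagLeffler α 1 (-(c * t ^ α))) := by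
  have hb : EntireCoeff fun k => c ^ k * mlCoeff α k :=
    (entireCoeff_mlCoeff hα).mono (abs_nonneg c) fun k => by
      rw [abs_mul, abs_pow, mul_comm]
  have hp : ∀ x, mittagLeffler α 1 (-(c * x)) = pser (fun k => c ^ k * mlCoeff α k) x := by
    intro x
    rw [mittagLeffler_neg]
    exact tsum_congr fun k => by rw [mul_pow]; ring
  simp_rw [hp]
  have h := (hb.hasSum_integral_beta hα (p := 1) one_pos hα ht).mul_left c
  simp only [sub_self, Real.rpow_zero, mul_one] at h
  -- Fractional integration shifts the index by one, so the constant term `1` of the series is split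
  -- off before comparison.
  rw [← h.tsum_eq, pser, (hb.hasSum (t ^ α)).summable.tsum_eq_zero_add]
  have h0 : c ^ 0 * mlCoeff α 0 * (t ^ α) ^ 0 = 1 := by simp [mlCoeff]
  rw [h0, sub_add_cancel_left, ← tsum_neg, ← tsum_mul_left]
  refine tsum_congr fun k => ?_
  have h3 : 0 < Real.Gamma (α * k + 1) := Real.Gamma_pos_of_pos (by positivity)
  have h4 : t ^ (α * k + 1 + α - 1) = (t ^ α) ^ (k + 1) := by
    rw [← Real.rpow_natCast, ← Real.rpow_mul ht.le]; push_cast; ring_nf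
  have h5 : α * k + 1 + α = α * ((k + 1 : ℕ) : ℝ) + 1 := by push_cast; ring
  have h6 : 0 < Real.Gamma (α * ((k + 1 : ℕ) : ℝ) + 1) := Real.Gamma_pos_of_pos (by positivity)
  rw [h4, h5]
  simp only [mlCoeff]
  field_simp
  ring

/-- For `x = t^α` and `u(t) = E_α(-t^α)` the sum is `t u'(t)`. The coefficients are put in the form
`β k / Γ(α k + 1)` that `caputo_pser_of_isMax` takes. -/
theorem mul_mlDeriv {α : ℝ} (hα : 0 < α) (x : ℝ) :
    HasSum (fun k : ℕ => (α * k * (-1) ^ k) * (Real.Gamma (α * k + 1))⁻¹ * x ^ k)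
      (α * x * mlDeriv α x) := by
  have h := ((entireCoeff_mlCoeff hα).deriv.hasSum x).mul_left (α * x)
  rw [← hasSum_nat_add_iff' 1]
  simp only [Finset.range_one, Finset.sum_singleton, CharP.cast_eq_zero, mul_zero, zero_mul,
    sub_zero]
  refine Eq.subst (motive := fun f => HasSum f _) (funext fun k => ?_) h
  simp only [mlCoeff]
  push_cast
  ring

theorem entireCoeff_mul_mlCoeff {α : ℝ} (hα : 0 < α) :
    EntireCoeff fun k : ℕ => (α * k * (-1) ^ k) * (Real.Gamma (α * k + 1))⁻¹ := by
  intro r hr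
  have h := (mul_mlDeriv hα r).summable
  have h2 := h.abs
  refine h2.congr fun k => ?_
  rw [abs_mul, abs_pow, abs_of_nonneg hr]

/-- The Caputo derivative of `t u'` is `-t u' - α u`, because `α (k + 1) = α k + α`. Both one-sided
bounds on `t u'` rest on this and on `0 ≤ u ≤ 1`. -/
theorem pser_caputo_mul_mlDeriv {α : ℝ} (hα : 0 < α) (x : ℝ) :
    pser (fun k : ℕ => (α * ((k + 1 : ℕ) : ℝ) * (-1) ^ (k + 1)) * (Real.Gamma (α * k + 1))⁻¹) x =
      -(α * x * mlDeriv α x) - α * mittagLeffler α 1 (-x) := by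
  rw [mittagLeffler_neg]
  have h := (mul_mlDeriv hα x).neg.sub (((entireCoeff_mlCoeff hα).hasSum x).mul_left α)
  rw [← h.tsum_eq]
  refine tsum_congr fun k => ?_
  simp only [mlCoeff]
  push_cast
  ring

theorem exists_rpow_eq {α x : ℝ} (hα : 0 < α) (hx : 0 < x) : ∃ t : ℝ, 0 < t ∧ t ^ α = x :=
  ⟨x ^ α⁻¹, by positivity, by
    rw [← Real.rpow_mul hx.le, inv_mul_cancel₀ hα.ne', Real.rpow_one]⟩

/-- If every interval `[0, t]` on which `w` has a positive maximum at its right end `t` is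
impossible, then `w` is nonpositive. -/
theorem nonpos_of_forall_isMax {w : ℝ → ℝ} (hw : Continuous w)
    (h0 : w 0 ≤ 0) (h : ∀ t, 0 < t → 0 < w t → (∀ s ∈ Set.Icc 0 t, w s ≤ w t) → False) {T : ℝ}
    (hT : 0 ≤ T) : w T ≤ 0 := by
  obtain ⟨t, ht, hmax⟩ := isCompact_Icc.exists_isMaxOn (Set.nonempty_Icc.2 hT) hw.continuousOn
  by_contra! hpos
  have hpt : 0 < w t := hpos.trans_le (hmax ⟨hT, le_rfl⟩)
  have ht0 : 0 < t := lt_of_le_of_ne ht.1 (by rintro rfl; linarith)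
  exact h t ht0 hpt fun s hs => hmax ⟨hs.1, hs.2.trans ht.2⟩

/-- The Caputo derivative of `w = -u` is `u`. At a positive maximum of `w` it would be negative,
while the maximum principle bounds it below by a positive multiple of `w t - w 0 = w t + 1`. -/
theorem mittagLeffler_neg_nonneg_of_lt_one {α x : ℝ} (hα : 0 < α) (hα₁ : α < 1) (hx : 0 ≤ x) :
    0 ≤ mittagLeffler α 1 (-x) := by
  rcases hx.eq_or_lt with rfl | hx
  · simp [mittagLeffler_zero]
  obtain ⟨T, hT, rfl⟩ := exists_rpow_eq hα hx
  have hcα : Continuous fun s : ℝ => s ^ α := continuous_id.rpow_const fun _ => Or.inr hα.le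
  have hβ : EntireCoeff fun k : ℕ => (-(-1) ^ k) * (Real.Gamma (α * k + 1))⁻¹ := by
    convert (entireCoeff_mlCoeff hα).neg using 2 with k
    rw [mlCoeff]; ring
  have e1 : ∀ y, pser (fun k : ℕ => (-(-1) ^ k) * (Real.Gamma (α * k + 1))⁻¹) y =
      -mittagLeffler α 1 (-y) := fun y => by
    rw [mittagLeffler_neg, ← pser_neg]
    congr 1; ext k; rw [mlCoeff]; ring
  have e2 : ∀ y, pser (fun k : ℕ => (-(-1) ^ (k + 1)) * (Real.Gamma (α * k + 1))⁻¹) y =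
      mittagLeffler α 1 (-y) := fun y => by
    rw [mittagLeffler_neg]
    congr 1; ext k; rw [mlCoeff]; ring
  have hΓ : 0 < Real.Gamma (1 - α) := Real.Gamma_pos_of_pos (by linarith)
  refine neg_nonpos.1 (nonpos_of_forall_isMax
    (w := fun s => -mittagLeffler α 1 (-s ^ α))
    ((continuous_mittagLeffler_neg hα).comp hcα).neg ?_ (fun t ht hpos hmax => ?_) hT.le)
  · simp [Real.zero_rpow hα.ne', mittagLeffler_zero]
  · have h := caputo_pser_of_isMax hα hα₁ ht hβ (by simpa only [e1] using hmax)
    rw [e1, e2] at h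
    have h1 : 0 < t ^ (-α) * (-mittagLeffler α 1 (-t ^ α) - -(-1) ^ 0) := by
      have : 0 < t ^ (-α) := by positivity
      refine mul_pos this ?_
      simp only [pow_zero, sub_neg_eq_add]
      linarith
    have h2 : Real.Gamma (1 - α) * mittagLeffler α 1 (-t ^ α) < 0 :=
      mul_neg_of_pos_of_neg hΓ (by linarith)
    linarith

theorem mul_integral_mittagLeffler_one {α t : ℝ} (hα : 0 < α) (ht : 0 < t) :
    ∫ s in (0 : ℝ)..t, (t - s) ^ (α - 1) * mittagLeffler α 1 (-s ^ α) =
      Real.Gamma α * (1 - mittagLeffler α 1 (-t ^ α)) := by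
  simpa using mul_integral_mittagLeffler (c := 1) hα ht

theorem intervalIntegrable_rpow_sub_mul {α c t : ℝ} (hα : 0 < α) (ht : 0 < t) :
    IntervalIntegrable (fun s => (t - s) ^ (α - 1) * mittagLeffler α 1 (-(c * s ^ α)))
      volume 0 t := by
  have hcα : Continuous fun s : ℝ => c * s ^ α :=
    (continuous_id.rpow_const fun _ => Or.inr hα.le).const_mul c
  simpa using integrableOn_beta_mul ((continuous_mittagLeffler_neg hα).comp hcα)
    (p := 1) one_pos hα ht

/-- In the Volterra equation `1 - u` is a fractional integral of the nonnegative function `u`. -/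
theorem mittagLeffler_neg_le_one_of_nonneg {α : ℝ} (hα : 0 < α)
    (h : ∀ x, 0 ≤ x → 0 ≤ mittagLeffler α 1 (-x)) {x : ℝ} (hx : 0 ≤ x) :
    mittagLeffler α 1 (-x) ≤ 1 := by
  rcases hx.eq_or_lt with rfl | hx
  · simp [mittagLeffler_zero]
  obtain ⟨t, ht, rfl⟩ := exists_rpow_eq hα hx
  have h1 : 0 ≤ ∫ s in (0 : ℝ)..t, (t - s) ^ (α - 1) * mittagLeffler α 1 (-s ^ α) :=
    intervalIntegral.integral_nonneg ht.le fun s hs =>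
      mul_nonneg (Real.rpow_nonneg (sub_nonneg.2 hs.2) _) (h _ (Real.rpow_nonneg hs.1 _))
  rw [mul_integral_mittagLeffler_one hα ht] at h1
  have := (mul_nonneg_iff_of_pos_left (Real.Gamma_pos_of_pos hα)).1 h1
  linarith

/-- Maximum principle for `w = t u'`, which vanishes at `0`: at a positive maximum its Caputo
derivative `-w - α u` would be negative, as `u ≥ 0`. -/
theorem mul_mlDeriv_nonpos_of_lt_one {α x : ℝ} (hα : 0 < α) (hα₁ : α < 1) (hx : 0 ≤ x) :
    x * mlDeriv α x ≤ 0 := by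
  rcases hx.eq_or_lt with rfl | hx
  · simp
  obtain ⟨T, hT, rfl⟩ := exists_rpow_eq hα hx
  have hcα : Continuous fun s : ℝ => s ^ α := continuous_id.rpow_const fun _ => Or.inr hα.le
  have hd : Continuous (mlDeriv α) := (entireCoeff_mlCoeff hα).deriv.continuous
  have hΓ : 0 < Real.Gamma (1 - α) := Real.Gamma_pos_of_pos (by linarith)
  have key : α * T ^ α * mlDeriv α (T ^ α) ≤ 0 := by
    refine nonpos_of_forall_isMax (w := fun s => α * s ^ α * mlDeriv α (s ^ α))
      ((hcα.const_mul α).mul (hd.comp hcα)) ?_ (fun t ht hpos hmax => ?_) hT.le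
    · simp [Real.zero_rpow hα.ne']
    · have e1 := fun y => (mul_mlDeriv hα y).tsum_eq
      have h := caputo_pser_of_isMax hα hα₁ ht (entireCoeff_mul_mlCoeff hα)
        (by simpa only [pser, e1] using hmax)
      rw [pser_caputo_mul_mlDeriv hα, pser, e1] at h
      have h1 : 0 < t ^ (-α) * (α * t ^ α * mlDeriv α (t ^ α) - α * ((0 : ℕ) : ℝ) * (-1) ^ 0) := by
        simp only [Nat.cast_zero, mul_zero, zero_mul, sub_zero]
        have : 0 < t ^ (-α) := by positivity
        exact mul_pos this hpos
      have h3 := mittagLeffler_neg_nonneg_of_lt_one hα hα₁ (x := t ^ α) (by positivity)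
      have h4 : 0 ≤ α * mittagLeffler α 1 (-t ^ α) := mul_nonneg hα.le h3
      have h2 := mul_neg_of_pos_of_neg hΓ
        (by linarith : -(α * t ^ α * mlDeriv α (t ^ α)) - α * mittagLeffler α 1 (-t ^ α) < 0)
      linarith
  rw [mul_assoc] at key
  exact nonpos_of_mul_nonpos_right key hα

/-- Maximum principle for `-t u'`. Where it exceeds `α`, its Caputo derivative `t u' + α u` is
negative because `u ≤ 1`. The threshold `α` is subtracted only to locate the maximum, which a
constant does not move. -/
theorem neg_one_le_mul_mlDeriv_of_lt_one {α x : ℝ} (hα : 0 < α) (hα₁ : α < 1) (hx : 0 ≤ x) :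
    -1 ≤ x * mlDeriv α x := by
  rcases hx.eq_or_lt with rfl | hx
  · simp
  obtain ⟨T, hT, rfl⟩ := exists_rpow_eq hα hx
  have hcα : Continuous fun s : ℝ => s ^ α := continuous_id.rpow_const fun _ => Or.inr hα.le
  have hd : Continuous (mlDeriv α) := (entireCoeff_mlCoeff hα).deriv.continuous
  have hΓ : 0 < Real.Gamma (1 - α) := Real.Gamma_pos_of_pos (by linarith)
  have hβ : EntireCoeff fun k : ℕ => (-(α * k * (-1) ^ k)) * (Real.Gamma (α * k + 1))⁻¹ := by
    simpa only [neg_mul] using (entireCoeff_mul_mlCoeff hα).neg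
  have e1 : ∀ y, pser (fun k : ℕ => (-(α * k * (-1) ^ k)) * (Real.Gamma (α * k + 1))⁻¹) y =
      -(α * y * mlDeriv α y) := fun y => by
    rw [← (mul_mlDeriv hα y).tsum_eq]
    simp only [neg_mul]
    rw [pser_neg]; rfl
  have e2 : ∀ y, pser (fun k : ℕ => (-(α * ((k + 1 : ℕ) : ℝ) * (-1) ^ (k + 1))) *
      (Real.Gamma (α * k + 1))⁻¹) y = α * y * mlDeriv α y + α * mittagLeffler α 1 (-y) :=
    fun y => by
    simp only [neg_mul]
    rw [pser_neg]
    have := pser_caputo_mul_mlDeriv hα y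
    rw [this]; ring
  have key : -(α * T ^ α * mlDeriv α (T ^ α)) - α ≤ 0 := by
    refine nonpos_of_forall_isMax (w := fun s => -(α * s ^ α * mlDeriv α (s ^ α)) - α)
      (((hcα.const_mul α).mul (hd.comp hcα)).neg.sub continuous_const) ?_
      (fun t ht hpos hmax => ?_) hT.le
    · simp [Real.zero_rpow hα.ne', hα.le]
    · have h := caputo_pser_of_isMax hα hα₁ ht hβ
        (fun s hs => by rw [e1, e1]; linarith [hmax s hs])
      rw [e1, e2] at h
      have h1 : 0 < t ^ (-α) *
          (-(α * t ^ α * mlDeriv α (t ^ α)) - -(α * ((0 : ℕ) : ℝ) * (-1) ^ 0)) := by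
        simp only [Nat.cast_zero, mul_zero, zero_mul, sub_zero, neg_zero]
        have : 0 < t ^ (-α) := by positivity
        exact mul_pos this (by linarith)
      have h3 := mittagLeffler_neg_le_one_of_nonneg hα
        (fun x hx => mittagLeffler_neg_nonneg_of_lt_one hα hα₁ hx) (x := t ^ α) (by positivity)
      have h4 : α * mittagLeffler α 1 (-t ^ α) ≤ α * 1 := mul_le_mul_of_nonneg_left h3 hα.le
      have h2 := mul_neg_of_pos_of_neg hΓ
        (by linarith : α * t ^ α * mlDeriv α (t ^ α) + α * mittagLeffler α 1 (-t ^ α) < 0)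
      linarith
  nlinarith

/-- Since `u` decreases, replacing `u(s)` by `u(t)` in the Volterra integral gives `(t^α / α) u(t) ≤
Γ(α) (1 - u(t)) ≤ Γ(α)`. -/
theorem mul_mittagLeffler_neg_le_of_lt_one {α x : ℝ} (hα : 0 < α) (hα₁ : α < 1) (hx : 0 ≤ x) :
    x * mittagLeffler α 1 (-x) ≤ Real.Gamma (α + 1) := by
  have hanti : AntitoneOn (fun x => mittagLeffler α 1 (-x)) (Set.Ici 0) := by
    refine antitoneOn_of_deriv_nonpos (convex_Ici 0) (continuous_mittagLeffler_neg hα).continuousOn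
      (fun y _ => (hasDerivAt_mittagLeffler_neg hα y).differentiableAt.differentiableWithinAt)
      fun y hy => ?_
    rw [interior_Ici] at hy
    rw [(hasDerivAt_mittagLeffler_neg hα y).deriv]
    exact nonpos_of_mul_nonpos_right (mul_mlDeriv_nonpos_of_lt_one hα hα₁ (le_of_lt hy)) hy
  rcases hx.eq_or_lt with rfl | hx
  · simpa using (Real.Gamma_pos_of_pos (by linarith : 0 < α + 1)).le
  obtain ⟨t, ht, rfl⟩ := exists_rpow_eq hα hx
  have h0 := mittagLeffler_neg_nonneg_of_lt_one hα hα₁ hx.le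
  have hk : IntervalIntegrable (fun s => (t - s) ^ (α - 1)) volume 0 t := by
    simpa using intervalIntegrable_beta (p := 1) one_pos hα ht
  have hI : ∫ s in (0 : ℝ)..t, (t - s) ^ (α - 1) = t ^ α / α := by
    have h := integral_beta (p := 1) one_pos hα ht
    have h2 := Real.Gamma_pos_of_pos hα
    rw [add_comm 1 α, Real.Gamma_add_one hα.ne', Real.Gamma_one] at h
    simp only [sub_self, Real.rpow_zero, mul_one, add_sub_cancel_right] at h
    rw [h]; field_simp
  have h1 : ∫ s in (0 : ℝ)..t, (t - s) ^ (α - 1) * mittagLeffler α 1 (-t ^ α) ≤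
      ∫ s in (0 : ℝ)..t, (t - s) ^ (α - 1) * mittagLeffler α 1 (-s ^ α) := by
    refine intervalIntegral.integral_mono_on ht.le (hk.mul_const _)
      (by simpa using intervalIntegrable_rpow_sub_mul (c := 1) hα ht) fun s hs => ?_
    refine mul_le_mul_of_nonneg_left ?_ (Real.rpow_nonneg (sub_nonneg.2 hs.2) _)
    exact hanti (Real.rpow_nonneg hs.1 _) hx.le (Real.rpow_le_rpow hs.1 hs.2 hα.le)
  rw [mul_integral_mittagLeffler_one hα ht, intervalIntegral.integral_mul_const, hI] at h1
  have h2 := Real.Gamma_pos_of_pos hα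
  rw [Real.Gamma_add_one hα.ne']
  have h3 : Real.Gamma α * (1 - mittagLeffler α 1 (-t ^ α)) ≤ Real.Gamma α * 1 :=
    mul_le_mul_of_nonneg_left (by linarith) h2.le
  have h4 : t ^ α * mittagLeffler α 1 (-t ^ α) =
      α * (t ^ α / α * mittagLeffler α 1 (-t ^ α)) := by field_simp
  rw [h4]
  exact mul_le_mul_of_nonneg_left (by linarith) hα.le

/-! ### The exponential case, and the bounds for all `0 < α ≤ 1`. -/

theorem mittagLeffler_one_one (x : ℝ) : mittagLeffler 1 1 x = Real.exp x := by
  rw [Real.exp_eq_exp_ℝ, NormedSpace.exp_eq_tsum_div]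
  refine tsum_congr fun k => ?_
  rw [one_mul, Real.Gamma_nat_eq_factorial]

theorem mlDeriv_one (x : ℝ) : mlDeriv 1 x = -Real.exp (-x) := by
  have h1 := hasDerivAt_mittagLeffler_neg one_pos x
  simp_rw [mittagLeffler_one_one] at h1
  have h2 : HasDerivAt (fun x : ℝ => Real.exp (-x)) (Real.exp (-x) * -1) x :=
    (hasDerivAt_neg x).exp
  rw [h1.unique h2]; ring

theorem mul_exp_neg_le_one {x : ℝ} : x * Real.exp (-x) ≤ 1 := by
  have h := Real.add_one_le_exp x
  rw [Real.exp_neg]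
  exact (mul_inv_le_iff₀ (Real.exp_pos x)).2 (by linarith)

variable {α : ℝ}

theorem mittagLeffler_neg_nonneg (hα : 0 < α) (hα₁ : α ≤ 1) {x : ℝ} (hx : 0 ≤ x) :
    0 ≤ mittagLeffler α 1 (-x) := by
  rcases hα₁.eq_or_lt with rfl | h
  · rw [mittagLeffler_one_one]; positivity
  · exact mittagLeffler_neg_nonneg_of_lt_one hα h hx

theorem mittagLeffler_neg_le_one (hα : 0 < α) (hα₁ : α ≤ 1) {x : ℝ} (hx : 0 ≤ x) :
    mittagLeffler α 1 (-x) ≤ 1 :=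
  mittagLeffler_neg_le_one_of_nonneg hα (fun _ => mittagLeffler_neg_nonneg hα hα₁) hx

theorem abs_mul_mlDeriv_le (hα : 0 < α) (hα₁ : α ≤ 1) {x : ℝ} (hx : 0 ≤ x) :
    |x * mlDeriv α x| ≤ 1 := by
  rcases hα₁.eq_or_lt with rfl | h
  · rw [mlDeriv_one, mul_neg, abs_neg, abs_of_nonneg (by positivity)]
    exact mul_exp_neg_le_one
  · exact abs_le.2 ⟨neg_one_le_mul_mlDeriv_of_lt_one hα h hx,
      (mul_mlDeriv_nonpos_of_lt_one hα h hx).trans zero_le_one⟩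

theorem mul_mittagLeffler_neg_le (hα : 0 < α) (hα₁ : α ≤ 1) {x : ℝ} (hx : 0 ≤ x) :
    x * mittagLeffler α 1 (-x) ≤ Real.Gamma (α + 1) := by
  rcases hα₁.eq_or_lt with rfl | h
  · rw [mittagLeffler_one_one, show (1 : ℝ) + 1 = 2 by norm_num, Real.Gamma_two]
    exact mul_exp_neg_le_one
  · exact mul_mittagLeffler_neg_le_of_lt_one hα h hx

/-! ### The fractional evolution along an orthogonal sequence -/

section Relaxation

variable {α c : ℝ}

theorem hasDerivAt_relaxation (hα : 0 < α) {t : ℝ} (ht : 0 < t) :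
    HasDerivAt (fun t => mittagLeffler α 1 (-c * t ^ α))
      (mlDeriv α (c * t ^ α) * (c * (α * t ^ (α - 1)))) t := by
  have h := HasDerivAt.comp (h₂ := fun x => mittagLeffler α 1 (-x)) (h := fun s => c * s ^ α) t
    (hasDerivAt_mittagLeffler_neg hα _)
    ((Real.hasDerivAt_rpow_const (p := α) (Or.inl ht.ne')).const_mul c)
  simpa only [neg_mul] using! h

theorem continuous_relaxation (hα : 0 < α) :
    Continuous fun t => mittagLeffler α 1 (-c * t ^ α) := by
  simp_rw [neg_mul]
  exact (continuous_mittagLeffler_neg hα).comp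
    ((continuous_id.rpow_const fun _ => Or.inr hα.le).const_mul c)

theorem relaxation_nonneg (hα : 0 < α) (hα₁ : α ≤ 1) (hc : 0 ≤ c) {t : ℝ} (ht : 0 ≤ t) :
    0 ≤ mittagLeffler α 1 (-c * t ^ α) := by
  rw [neg_mul]
  exact mittagLeffler_neg_nonneg hα hα₁ (by positivity)

theorem abs_relaxation_le (hα : 0 < α) (hα₁ : α ≤ 1) (hc : 0 ≤ c) {t : ℝ} (ht : 0 ≤ t) :
    |mittagLeffler α 1 (-c * t ^ α)| ≤ 1 := by
  rw [abs_of_nonneg (relaxation_nonneg hα hα₁ hc ht), neg_mul]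
  exact mittagLeffler_neg_le_one hα hα₁ (by positivity)

/-- The bound does not depend on `c`: for `t > 0` decay of the Mittag-Leffler function absorbs the
unbounded eigenvalue, at the price of the singularity `t^(-α)`. -/
theorem abs_mul_relaxation_le (hα : 0 < α) (hα₁ : α ≤ 1) (hc : 0 ≤ c) {t : ℝ} (ht : 0 < t) :
    |-c * mittagLeffler α 1 (-c * t ^ α)| ≤ Real.Gamma (α + 1) * t ^ (-α) := by
  have h := mul_mittagLeffler_neg_le hα hα₁ (x := c * t ^ α) (by positivity)
  have h0 := relaxation_nonneg hα hα₁ hc ht.le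
  rw [neg_mul, abs_neg, abs_of_nonneg (mul_nonneg hc h0), Real.rpow_neg ht.le]
  refine (le_mul_inv_iff₀ (by positivity)).2 (le_trans (le_of_eq ?_) h)
  rw [neg_mul]; ring

theorem abs_deriv_relaxation_le (hα : 0 < α) (hα₁ : α ≤ 1) (hc : 0 ≤ c) {t : ℝ} (ht : 0 < t) :
    |mlDeriv α (c * t ^ α) * (c * (α * t ^ (α - 1)))| ≤ α / t := by
  have h := abs_mul_mlDeriv_le hα hα₁ (x := c * t ^ α) (by positivity)
  have e : mlDeriv α (c * t ^ α) * (c * (α * t ^ (α - 1))) =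
      (α / t) * (c * t ^ α * mlDeriv α (c * t ^ α)) := by
    rw [Real.rpow_sub_one ht.ne']; field_simp
  rw [e, abs_mul, abs_of_pos (by positivity : 0 < α / t)]
  exact mul_le_of_le_one_right (by positivity) h

/-- The Riemann-Liouville kernel of the integral of order `α`. -/
theorem rlKernel_eq {t s : ℝ} (hs : s ≤ t) :
    1 / Real.Gamma (1 - (1 - α)) * (1 / (t - s) ^ (1 - α)) =
      (Real.Gamma α)⁻¹ * (t - s) ^ (α - 1) := by
  rw [show 1 - (1 - α) = α by ring, show α - 1 = -(1 - α) by ring,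
    Real.rpow_neg (sub_nonneg.2 hs), one_div, one_div]

theorem intervalIntegrable_rlKernel (hα : 0 < α) {t : ℝ} (ht : 0 < t) :
    IntervalIntegrable (fun s => 1 / Real.Gamma (1 - (1 - α)) * (1 / (t - s) ^ (1 - α)))
      volume 0 t := by
  have h : IntervalIntegrable (fun s => (t - s) ^ (α - 1)) volume 0 t := by
    simpa using intervalIntegrable_beta (p := 1) one_pos hα ht
  refine (h.const_mul (Real.Gamma α)⁻¹).congr fun s hs => ?_
  rw [Set.uIoc_of_le ht.le] at hs
  exact (rlKernel_eq hs.2).symm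

theorem intervalIntegrable_rlKernel_mul (hα : 0 < α) {t : ℝ} (ht : 0 < t) :
    IntervalIntegrable (fun s => 1 / Real.Gamma (1 - (1 - α)) * (1 / (t - s) ^ (1 - α)) *
      (-c * mittagLeffler α 1 (-c * s ^ α))) volume 0 t :=
  (intervalIntegrable_rlKernel hα ht).mul_continuousOn
    ((continuous_relaxation hα).const_mul (-c)).continuousOn

theorem integral_rlKernel_mul (hα : 0 < α) {t : ℝ} (ht : 0 < t) :
    ∫ s in (0 : ℝ)..t, 1 / Real.Gamma (1 - (1 - α)) * (1 / (t - s) ^ (1 - α)) *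
      (-c * mittagLeffler α 1 (-c * s ^ α)) = mittagLeffler α 1 (-c * t ^ α) - 1 := by
  have h := mul_integral_mittagLeffler (c := c) hα ht
  have hΓ := Real.Gamma_pos_of_pos hα
  have e : ∫ s in (0 : ℝ)..t, 1 / Real.Gamma (1 - (1 - α)) * (1 / (t - s) ^ (1 - α)) *
      (-c * mittagLeffler α 1 (-c * s ^ α)) =
      ∫ s in (0 : ℝ)..t, (-(c * (Real.Gamma α)⁻¹)) *
        ((t - s) ^ (α - 1) * mittagLeffler α 1 (-(c * s ^ α))) := by
    rw [intervalIntegral.integral_of_le ht.le, intervalIntegral.integral_of_le ht.le]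
    refine setIntegral_congr_fun measurableSet_Ioc fun s hs => ?_
    simp only [rlKernel_eq hs.2, neg_mul]
    ring
  rw [e, intervalIntegral.integral_const_mul]
  have e2 : -(c * (Real.Gamma α)⁻¹) *
      ∫ s in (0 : ℝ)..t, (t - s) ^ (α - 1) * mittagLeffler α 1 (-(c * s ^ α)) =
      -((Real.Gamma α)⁻¹ *
        (c * ∫ s in (0 : ℝ)..t, (t - s) ^ (α - 1) * mittagLeffler α 1 (-(c * s ^ α)))) := by
    ring
  rw [e2, h, neg_mul]
  field_simp
  ring

/-- The integrand is nonpositive, so the integral over `(ε, t)` lies between the full one, `u(t) - 1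
≥ -1`, and `0`. Uniformity in `ε` and `c` could not be had from the bound `s^(-α)` when `α = 1`. -/
theorem abs_integral_rlKernel_mul_le (hα : 0 < α) (hα₁ : α ≤ 1) (hc : 0 ≤ c) {ε t : ℝ}
    (hε : 0 ≤ ε) (hεt : ε < t) :
    |∫ s in ε..t, 1 / Real.Gamma (1 - (1 - α)) * (1 / (t - s) ^ (1 - α)) *
      (-c * mittagLeffler α 1 (-c * s ^ α))| ≤ 1 := by
  have ht : 0 < t := hε.trans_lt hεt
  have hint := intervalIntegrable_rlKernel_mul (c := c) hα ht
  have hneg : ∀ s ∈ Set.Icc 0 t, 1 / Real.Gamma (1 - (1 - α)) * (1 / (t - s) ^ (1 - α)) *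
      (-c * mittagLeffler α 1 (-c * s ^ α)) ≤ 0 := by
    intro s hs
    rw [rlKernel_eq hs.2]
    have h1 := Real.rpow_nonneg (sub_nonneg.2 hs.2) (α - 1)
    have h2 := mul_nonneg hc (relaxation_nonneg hα hα₁ hc hs.1)
    have h3 := inv_nonneg.2 (Real.Gamma_pos_of_pos hα).le
    have := mul_nonneg (mul_nonneg h3 h1) h2
    linarith
  have h1 := intervalIntegral.integral_add_adjacent_intervals
    (hint.mono_set (by
      rw [Set.uIcc_of_le hε, Set.uIcc_of_le ht.le]; exact Set.Icc_subset_Icc le_rfl hεt.le))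
    (hint.mono_set (by
      rw [Set.uIcc_of_le hεt.le, Set.uIcc_of_le ht.le]; exact Set.Icc_subset_Icc hε le_rfl))
  rw [integral_rlKernel_mul hα ht] at h1
  have hA : ∫ s in (0 : ℝ)..ε, 1 / Real.Gamma (1 - (1 - α)) * (1 / (t - s) ^ (1 - α)) *
      (-c * mittagLeffler α 1 (-c * s ^ α)) ≤ 0 := by
    rw [intervalIntegral.integral_of_le hε]
    exact setIntegral_nonpos measurableSet_Ioc fun s hs => hneg s ⟨hs.1.le, hs.2.trans hεt.le⟩
  have hB : ∫ s in ε..t, 1 / Real.Gamma (1 - (1 - α)) * (1 / (t - s) ^ (1 - α)) *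
      (-c * mittagLeffler α 1 (-c * s ^ α)) ≤ 0 := by
    rw [intervalIntegral.integral_of_le hεt.le]
    exact setIntegral_nonpos measurableSet_Ioc fun s hs => hneg s ⟨hε.trans hs.1.le, hs.2⟩
  have := relaxation_nonneg hα hα₁ hc ht.le
  rw [abs_of_nonpos hB]
  linarith

theorem tendsto_integral_rlKernel_mul (hα : 0 < α) {t : ℝ} (ht : 0 < t) :
    Tendsto (fun ε => ∫ s in ε..t, 1 / Real.Gamma (1 - (1 - α)) * (1 / (t - s) ^ (1 - α)) *
      (-c * mittagLeffler α 1 (-c * s ^ α))) (𝓝[>] 0)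
      (𝓝 (mittagLeffler α 1 (-c * t ^ α) - 1)) := by
  rw [← integral_rlKernel_mul hα ht]
  have hint := intervalIntegrable_rlKernel_mul (c := c) hα ht
  have h := intervalIntegral.continuousOn_primitive_interval_left
    (hint.def'.congr_set_ae uIoc_ae_eq_interval.symm)
  have h0 := h 0 Set.left_mem_uIcc
  rw [ContinuousWithinAt, Set.uIcc_of_le ht.le] at h0
  refine h0.mono_left (nhdsWithin_le_iff.2 ?_)
  exact mem_of_superset (Ioc_mem_nhdsGT ht) Set.Ioc_subset_Icc_self

end Relaxation

/-! ### The evolution in Hilbert space and its fractional derivative. -/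

section Evolution

variable {H : Type*} [NormedAddCommGroup H] [InnerProductSpace ℝ H] [CompleteSpace H]
  {ζ : ℕ → H} {c : ℕ → ℝ} {α : ℝ}

/-- The field `∑ E_α(-c l tᵅ) • ζ l`. -/
noncomputable def evol (ζ : ℕ → H) (c : ℕ → ℝ) (α t : ℝ) : H :=
  diagSum ζ fun l => mittagLeffler α 1 (-c l * t ^ α)

/-- The field `∑ -c l E_α(-c l tᵅ) • ζ l`. -/
noncomputable def evolGen (ζ : ℕ → H) (c : ℕ → ℝ) (α t : ℝ) : H :=
  diagSum ζ fun l => -c l * mittagLeffler α 1 (-c l * t ^ α)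

/-- The time derivative of `evol`. -/
noncomputable def evolDeriv (ζ : ℕ → H) (c : ℕ → ℝ) (α t : ℝ) : H :=
  diagSum ζ fun l => mlDeriv α (c l * t ^ α) * (c l * (α * t ^ (α - 1)))

variable (hζ : Pairwise fun i j => inner ℝ (ζ i) (ζ j) = 0) (hs : Summable fun l => ‖ζ l‖ ^ 2)
  (hc : ∀ l, 0 ≤ c l) (hα : 0 < α) (hα₁ : α ≤ 1)

include hζ hs hc hα hα₁

theorem tendsto_evol_zero : Tendsto (evol ζ c α) (𝓝[>] 0) (𝓝 (evol ζ c α 0)) := by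
  refine tendsto_diagSum hζ hs (C := 1) ?_ (fun l => abs_relaxation_le hα hα₁ (hc l) le_rfl)
    fun l => ((continuous_relaxation hα).tendsto 0).mono_left nhdsWithin_le_nhds
  filter_upwards [self_mem_nhdsWithin] with t ht l
  exact abs_relaxation_le hα hα₁ (hc l) (le_of_lt ht)

theorem hasDerivAt_evol {t : ℝ} (ht : 0 < t) :
    HasDerivAt (evol ζ c α) (evolDeriv ζ c α t) t := by
  have hpos : ∀ s ∈ Metric.ball t (t / 2), t / 2 < s := fun s hs' => by
    rw [Real.ball_eq_Ioo] at hs'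
    linarith [hs'.1]
  refine hasDerivAt_diagSum hζ hs (u := fun t l => mittagLeffler α 1 (-c l * t ^ α))
    (d := fun t l => mlDeriv α (c l * t ^ α) * (c l * (α * t ^ (α - 1))))
    (δ := t / 2) (C := α / (t / 2)) (D := 1) (by positivity)
    (fun s hs' l => ?_) (fun s hs' l => ?_) (fun s hs' l => ?_)
  · exact abs_relaxation_le hα hα₁ (hc l) (by linarith [hpos s hs'])
  · refine (abs_deriv_relaxation_le hα hα₁ (hc l) (by linarith [hpos s hs'])).trans ?_
    have := hpos s hs'
    gcongr
  · exact hasDerivAt_relaxation hα (by linarith [hpos s hs'])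

theorem norm_evolGen_le {t : ℝ} (ht : 0 < t) :
    ‖evolGen ζ c α t‖ ≤ Real.Gamma (α + 1) * t ^ (-α) * Real.sqrt (∑' l, ‖ζ l‖ ^ 2) :=
  norm_diagSum_le hζ hs fun l => abs_mul_relaxation_le hα hα₁ (hc l) ht

theorem continuousOn_evolGen : ContinuousOn (evolGen ζ c α) (Set.Ioi 0) := by
  intro t ht
  have ht : 0 < t := ht
  have hΓ := Real.Gamma_pos_of_pos (by linarith : 0 < α + 1)
  refine ContinuousAt.continuousWithinAt (tendsto_diagSum hζ hs
    (C := Real.Gamma (α + 1) * (t / 2) ^ (-α)) ?_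
    (fun l => abs_mul_relaxation_le hα hα₁ (hc l) ht)
    fun l => ((continuous_relaxation hα).const_mul (-c l)).tendsto t)
  filter_upwards [lt_mem_nhds (half_lt_self ht)] with s hs' l
  refine (abs_mul_relaxation_le hα hα₁ (hc l) ((half_pos ht).trans hs')).trans ?_
  exact mul_le_mul_of_nonneg_left (Real.rpow_le_rpow_of_nonpos (half_pos ht) hs'.le (by linarith))
    hΓ.le

/-- Integrability of the dominating kernel is left as a hypothesis, since down to `ε = 0` it
requires `α < 1`, while for `ε > 0` it also holds at `α = 1`. -/
theorem intervalIntegrable_rlIntegrand_of_bound {ε t : ℝ} (hε : 0 ≤ ε) (hεt : ε < t)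
    (hint : IntervalIntegrable (fun s => (t - s) ^ (α - 1) * s ^ (-α)) volume ε t) :
    IntervalIntegrable (rlIntegrand (1 - α) (evolGen ζ c α) t) volume ε t := by
  have ht : 0 < t := hε.trans_lt hεt
  rw [intervalIntegrable_iff_integrableOn_Ioc_of_le hεt.le] at hint ⊢
  have hk := (intervalIntegrable_iff_integrableOn_Ioc_of_le ht.le).1
    (intervalIntegrable_rlKernel hα ht)
  refine Integrable.mono' (hint.const_mul ((Real.Gamma α)⁻¹ * Real.Gamma (α + 1) *
    Real.sqrt (∑' l, ‖ζ l‖ ^ 2))) ?_ ?_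
  · refine (hk.mono_set (Set.Ioc_subset_Ioc_left hε)).aestronglyMeasurable.smul ?_
    exact ((continuousOn_evolGen hζ hs hc hα hα₁).mono fun s hs' =>
      hε.trans_lt hs'.1).aestronglyMeasurable measurableSet_Ioc
  · refine (ae_restrict_iff' measurableSet_Ioc).2 (ae_of_all _ fun s hs' => ?_)
    have hs0 : 0 < s := hε.trans_lt hs'.1
    have h1 : 0 ≤ (Real.Gamma α)⁻¹ * (t - s) ^ (α - 1) :=
      mul_nonneg (inv_nonneg.2 (Real.Gamma_pos_of_pos hα).le)
        (Real.rpow_nonneg (sub_nonneg.2 hs'.2) _)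
    rw [rlIntegrand, rlKernel_eq hs'.2, norm_smul, Real.norm_of_nonneg h1]
    refine (mul_le_mul_of_nonneg_left (norm_evolGen_le hζ hs hc hα hα₁ hs0) h1).trans_eq ?_
    ring

theorem intervalIntegrable_rlIntegrand_evolGen (hα₂ : α < 1) {t : ℝ} (ht : 0 < t) :
    IntervalIntegrable (rlIntegrand (1 - α) (evolGen ζ c α) t) volume 0 t := by
  refine intervalIntegrable_rlIntegrand_of_bound hζ hs hc hα hα₁ le_rfl ht ?_
  have := intervalIntegrable_beta (p := 1 - α) (by linarith) hα ht
  rwa [show (1 - α) - 1 = -α by ring] at this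

/-- Sum and integral are exchanged on `(ε, t)`, where the coefficients are bounded by `Γ(α + 1)
ε^(-α)`. Then `ε → 0` is taken coefficientwise under the uniform bound `1`. This order of limits
covers `α = 1`. -/
theorem hasRLIntegral_evolGen {t : ℝ} (ht : 0 < t) :
    HasRLIntegral (1 - α) (evolGen ζ c α) t (evol ζ c α t - evol ζ c α 0) := by
  have hsub : ∀ ε ∈ Set.Ioo 0 t, Set.uIcc ε t ⊆ Set.uIcc 0 t := fun ε hε => by
    rw [Set.uIcc_of_le hε.2.le, Set.uIcc_of_le ht.le]; exact Set.Icc_subset_Icc hε.1.le le_rfl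
  refine ⟨fun ε hε => ?_, ?_⟩
  · refine intervalIntegrable_rlIntegrand_of_bound hζ hs hc hα hα₁ hε.1.le hε.2 ?_
    have h : IntervalIntegrable (fun s => (t - s) ^ (α - 1)) volume 0 t := by
      simpa using intervalIntegrable_beta (p := 1) one_pos hα ht
    refine (h.mono_set (hsub ε hε)).mul_continuousOn fun s hs' => ?_
    rw [Set.uIcc_of_le hε.2.le] at hs'
    exact (Real.continuousAt_rpow_const _ _
      (Or.inl (hε.1.trans_le hs'.1).ne')).continuousWithinAt
  · have e0 : ∀ l, mittagLeffler α 1 (-c l * 0 ^ α) = 1 := fun l => by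
      rw [Real.zero_rpow hα.ne', mul_zero, mittagLeffler_zero]
    have h2 : evol ζ c α t - evol ζ c α 0 =
        diagSum ζ fun l => mittagLeffler α 1 (-c l * t ^ α) - 1 := by
      rw [evol, evol, diagSum_sub hζ hs (fun l => abs_relaxation_le hα hα₁ (hc l) ht.le)
        (fun l => abs_relaxation_le hα hα₁ (hc l) le_rfl)]
      simp_rw [e0]
    rw [h2]
    have h3 : Tendsto (fun ε => diagSum ζ fun l =>
        ∫ s in ε..t, 1 / Real.Gamma (1 - (1 - α)) * (1 / (t - s) ^ (1 - α)) *
          (-c l * mittagLeffler α 1 (-c l * s ^ α))) (𝓝[>] 0)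
        (𝓝 (diagSum ζ fun l => mittagLeffler α 1 (-c l * t ^ α) - 1)) := by
      refine tendsto_diagSum hζ hs (C := 1) (D := 1) ?_ (fun l => ?_)
        fun l => tendsto_integral_rlKernel_mul hα ht
      · filter_upwards [Ioo_mem_nhdsGT ht] with ε hε l
        exact abs_integral_rlKernel_mul_le hα hα₁ (hc l) hε.1.le hε.2
      · rw [← integral_rlKernel_mul hα ht]
        exact abs_integral_rlKernel_mul_le hα hα₁ (hc l) le_rfl ht
    refine h3.congr' ?_
    filter_upwards [Ioo_mem_nhdsGT ht] with ε hε
    refine (intervalIntegral_diagSum hζ hs (C := Real.Gamma (α + 1) * ε ^ (-α)) (D := 1) hε.2.le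
      ((intervalIntegrable_rlKernel hα ht).mono_set (hsub ε hε)) (fun s hs' l => ?_)
      (fun l => ((continuous_relaxation hα).const_mul _).continuousOn)
      fun l => abs_integral_rlKernel_mul_le hα hα₁ (hc l) hε.1.le hε.2).symm
    refine (abs_mul_relaxation_le hα hα₁ (hc l) (hε.1.trans hs'.1)).trans ?_
    exact mul_le_mul_of_nonneg_left
      (Real.rpow_le_rpow_of_nonpos hε.1 hs'.1.le (by linarith))
      (Real.Gamma_pos_of_pos (by linarith)).le

/-- This is the evolution equation: the fractional integral of the generator term differs from the
solution by a constant vector. -/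
theorem hasRLDerivAt_evolGen {t : ℝ} (ht : 0 < t) :
    HasRLDerivAt (1 - α) (evolGen ζ c α) (evolDeriv ζ c α t) t :=
  ⟨fun r => evol ζ c α r - evol ζ c α 0,
    fun _ hr => hasRLIntegral_evolGen hζ hs hc hα hα₁ hr,
    (hasDerivAt_evol hζ hs hc hα hα₁ ht).sub_const _⟩

end Evolution

/-! ### Derivatives of Legendre polynomials -/

section Legendre

open Polynomial

/-- The `m`-th derivative of the Legendre polynomial of degree `l`. -/
noncomputable def legD (l m : ℕ) : ℝ[X] := derivative^[m] (legendreP l)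

theorem derivative_legD (l m : ℕ) : derivative (legD l m) = legD l (m + 1) := by
  rw [legD, legD, Function.iterate_succ_apply']

theorem legD_eq (l m : ℕ) : legD l m =
    C ((2 ^ l * (l.factorial : ℝ))⁻¹) * derivative^[m + l] ((X ^ 2 - 1) ^ l) := by
  rw [legD, legendreP, iterate_derivative_C_mul, ← Function.iterate_add_apply]

/-- With `f = (X² - 1)^l`, differentiating `(X² - 1) f' = 2 l X f` once gives `j = 0`; each further
differentiation raises `j` by one. -/
theorem rodrigues_ode (l j : ℕ) :
    ((X : ℝ[X]) ^ 2 - 1) * derivative^[j + 2] ((X ^ 2 - 1) ^ l) +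
      2 * (C ((j : ℝ) + 1 - l)) * X * derivative^[j + 1] ((X ^ 2 - 1) ^ l) +
      C (((j : ℝ) + 1) * j - 2 * l * (j + 1)) * derivative^[j] ((X ^ 2 - 1) ^ l) = 0 := by
  induction j with
  | zero =>
    have h : ((X : ℝ[X]) ^ 2 - 1) * derivative ((X ^ 2 - 1) ^ l) =
        2 * C (l : ℝ) * X * (X ^ 2 - 1) ^ l := by
      rcases l with _ | l
      · simp
      · rw [derivative_pow_succ]
        simp only [derivative_sub, derivative_X_pow, derivative_one, map_natCast]
        push_cast
        simp only [map_add, map_natCast, map_one]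
        ring
    have h2 := congrArg derivative h
    simp only [derivative_mul, derivative_sub, derivative_X_pow, derivative_one, derivative_X,
      derivative_C, derivative_ofNat] at h2
    simp only [Function.iterate_succ, Function.comp, Function.iterate_zero, id]
    simp only [map_sub, map_add, map_mul, map_natCast, map_one, map_ofNat, Nat.cast_zero,
      Nat.cast_ofNat] at h2 ⊢
    simp only [map_zero, zero_add] at h2 ⊢
    linear_combination h2
  | succ j ih =>
    have h2 := congrArg derivative ih
    simp only [derivative_mul, derivative_add, derivative_sub, derivative_X_pow, derivative_one,
      derivative_X, derivative_C, derivative_ofNat, derivative_zero,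
      ← Function.iterate_succ_apply'] at h2
    simp only [map_sub, map_add, map_mul, map_natCast, map_one, map_ofNat, Nat.cast_add,
      Nat.cast_ofNat, Nat.cast_one] at h2 ⊢
    linear_combination h2

/-- The differential equation of the associated Legendre functions. -/
theorem legD_ode (l m : ℕ) (t : ℝ) :
    (1 - t ^ 2) * (legD l (m + 2)).eval t - 2 * (m + 1) * t * (legD l (m + 1)).eval t +
      ((l : ℝ) * (l + 1) - m * (m + 1)) * (legD l m).eval t = 0 := by
  have h := congrArg (eval t) (rodrigues_ode l (m + l))
  simp only [eval_add, eval_mul, eval_sub, eval_pow, eval_X, eval_one, eval_C, eval_ofNat,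
    eval_zero] at h
  simp only [legD_eq, eval_mul, eval_C]
  rw [show m + 2 + l = m + l + 2 by ring, show m + 1 + l = m + l + 1 by ring]
  push_cast at h
  linear_combination (-(2 ^ l * (l.factorial : ℝ))⁻¹) * h

theorem natDegree_rodrigues (l : ℕ) : ((X ^ 2 - 1 : ℝ[X]) ^ l).natDegree = 2 * l := by
  have : (X ^ 2 - 1 : ℝ[X]).natDegree = 2 := by
    simpa using natDegree_X_pow_sub_C (R := ℝ) (n := 2) (r := 1)
  rw [natDegree_pow, this, mul_comm]

theorem coeff_rodrigues (l : ℕ) : ((X ^ 2 - 1 : ℝ[X]) ^ l).coeff (2 * l) = 1 := by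
  have h : (X ^ 2 - 1 : ℝ[X]).Monic := by
    simpa using monic_X_pow_sub_C (R := ℝ) (1 : ℝ) (two_ne_zero)
  rw [← natDegree_rodrigues l]
  exact (h.pow l).coeff_natDegree

theorem natDegree_legD_le (l m : ℕ) : (legD l m).natDegree ≤ l - m := by
  rw [legD_eq]
  refine (natDegree_C_mul_le _ _).trans ((natDegree_iterate_derivative _ _).trans ?_)
  rw [natDegree_rodrigues]
  omega

theorem coeff_legD {l m : ℕ} (hm : m ≤ l) : (legD l m).coeff (l - m) =
    (2 ^ l * (l.factorial : ℝ))⁻¹ * ((2 * l).descFactorial (m + l) : ℝ) := by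
  rw [legD_eq, coeff_C_mul, coeff_iterate_derivative, show l - m + (m + l) = 2 * l by omega,
    coeff_rodrigues]
  simp

theorem degree_legD {l m : ℕ} (hm : m ≤ l) : (legD l m).degree = (l - m : ℕ) := by
  refine degree_eq_of_le_of_coeff_ne_zero (natDegree_le_iff_degree_le.1 (natDegree_legD_le l m)) ?_
  rw [coeff_legD hm]
  have : (0 : ℝ) < ((2 * l).descFactorial (m + l) : ℝ) := by
    exact_mod_cast Nat.descFactorial_pos.2 (by omega)
  positivity

theorem legD_self (l : ℕ) :
    legD l l = C ((2 ^ l * (l.factorial : ℝ))⁻¹ * ((2 * l).factorial : ℝ)) := by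
  have h : (legD l l).natDegree ≤ 0 := by simpa using natDegree_legD_le l l
  rw [eq_C_of_natDegree_le_zero h]
  have := coeff_legD (le_refl l)
  rw [Nat.sub_self] at this
  rw [this, ← two_mul, Nat.descFactorial_self]

/-- The polynomials `(d/dt)ᵐ P_{m+n}`, ordered by degree. -/
noncomputable def legDSequence (m : ℕ) : Polynomial.Sequence ℝ where
  elems' n := legD (m + n) m
  degree_eq' n := by simpa using degree_legD (Nat.le_add_right m n)

/-- For fixed order there is one polynomial in each degree. Completeness uses this to replace an
arbitrary polynomial in `cos θ` by Legendre derivatives of the right order. -/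
theorem span_legD (m : ℕ) : Submodule.span ℝ (Set.range fun n => legD (m + n) m) = ⊤ :=
  (legDSequence m).span fun i => isUnit_iff_ne_zero.2
    (leadingCoeff_ne_zero.2 ((legDSequence m).ne_zero i))

/-! ### Orthogonality relations -/

/-- The inner product of two associated Legendre functions of order `m`. -/
noncomputable def legInner (l l' m : ℕ) : ℝ :=
  ∫ t in (-1 : ℝ)..1, (1 - t ^ 2) ^ m * ((legD l m).eval t * (legD l' m).eval t)

theorem legInner_comm (l l' m : ℕ) : legInner l l' m = legInner l' l m := by
  simp only [legInner, mul_comm]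

/-- The derivative of `(1 - t²)^(m+1) P_l^(m+1) P_l'^(m)` integrates to `0`, and the Legendre
equation rewrites it. The factor involves `l` alone, so symmetry in `l` and `l'` yields
orthogonality. -/
theorem legInner_succ (l l' m : ℕ) :
    legInner l l' (m + 1) = ((l : ℝ) * (l + 1) - m * (m + 1)) * legInner l l' m := by
  have hd : ∀ t : ℝ, HasDerivAt
      (fun t => (1 - t ^ 2) ^ (m + 1) * ((legD l (m + 1)).eval t * (legD l' m).eval t))
      ((1 - t ^ 2) ^ (m + 1) * ((legD l (m + 1)).eval t * (legD l' (m + 1)).eval t) -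
        ((l : ℝ) * (l + 1) - m * (m + 1)) *
          ((1 - t ^ 2) ^ m * ((legD l m).eval t * (legD l' m).eval t))) t := by
    intro t
    have h1 : HasDerivAt (fun t : ℝ => (1 - t ^ 2) ^ (m + 1))
        (((m + 1 : ℕ) : ℝ) * (1 - t ^ 2) ^ m * (-(2 * t))) t := by
      have h := ((hasDerivAt_pow 2 t).const_sub 1).pow (m + 1)
      simpa using! h
    have h2 := (legD l (m + 1)).hasDerivAt t
    have h3 := (legD l' m).hasDerivAt t
    rw [derivative_legD] at h2 h3
    refine (h1.mul (h2.mul h3)).congr_deriv ?_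
    have ode := legD_ode l m t
    simp only [Pi.mul_apply]
    push_cast
    rw [pow_succ]
    linear_combination ((1 - t ^ 2) ^ m * (legD l' m).eval t) * ode
  have hF := intervalIntegral.integral_eq_sub_of_hasDerivAt (a := (-1 : ℝ)) (b := 1)
    (fun t _ => hd t) (Continuous.intervalIntegrable (by fun_prop) _ _)
  rw [intervalIntegral.integral_sub (Continuous.intervalIntegrable (by fun_prop) _ _)
    (Continuous.intervalIntegrable (by fun_prop) _ _), intervalIntegral.integral_const_mul] at hF
  have : legInner l l' (m + 1) - ((l : ℝ) * (l + 1) - m * (m + 1)) * legInner l l' m = 0 := by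
    rw [legInner, legInner, hF]
    norm_num
  linarith

theorem legInner_of_ne {l l' : ℕ} (h : l ≠ l') (m : ℕ) : legInner l l' m = 0 := by
  have h1 := legInner_succ l l' m
  have h2 := legInner_succ l' l m
  rw [legInner_comm l' l, legInner_comm l' l] at h2
  have h3 : ((l : ℝ) * (l + 1) - l' * (l' + 1)) * legInner l l' m = 0 := by linarith
  refine (mul_eq_zero.1 h3).resolve_left fun h4 => h ?_
  have h5 : ((l : ℝ) - l') * (l + l' + 1) = 0 := by linear_combination h4
  have h6 : (l : ℝ) + l' + 1 ≠ 0 := by positivity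
  exact_mod_cast sub_eq_zero.1 ((mul_eq_zero.1 h5).resolve_right h6)

theorem integral_one_sub_sq_pow_succ (l : ℕ) :
    (2 * (l : ℝ) + 3) * ∫ t in (-1 : ℝ)..1, (1 - t ^ 2) ^ (l + 1) =
      (2 * (l : ℝ) + 2) * ∫ t in (-1 : ℝ)..1, (1 - t ^ 2) ^ l := by
  have hd : ∀ t : ℝ, HasDerivAt (fun t => t * (1 - t ^ 2) ^ (l + 1))
      ((2 * l + 3) * (1 - t ^ 2) ^ (l + 1) - (2 * l + 2) * (1 - t ^ 2) ^ l) t := by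
    intro t
    have h1 : HasDerivAt (fun t : ℝ => (1 - t ^ 2) ^ (l + 1))
        (((l + 1 : ℕ) : ℝ) * (1 - t ^ 2) ^ l * (-(2 * t))) t := by
      have h := ((hasDerivAt_pow 2 t).const_sub 1).pow (l + 1)
      simpa using! h
    refine ((hasDerivAt_id t).mul h1).congr_deriv ?_
    simp only [id]
    push_cast
    ring
  have hF := intervalIntegral.integral_eq_sub_of_hasDerivAt (a := (-1 : ℝ)) (b := 1)
    (fun t _ => hd t) (Continuous.intervalIntegrable (by fun_prop) _ _)
  rw [intervalIntegral.integral_sub (Continuous.intervalIntegrable (by fun_prop) _ _)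
    (Continuous.intervalIntegrable (by fun_prop) _ _), intervalIntegral.integral_const_mul,
    intervalIntegral.integral_const_mul] at hF
  norm_num at hF
  linarith

theorem integral_one_sub_sq_pow (l : ℕ) :
    ∫ t in (-1 : ℝ)..1, (1 - t ^ 2) ^ l =
      2 * (2 ^ l * (l.factorial : ℝ)) ^ 2 / ((2 * l + 1) * ((2 * l).factorial : ℝ)) := by
  induction l with
  | zero => norm_num
  | succ l ih =>
    have h := integral_one_sub_sq_pow_succ l
    rw [ih] at h
    have h2 : (2 * (l : ℝ) + 3) ≠ 0 := by positivity
    rw [← mul_right_inj' h2, h, show 2 * (l + 1) = 2 * l + 1 + 1 by ring, Nat.factorial_succ,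
      Nat.factorial_succ, Nat.factorial_succ]
    have : ((2 * l).factorial : ℝ) ≠ 0 := by positivity
    push_cast
    field_simp
    ring

/-- The factor of `legInner_succ` is `(l - m)(l + m + 1)`, and the product telescopes into
factorials. -/
theorem legInner_self_eq_mul (l m : ℕ) (hm : m ≤ l) :
    ((l - m).factorial : ℝ) * legInner l l m = ((l + m).factorial : ℝ) * legInner l l 0 := by
  induction m with
  | zero => simp
  | succ m ih =>
    have h := ih (by omega)
    obtain ⟨k, rfl⟩ := Nat.exists_eq_add_of_le hm
    rw [show m + 1 + k - m = k + 1 by omega, Nat.factorial_succ] at h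
    rw [show m + 1 + k - (m + 1) = k by omega, ← add_assoc, Nat.factorial_succ, legInner_succ]
    push_cast at h ⊢
    linear_combination ((m : ℝ) + 1 + k + m + 1) * h

/-- The norm is computed at `m = l`, where the polynomial is constant and only the integral of `(1 -
t²)^l` remains. The telescoped relation carries it to `m = 0` and from there to every `m`. -/
theorem legInner_self (l m : ℕ) (hm : m ≤ l) :
    legInner l l m = 2 / (2 * l + 1) * (((l + m).factorial : ℝ) / ((l - m).factorial : ℝ)) := by
  have h0 := legInner_self_eq_mul l l le_rfl
  rw [Nat.sub_self, Nat.factorial_zero, Nat.cast_one, one_mul, ← two_mul] at h0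
  have h1 : legInner l l l = ((2 ^ l * (l.factorial : ℝ))⁻¹ * ((2 * l).factorial : ℝ)) ^ 2 *
      (2 * (2 ^ l * (l.factorial : ℝ)) ^ 2 / ((2 * l + 1) * ((2 * l).factorial : ℝ))) := by
    rw [← integral_one_sub_sq_pow, legInner, legD_self]
    simp only [eval_C]
    rw [intervalIntegral.integral_mul_const]
    ring
  have h3 : ((2 * l).factorial : ℝ) ≠ 0 := by positivity
  have h2 : legInner l l 0 = 2 / (2 * l + 1) := by
    rw [← mul_right_inj' h3, ← h0, h1]
    field_simp
  have h4 := legInner_self_eq_mul l m hm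
  have h5 : ((l - m).factorial : ℝ) ≠ 0 := by positivity
  rw [← mul_right_inj' h5, h4, h2]
  field_simp

end Legendre

/-! ### Spherical coordinates -/

theorem sphPoint_zero (θ φ : ℝ) : (sphPoint θ φ).1 0 = Real.sin θ * Real.cos φ := rfl
theorem sphPoint_one (θ φ : ℝ) : (sphPoint θ φ).1 1 = Real.sin θ * Real.sin φ := rfl
theorem sphPoint_two (θ φ : ℝ) : (sphPoint θ φ).1 2 = Real.cos θ := rfl

theorem colatitude_sphPoint {θ : ℝ} (hθ : θ ∈ Set.Icc 0 Real.pi) (φ : ℝ) :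
    colatitude (sphPoint θ φ) = θ := by
  rw [colatitude, sphPoint_two, Real.arccos_cos hθ.1 hθ.2]

theorem longitude_sphPoint {θ φ : ℝ} (hθ : θ ∈ Set.Ioo 0 Real.pi)
    (hφ : φ ∈ Set.Ioc (-Real.pi) Real.pi) : longitude (sphPoint θ φ) = φ := by
  rw [longitude, sphPoint_zero, sphPoint_one]
  have h := Complex.arg_mul_cos_add_sin_mul_I (Real.sin_pos_of_mem_Ioo hθ) hφ
  refine Eq.trans ?_ h
  congr 1
  apply Complex.ext <;> simp [← Complex.ofReal_sin,
    ← Complex.ofReal_cos]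

theorem colatitude_mem (x : S2) : colatitude x ∈ Set.Icc 0 Real.pi :=
  ⟨Real.arccos_nonneg _, Real.arccos_le_pi _⟩

theorem longitude_mem (x : S2) : longitude x ∈ Set.Ioc (-Real.pi) Real.pi :=
  Complex.arg_mem_Ioc _

theorem sum_sq_eq_one (x : S2) : x.1 0 ^ 2 + x.1 1 ^ 2 + x.1 2 ^ 2 = 1 := by
  have h := x.2
  rw [mem_sphere_zero_iff_norm, EuclideanSpace.norm_eq, Real.sqrt_eq_one,
    Fin.sum_univ_three] at h
  simpa using h

/-- The poles need no exception: `‖z‖ cos (arg z) = re z` holds for `z = 0` too. -/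
theorem sphPoint_colatitude_longitude (x : S2) : sphPoint (colatitude x) (longitude x) = x := by
  have h := sum_sq_eq_one x
  have hs : Real.sin (colatitude x) = ‖(⟨x.1 0, x.1 1⟩ : ℂ)‖ := by
    rw [colatitude, Real.sin_arccos, Complex.norm_def, Complex.normSq_mk]
    congr 1; linarith
  have h0 : (sphPoint (colatitude x) (longitude x)).1 0 = x.1 0 := by
    rw [sphPoint_zero, hs, longitude, Complex.norm_mul_cos_arg]
  have h1 : (sphPoint (colatitude x) (longitude x)).1 1 = x.1 1 := by
    rw [sphPoint_one, hs, longitude, Complex.norm_mul_sin_arg]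
  have h2 : (sphPoint (colatitude x) (longitude x)).1 2 = x.1 2 := by
    rw [sphPoint_two, colatitude, Real.cos_arccos] <;> nlinarith
  refine Subtype.ext ?_
  ext i
  fin_cases i
  · exact h0
  · exact h1
  · exact h2

theorem continuous_coord (i : Fin 3) : Continuous fun x : S2 => x.1 i :=
  (PiLp.continuous_apply 2 _ i).comp continuous_subtype_val

theorem continuous_colatitude : Continuous colatitude :=
  Real.continuous_arccos.comp (continuous_coord 2)

theorem measurable_longitude : Measurable longitude := by
  have : Continuous fun x : S2 => (⟨x.1 0, x.1 1⟩ : ℂ) := by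
    have h : (fun x : S2 => (⟨x.1 0, x.1 1⟩ : ℂ)) =
        fun x : S2 => ((x.1 0 : ℝ) : ℂ) + ((x.1 1 : ℝ) : ℂ) * Complex.I := by
      ext x; exact Complex.mk_eq_add_mul_I _ _
    rw [h]
    have h0 := continuous_coord 0
    have h1 := continuous_coord 1
    fun_prop
  exact Complex.measurable_arg.comp this.measurable

/-- The coordinate rectangle. -/
def coordRect : Set (ℝ × ℝ) := Set.Ioo 0 Real.pi ×ˢ Set.Ioc (-Real.pi) Real.pi

theorem measurableSet_coordRect : MeasurableSet coordRect :=
  measurableSet_Ioo.prod measurableSet_Ioc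

theorem ae_mem_coordRect : ∀ᵐ p ∂coordMeasure, p ∈ coordRect :=
  (withDensity_absolutelyContinuous _ _).ae_le (ae_restrict_mem measurableSet_coordRect)

theorem ae_sin_colatitude_pos : ∀ᵐ x ∂sphereMeasure, colatitude x ∈ Set.Ioo 0 Real.pi := by
  rw [sphereMeasure, ae_map_iff continuous_sphPoint.measurable.aemeasurable
    (continuous_colatitude.measurable measurableSet_Ioo)]
  filter_upwards [ae_mem_coordRect] with p hp
  rw [colatitude_sphPoint (Set.Ioo_subset_Icc_self hp.1)]
  exact hp.1

theorem integral_sphere {E : Type*} [NormedAddCommGroup E] [NormedSpace ℝ E] {f : S2 → E}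
    (hf : AEStronglyMeasurable f sphereMeasure) :
    ∫ x, f x ∂sphereMeasure =
      ∫ p in coordRect, (Real.sin p.1 / (4 * Real.pi)) • f (sphPoint p.1 p.2) := by
  rw [sphereMeasure, integral_map continuous_sphPoint.measurable.aemeasurable hf, coordMeasure,
    integral_withDensity_eq_integral_toReal_smul (by fun_prop) (by simp)]
  refine setIntegral_congr_fun measurableSet_coordRect fun p hp => ?_
  have : 0 ≤ Real.sin p.1 / (4 * Real.pi) :=
    div_nonneg (Real.sin_pos_of_mem_Ioo hp.1).le (by positivity)
  simp only [ENNReal.toReal_ofReal this]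

theorem integral_coordRect {E : Type*} [NormedAddCommGroup E] [NormedSpace ℝ E]
    {G : ℝ → ℝ → E} (hG : Continuous fun p : ℝ × ℝ => G p.1 p.2) :
    ∫ p in coordRect, G p.1 p.2 =
      ∫ θ in (0 : ℝ)..Real.pi, ∫ φ in (-Real.pi)..Real.pi, G θ φ := by
  have hint : IntegrableOn (fun p : ℝ × ℝ => G p.1 p.2) coordRect (volume.prod volume) :=
    (hG.continuousOn.integrableOn_compact (isCompact_Icc.prod isCompact_Icc)).mono_set
      (Set.prod_mono Set.Ioo_subset_Icc_self Set.Ioc_subset_Icc_self)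
  rw [Measure.volume_eq_prod, coordRect, setIntegral_prod _ hint,
    intervalIntegral.integral_of_le Real.pi_pos.le, integral_Ioc_eq_integral_Ioo]
  refine setIntegral_congr_fun measurableSet_Ioo fun θ _ => ?_
  rw [intervalIntegral.integral_of_le (by linarith [Real.pi_pos])]

/-- The integral over the sphere of a function that is continuous in spherical coordinates. -/
theorem integral_sphere_of_coord {E : Type*} [NormedAddCommGroup E] [NormedSpace ℝ E] {f : S2 → E}
    (hf : AEStronglyMeasurable f sphereMeasure)
    {G : ℝ → ℝ → E} (hG : Continuous fun p : ℝ × ℝ => G p.1 p.2)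
    (hfG : ∀ p ∈ coordRect, (Real.sin p.1 / (4 * Real.pi)) • f (sphPoint p.1 p.2) = G p.1 p.2) :
    ∫ x, f x ∂sphereMeasure = ∫ θ in (0 : ℝ)..Real.pi, ∫ φ in (-Real.pi)..Real.pi, G θ φ := by
  rw [integral_sphere hf, ← integral_coordRect hG]
  exact setIntegral_congr_fun measurableSet_coordRect hfG

/-! ### Spherical harmonics in coordinates -/

open Polynomial in
/-- The function `sin^|m| θ q(cos θ) exp(i m φ)`. -/
noncomputable def sectorial (m : ℤ) (q : ℝ[X]) (x : S2) : ℂ :=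
  ((Real.sin (colatitude x) ^ m.natAbs * q.eval (Real.cos (colatitude x)) : ℝ) : ℂ) *
    Complex.exp (Complex.I * m * longitude x)

/-- The normalization constant of the spherical harmonic `Y_{l,m}`. -/
noncomputable def harmNorm (l : ℕ) (m : ℤ) : ℝ :=
  (if 0 ≤ m then (-1) ^ m.natAbs else 1) *
    Real.sqrt ((2 * l + 1) * ((l - m.natAbs).factorial : ℝ) / ((l + m.natAbs).factorial : ℝ))

theorem harmNorm_sq (l : ℕ) (m : ℤ) : harmNorm l m ^ 2 =
    (2 * l + 1) * ((l - m.natAbs).factorial : ℝ) / ((l + m.natAbs).factorial : ℝ) := by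
  rw [harmNorm, mul_pow, Real.sq_sqrt (by positivity)]
  split_ifs
  · rw [← pow_mul, mul_comm m.natAbs 2, pow_mul]; simp
  · simp

theorem harmNorm_ne_zero (l : ℕ) (m : ℤ) : harmNorm l m ≠ 0 := by
  have h : harmNorm l m ^ 2 ≠ 0 := by rw [harmNorm_sq]; positivity
  exact fun h0 => h (by rw [h0]; simp)

theorem assocLegendre_cos (l m : ℕ) {θ : ℝ} (hθ : θ ∈ Set.Icc 0 Real.pi) :
    assocLegendre l m (Real.cos θ) =
      (-1) ^ m * (Real.sin θ ^ m * (legD l m).eval (Real.cos θ)) := by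
  rw [assocLegendre, ← Real.abs_sin_eq_sqrt_one_sub_cos_sq,
    abs_of_nonneg (Real.sin_nonneg_of_mem_Icc hθ), legD]
  ring

/-- For negative `m` the phase of the associated Legendre function cancels the sign in front of the
conjugate, which explains the case split in `harmNorm`. -/
theorem sphHarmonic_eq (l : ℕ) (m : ℤ) (x : S2) :
    sphHarmonic l m x = harmNorm l m * sectorial m (legD l m.natAbs) x := by
  rw [sphHarmonic, harmonicCoord, assocLegendre_cos _ _ (colatitude_mem x), harmNorm, sectorial]
  have hm : (m : ℂ) = if 0 ≤ m then (m.natAbs : ℂ) else -(m.natAbs : ℂ) := by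
    split_ifs with h
    · rw [← Int.cast_natCast, Int.natAbs_of_nonneg h]
    · have : m = -(m.natAbs : ℤ) := by omega
      exact_mod_cast this
  rw [hm]
  have h1 : ((-1 : ℂ) ^ m.natAbs) * (-1) ^ m.natAbs = 1 := by
    rw [← mul_pow]; simp
  split_ifs with h
  · push_cast; ring
  · simp only [map_mul, Complex.conj_ofReal, ← Complex.exp_conj, Complex.conj_I, map_natCast]
    push_cast
    have h2 : -Complex.I * (m.natAbs : ℂ) * (longitude x : ℂ) =
      Complex.I * -(m.natAbs : ℂ) * (longitude x : ℂ) := by ring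
    rw [h2]
    linear_combination (Complex.exp (Complex.I * -(m.natAbs : ℂ) * (longitude x : ℂ)) *
      ((Real.sqrt ((2 * l + 1) * ((l - m.natAbs).factorial : ℝ) /
        ((l + m.natAbs).factorial : ℝ)) : ℝ) : ℂ) * Complex.sin (colatitude x) ^ m.natAbs *
      (((legD l m.natAbs).eval (Real.cos (colatitude x)) : ℝ) : ℂ)) * h1

theorem sphHarmonic_neg (l : ℕ) (m : ℤ) (x : S2) :
    sphHarmonic l (-m) x = (-1) ^ m.natAbs * (starRingEnd ℂ) (sphHarmonic l m x) := by
  have h1 : ((-1 : ℂ) ^ m.natAbs) * (-1) ^ m.natAbs = 1 := by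
    rw [← mul_pow]; simp
  rcases lt_trichotomy m 0 with h | rfl | h
  · rw [sphHarmonic, sphHarmonic, if_pos (by omega), if_neg (by omega), Int.natAbs_neg]
    simp only [map_mul, map_pow, map_neg, map_one, Complex.conj_conj, ← mul_assoc, h1, one_mul]
  · simp [sphHarmonic, harmonicCoord]
  · rw [sphHarmonic, sphHarmonic, if_neg (by omega), if_pos (by omega), Int.natAbs_neg]

theorem measurable_sectorial (m : ℤ) (q : Polynomial ℝ) : Measurable (sectorial m q) := by
  have h1 := continuous_colatitude.measurable
  have h2 := measurable_longitude
  have h3 : Continuous fun θ : ℝ => Real.sin θ ^ m.natAbs * q.eval (Real.cos θ) :=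
    (Real.continuous_sin.pow _).mul (q.continuous.comp Real.continuous_cos)
  refine Measurable.mul (Complex.measurable_ofReal.comp (h3.measurable.comp h1)) ?_
  fun_prop

theorem norm_exp_I_mul_intCast (m : ℤ) (φ : ℝ) : ‖Complex.exp (Complex.I * m * φ)‖ = 1 := by
  rw [show Complex.I * m * φ = ((m * φ : ℝ) : ℂ) * Complex.I by push_cast; ring]
  exact Complex.norm_exp_ofReal_mul_I _

theorem exists_norm_sectorial_le (m : ℤ) (q : Polynomial ℝ) : ∃ C, ∀ x, ‖sectorial m q x‖ ≤ C := by
  have h3 : Continuous fun θ : ℝ => Real.sin θ ^ m.natAbs * q.eval (Real.cos θ) :=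
    (Real.continuous_sin.pow _).mul (q.continuous.comp Real.continuous_cos)
  obtain ⟨C, hC⟩ := (isCompact_Icc (a := 0) (b := Real.pi)).exists_bound_of_continuousOn
    h3.continuousOn
  refine ⟨C, fun x => ?_⟩
  rw [sectorial, norm_mul, norm_exp_I_mul_intCast, mul_one, Complex.norm_real]
  exact hC _ (colatitude_mem x)

theorem measurable_sphHarmonic (l : ℕ) (m : ℤ) : Measurable (sphHarmonic l m) := by
  rw [funext (sphHarmonic_eq l m)]
  exact (measurable_sectorial _ _).const_mul _

theorem exists_norm_sphHarmonic_le (l : ℕ) (m : ℤ) : ∃ C, ∀ x, ‖sphHarmonic l m x‖ ≤ C := by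
  obtain ⟨C, hC⟩ := exists_norm_sectorial_le m (legD l m.natAbs)
  refine ⟨|harmNorm l m| * C, fun x => ?_⟩
  rw [sphHarmonic_eq, norm_mul, Complex.norm_real]
  exact mul_le_mul_of_nonneg_left (hC x) (abs_nonneg _)

theorem memLp_sphHarmonic (l : ℕ) (m : ℤ) : MemLp (sphHarmonic l m) 2 sphereMeasure := by
  obtain ⟨C, hC⟩ := exists_norm_sphHarmonic_le l m
  exact MemLp.of_bound (measurable_sphHarmonic l m).aestronglyMeasurable C (ae_of_all _ hC)

theorem sectorial_sphPoint (m : ℤ) (q : Polynomial ℝ) {p : ℝ × ℝ} (hp : p ∈ coordRect) :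
    sectorial m q (sphPoint p.1 p.2) =
      ((Real.sin p.1 ^ m.natAbs * q.eval (Real.cos p.1) : ℝ) : ℂ) *
        Complex.exp (Complex.I * m * p.2) := by
  rw [sectorial, colatitude_sphPoint (Set.Ioo_subset_Icc_self hp.1), longitude_sphPoint hp.1 hp.2]

/-! ### Orthonormality -/

theorem integral_exp_I_int (m : ℤ) :
    ∫ φ in (-Real.pi)..Real.pi, Complex.exp (Complex.I * m * φ) =
      if m = 0 then ((2 * Real.pi : ℝ) : ℂ) else 0 := by
  split_ifs with h
  · subst h
    simp
    ring
  · have hc : Complex.I * (m : ℂ) ≠ 0 := mul_ne_zero Complex.I_ne_zero (by exact_mod_cast h)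
    rw [integral_exp_mul_complex hc, div_eq_zero_iff]
    left
    rw [sub_eq_zero, Complex.exp_eq_exp_iff_exists_int]
    exact ⟨m, by push_cast; ring⟩

theorem integral_sin_mul_sectorial (l l' m : ℕ) :
    ∫ θ in (0 : ℝ)..Real.pi, Real.sin θ * ((Real.sin θ ^ m * (legD l m).eval (Real.cos θ)) *
      (Real.sin θ ^ m * (legD l' m).eval (Real.cos θ))) = legInner l l' m := by
  -- The substitution is `t = -cos θ`, whose derivative is `sin θ`; the reflection `t ↦ -t` in `h2`
  -- removes the signs.
  have h := intervalIntegral.integral_comp_mul_deriv (a := 0) (b := Real.pi)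
    (f := fun θ => -Real.cos θ) (f' := Real.sin)
    (g := fun t => (1 - t ^ 2) ^ m * ((legD l m).eval (-t) * (legD l' m).eval (-t)))
    (fun θ _ => by simpa using! (Real.hasDerivAt_cos θ).neg)
    Real.continuous_sin.continuousOn (by fun_prop)
  simp only [Real.cos_zero, Real.cos_pi, neg_neg, Function.comp] at h
  have h2 := intervalIntegral.integral_comp_neg (a := -1) (b := (1 : ℝ))
    (fun t => (1 - t ^ 2) ^ m * ((legD l m).eval t * (legD l' m).eval t))
  rw [neg_neg] at h2
  rw [legInner, ← h2]
  simp only [neg_sq] at h h2 ⊢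
  rw [← h]
  refine intervalIntegral.integral_congr fun θ _ => ?_
  have := Real.sin_sq θ
  simp only [← this]
  ring

/-- The `φ`-integral forces `m = m'` and the `θ`-integral is then `legInner`. The range condition
matters only for the normalization, so one index suffices. -/
theorem integral_conj_sphHarmonic_mul (l l' : ℕ) (m m' : ℤ) (hm : m.natAbs ≤ l) :
    ∫ x, (starRingEnd ℂ) (sphHarmonic l m x) * sphHarmonic l' m' x ∂sphereMeasure =
      if l = l' ∧ m = m' then 1 else 0 := by
  have hmeas : AEStronglyMeasurable
      (fun x => (starRingEnd ℂ) (sphHarmonic l m x) * sphHarmonic l' m' x) sphereMeasure :=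
    ((Complex.continuous_conj.measurable.comp (measurable_sphHarmonic l m)).mul
      (measurable_sphHarmonic l' m')).aestronglyMeasurable
  have h := integral_sphere_of_coord hmeas
    (G := fun θ φ => ((harmNorm l m * harmNorm l' m' / (4 * Real.pi) *
      (Real.sin θ * ((Real.sin θ ^ m.natAbs * (legD l m.natAbs).eval (Real.cos θ)) *
      (Real.sin θ ^ m'.natAbs * (legD l' m'.natAbs).eval (Real.cos θ)))) : ℝ) : ℂ) *
        Complex.exp (Complex.I * ((m' - m : ℤ) : ℂ) * φ)) ?_ ?_
  · rw [h]
    simp_rw [intervalIntegral.integral_const_mul, integral_exp_I_int]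
    by_cases hmm : m = m'
    · subst hmm
      simp only [sub_self, if_true, and_true]
      rw [intervalIntegral.integral_mul_const, intervalIntegral.integral_ofReal,
        intervalIntegral.integral_const_mul, integral_sin_mul_sectorial]
      split_ifs with hl
      · subst hl
        rw [legInner_self _ _ hm]
        have h2 : harmNorm l m * harmNorm l m = _ := (sq _).symm.trans (harmNorm_sq l m)
        rw [h2]
        have h3 : ((l + m.natAbs).factorial : ℝ) ≠ 0 := by positivity
        have h4 : ((l - m.natAbs).factorial : ℝ) ≠ 0 := by positivity
        have h5 : (2 * (l : ℝ) + 1) ≠ 0 := by positivity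
        have h6 := Real.pi_ne_zero
        rw [← Complex.ofReal_mul, ← Complex.ofReal_one, Complex.ofReal_inj]
        field_simp
        norm_num
      · rw [legInner_of_ne hl]; simp
    · have : m' - m ≠ 0 := fun h0 => hmm (by omega)
      simp [this, hmm]
  · refine Continuous.mul (Complex.continuous_ofReal.comp ?_) (by fun_prop)
    have h1 : Continuous fun p : ℝ × ℝ => (legD l m.natAbs).eval (Real.cos p.1) :=
      (legD l m.natAbs).continuous.comp (by fun_prop)
    have h2 : Continuous fun p : ℝ × ℝ => (legD l' m'.natAbs).eval (Real.cos p.1) :=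
      (legD l' m'.natAbs).continuous.comp (by fun_prop)
    fun_prop
  · intro p hp
    simp only [sphHarmonic_eq, sectorial_sphPoint _ _ hp]
    have e : Complex.exp (Complex.I * ((m' - m : ℤ) : ℂ) * p.2) =
        (starRingEnd ℂ) (Complex.exp (Complex.I * m * p.2)) *
          Complex.exp (Complex.I * m' * p.2) := by
      rw [← Complex.exp_conj, ← Complex.exp_add]
      simp only [map_mul, Complex.conj_I, Complex.conj_ofReal, map_intCast]
      congr 1
      push_cast
      ring
    rw [e, Complex.real_smul]
    simp only [map_mul, Complex.conj_ofReal]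
    push_cast
    ring

/-! ### Completeness of the spherical harmonics -/

/-- The degrees and orders of the spherical harmonics. -/
abbrev HarmIdx : Type := Σ l : ℕ, Finset.Icc (-(l : ℤ)) l

/-- The spherical harmonics as elements of `L²`. -/
noncomputable def harmLp (i : HarmIdx) : Lp ℂ 2 sphereMeasure :=
  (memLp_sphHarmonic i.1 i.2).toLp (sphHarmonic i.1 i.2)

theorem natAbs_le_of_mem {l : ℕ} {m : ℤ} (h : m ∈ Finset.Icc (-(l : ℤ)) l) : m.natAbs ≤ l := by
  rw [Finset.mem_Icc] at h
  omega

theorem inner_harmLp_left (i : HarmIdx) {f : S2 → ℂ} (hf : MemLp f 2 sphereMeasure) :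
    inner ℂ (harmLp i) (hf.toLp f) =
      ∫ x, f x * (starRingEnd ℂ) (sphHarmonic i.1 i.2 x) ∂sphereMeasure := by
  rw [L2.inner_def]
  refine integral_congr_ae ?_
  filter_upwards [(memLp_sphHarmonic i.1 i.2).coeFn_toLp, hf.coeFn_toLp] with x h1 h2
  rw [harmLp, h1, h2, RCLike.inner_apply]

theorem orthonormal_harmLp : Orthonormal ℂ harmLp := by
  rw [orthonormal_iff_ite]
  rintro ⟨l, m, hm⟩ ⟨l', m', hm'⟩
  rw [harmLp, harmLp, ← harmLp, inner_harmLp_left]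
  simp_rw [mul_comm (sphHarmonic _ _ _)]
  rw [integral_conj_sphHarmonic_mul _ _ _ _ (natAbs_le_of_mem hm)]
  refine if_congr ?_ rfl rfl
  constructor
  · rintro ⟨h1, h2⟩
    subst h1; subst h2
    rfl
  · intro h
    rw [Sigma.mk.injEq] at h
    obtain ⟨h1, h2⟩ := h
    subst h1
    have := eq_of_heq h2
    rw [Subtype.mk.injEq] at this
    exact ⟨rfl, this⟩

open Polynomial in
-- Linear in `q`, so by `span_legD` it suffices to take a Legendre derivative, for which the
-- function is a multiple of a single harmonic.
theorem exists_mem_span_ae_eq_sectorial (m : ℤ) (q : ℝ[X]) :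
    ∃ F ∈ Submodule.span ℂ (Set.range harmLp), F =ᵐ[sphereMeasure] sectorial m q := by
  have hq : q ∈ Submodule.span ℝ (Set.range fun n => legD (m.natAbs + n) m.natAbs) := by
    rw [span_legD]; exact Submodule.mem_top
  induction hq using Submodule.span_induction with
  | mem q hq =>
    obtain ⟨n, rfl⟩ := hq
    have hm : m ∈ Finset.Icc (-((m.natAbs + n : ℕ) : ℤ)) ((m.natAbs + n : ℕ) : ℤ) := by
      rw [Finset.mem_Icc]; omega
    refine ⟨((harmNorm (m.natAbs + n) m : ℝ) : ℂ)⁻¹ • harmLp ⟨m.natAbs + n, ⟨m, hm⟩⟩,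
      Submodule.smul_mem _ _ (Submodule.subset_span ⟨_, rfl⟩), ?_⟩
    filter_upwards [Lp.coeFn_smul ((harmNorm (m.natAbs + n) m : ℝ) : ℂ)⁻¹
      (harmLp ⟨m.natAbs + n, ⟨m, hm⟩⟩), (memLp_sphHarmonic (m.natAbs + n) m).coeFn_toLp]
      with x h1 h2
    have h3 : ((harmNorm (m.natAbs + n) m : ℝ) : ℂ) ≠ 0 := by
      exact_mod_cast harmNorm_ne_zero _ _
    rw [h1, Pi.smul_apply, harmLp, h2, sphHarmonic_eq, smul_eq_mul, inv_mul_cancel_left₀ h3]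
  | zero =>
    refine ⟨0, Submodule.zero_mem _, ?_⟩
    filter_upwards [Lp.coeFn_zero ℂ 2 sphereMeasure] with x hx
    rw [hx]
    simp [sectorial]
  | add p q _ _ hp hq =>
    obtain ⟨F, hF, hFp⟩ := hp
    obtain ⟨G, hG, hGq⟩ := hq
    refine ⟨F + G, Submodule.add_mem _ hF hG, ?_⟩
    filter_upwards [Lp.coeFn_add F G, hFp, hGq] with x h1 h2 h3
    rw [h1, Pi.add_apply, h2, h3]
    simp only [sectorial, eval_add]
    push_cast
    ring
  | smul a q _ hq =>
    obtain ⟨F, hF, hFq⟩ := hq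
    refine ⟨(a : ℂ) • F, Submodule.smul_mem _ _ hF, ?_⟩
    filter_upwards [Lp.coeFn_smul (a : ℂ) F, hFq] with x h1 h2
    rw [h1, Pi.smul_apply, h2]
    simp only [sectorial, eval_smul, smul_eq_mul]
    push_cast
    ring

/-- The function `x₀ + i x₁` on the sphere. -/
noncomputable def coordPlus : C(S2, ℂ) :=
  ⟨fun x => ((x.1 0 : ℝ) : ℂ) + ((x.1 1 : ℝ) : ℂ) * Complex.I, by
    have h0 := continuous_coord 0
    have h1 := continuous_coord 1
    fun_prop⟩

/-- The function `x₂` on the sphere. -/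
noncomputable def coordZ : C(S2, ℂ) :=
  ⟨fun x => ((x.1 2 : ℝ) : ℂ), by
    have h0 := continuous_coord 2
    fun_prop⟩

theorem coordPlus_apply (x : S2) : coordPlus x =
    Real.sin (colatitude x) * Complex.exp (Complex.I * longitude x) := by
  nth_rw 1 [← sphPoint_colatitude_longitude x]
  simp only [coordPlus, ContinuousMap.coe_mk, sphPoint_zero, sphPoint_one]
  rw [mul_comm Complex.I, Complex.exp_mul_I]
  push_cast
  ring

theorem coordZ_apply (x : S2) : coordZ x = Real.cos (colatitude x) := by
  nth_rw 1 [← sphPoint_colatitude_longitude x]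
  simp only [coordZ, ContinuousMap.coe_mk, sphPoint_two]

open Polynomial in
-- Since `a + b = |a - b| + 2 min a b`, the surplus of sines is even and becomes the polynomial `(1
-- - cos² θ)^(min a b)`.
theorem monomial_eq_sectorial (a b c : ℕ) (x : S2) :
    (coordPlus ^ a * star coordPlus ^ b * coordZ ^ c) x =
      sectorial ((a : ℤ) - b) ((1 - X ^ 2) ^ min a b * X ^ c) x := by
  have hn : ((a : ℤ) - b).natAbs + 2 * min a b = a + b := by omega
  simp only [ContinuousMap.mul_apply, ContinuousMap.pow_apply, ContinuousMap.star_apply,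
    coordPlus_apply, coordZ_apply, sectorial, eval_mul, eval_pow, eval_sub, eval_one, eval_X,
    RCLike.star_def, map_mul, Complex.conj_ofReal, ← Complex.exp_conj, Complex.conj_I]
  rw [← Real.sin_sq, ← pow_mul, ← mul_assoc (Real.sin _ ^ _), ← pow_add, hn, mul_pow, mul_pow,
    ← Complex.exp_nat_mul, ← Complex.exp_nat_mul]
  have e : Complex.exp (Complex.I * (((a : ℤ) - b : ℤ) : ℂ) * longitude x) =
      Complex.exp (a * (Complex.I * longitude x)) * Complex.exp (b * (-Complex.I * longitude x)) := by
    rw [← Complex.exp_add]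
    congr 1
    push_cast
    ring
  rw [e]
  push_cast
  ring

/-- The algebra of polynomial functions on the sphere. -/
noncomputable def polyAlg : StarSubalgebra ℂ C(S2, ℂ) := StarAlgebra.adjoin ℂ {coordPlus, coordZ}

theorem star_coordZ : star coordZ = coordZ := by
  ext x
  simp [coordZ]

theorem polyAlg_separatesPoints : polyAlg.SeparatesPoints := by
  intro x y hxy
  by_contra! h
  have hp : coordPlus x = coordPlus y :=
    h _ ⟨_, StarAlgebra.subset_adjoin ℂ _ (Set.mem_insert _ _), rfl⟩
  have hz : coordZ x = coordZ y :=
    h _ ⟨_, StarAlgebra.subset_adjoin ℂ _ (Set.mem_insert_of_mem _ rfl), rfl⟩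
  have h0 := congrArg Complex.re hp
  have h1 := congrArg Complex.im hp
  have h2 := congrArg Complex.re hz
  simp only [coordPlus, coordZ, ContinuousMap.coe_mk, Complex.add_re, Complex.add_im,
    Complex.ofReal_re, Complex.ofReal_im, Complex.mul_re, Complex.mul_im, Complex.I_re,
    Complex.I_im, mul_zero, mul_one, zero_add, add_zero, sub_zero] at h0 h1 h2
  refine hxy (Subtype.ext ?_)
  ext i
  fin_cases i
  · exact h0
  · exact h1
  · exact h2

theorem exists_monomial_of_mem_closure {g : C(S2, ℂ)}
    (hg : g ∈ Submonoid.closure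
      (({coordPlus, coordZ} : Set C(S2, ℂ)) ∪ star ({coordPlus, coordZ} : Set C(S2, ℂ)))) :
    ∃ a b c : ℕ, g = coordPlus ^ a * star coordPlus ^ b * coordZ ^ c := by
  induction hg using Submonoid.closure_induction with
  | mem g hg =>
    simp only [Set.mem_union, Set.mem_insert_iff, Set.mem_singleton_iff, Set.mem_star] at hg
    rcases hg with (rfl | rfl) | (h | h)
    · exact ⟨1, 0, 0, by simp⟩
    · exact ⟨0, 0, 1, by simp⟩
    · exact ⟨0, 1, 0, by rw [← h]; simp⟩
    · exact ⟨0, 0, 1, by rw [← star_star g, h, star_coordZ]; simp⟩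
  | one => exact ⟨0, 0, 0, by simp⟩
  | mul f g _ _ hf hg =>
    obtain ⟨a, b, c, rfl⟩ := hf
    obtain ⟨a', b', c', rfl⟩ := hg
    exact ⟨a + a', b + b', c + c', by ring⟩

theorem toLp_mem_span_of_mem_polyAlg {g : C(S2, ℂ)} (hg : g ∈ polyAlg) :
    ContinuousMap.toLp 2 sphereMeasure ℂ g ∈ Submodule.span ℂ (Set.range harmLp) := by
  have hg' : g ∈ Submodule.span ℂ (Submonoid.closure (({coordPlus, coordZ} : Set C(S2, ℂ)) ∪
      star ({coordPlus, coordZ} : Set C(S2, ℂ))) : Set C(S2, ℂ)) := by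
    rw [← Algebra.adjoin_eq_span]
    exact hg
  clear hg
  induction hg' using Submodule.span_induction with
  | mem g hg =>
    obtain ⟨a, b, c, rfl⟩ := exists_monomial_of_mem_closure hg
    obtain ⟨F, hF, hFs⟩ := exists_mem_span_ae_eq_sectorial ((a : ℤ) - b)
      ((1 - Polynomial.X ^ 2) ^ min a b * Polynomial.X ^ c)
    convert hF using 1
    refine Lp.ext ?_
    filter_upwards [ContinuousMap.coeFn_toLp (𝕜 := ℂ) (p := 2) sphereMeasure
      (coordPlus ^ a * star coordPlus ^ b * coordZ ^ c), hFs] with x h1 h2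
    rw [h1, h2, monomial_eq_sectorial]
  | zero => simp
  | add f g _ _ hf hg => rw [map_add]; exact Submodule.add_mem _ hf hg
  | smul a g _ hg => rw [map_smul]; exact Submodule.smul_mem _ _ hg

/-- Stone-Weierstrass makes the polynomial functions dense in `C(S²)`, which is dense in `L²`; by
`monomial_eq_sectorial` these polynomials are finite combinations of harmonics. -/
theorem topologicalClosure_span_harmLp :
    (Submodule.span ℂ (Set.range harmLp)).topologicalClosure = ⊤ := by
  have hdense : Dense (polyAlg : Set C(S2, ℂ)) := by
    have h := ContinuousMap.starSubalgebra_topologicalClosure_eq_top_of_separatesPoints polyAlg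
      polyAlg_separatesPoints
    rw [dense_iff_closure_eq, ← StarSubalgebra.topologicalClosure_coe, h]
    rfl
  have h2 := (ContinuousMap.toLp_denseRange ℂ sphereMeasure ℂ (p := 2) (by simp)).dense_image
    (ContinuousMap.toLp 2 sphereMeasure ℂ : C(S2, ℂ) →L[ℂ] Lp ℂ 2 sphereMeasure).continuous hdense
  refine Submodule.dense_iff_topologicalClosure_eq_top.1 (h2.mono ?_)
  rintro _ ⟨g, hg, rfl⟩
  exact toLp_mem_span_of_mem_polyAlg hg

/-- The Hilbert basis of spherical harmonics. -/
noncomputable def harmBasis : HilbertBasis HarmIdx ℂ (Lp ℂ 2 sphereMeasure) :=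
  HilbertBasis.mk orthonormal_harmLp topologicalClosure_span_harmLp.ge

theorem harmBasis_apply (i : HarmIdx) : harmBasis i = harmLp i := by
  rw [harmBasis, HilbertBasis.coe_mk]

/-! ### The Laplace-Beltrami operator in Cartesian coordinates -/

section CartesianLaplacian

/-- The `i`-th standard basis vector. -/
noncomputable def stdVec (i : Fin 3) : E3 := EuclideanSpace.single i (1 : ℝ)

/-- The unit vector of longitude `φ` in the equatorial plane. -/
noncomputable def rho (φ : ℝ) : E3 := Real.cos φ • stdVec 0 + Real.sin φ • stdVec 1

/-- The derivative of `rho`. -/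
noncomputable def rhoPerp (φ : ℝ) : E3 := -Real.sin φ • stdVec 0 + Real.cos φ • stdVec 1

/-- The point of the sphere with colatitude `θ` and longitude `φ` as a vector. -/
noncomputable def sphVec (θ φ : ℝ) : E3 := Real.sin θ • rho φ + Real.cos θ • stdVec 2

/-- The derivative of `sphVec` with respect to `θ`. -/
noncomputable def sphVecTheta (θ φ : ℝ) : E3 := Real.cos θ • rho φ - Real.sin θ • stdVec 2

theorem sphPoint_val (θ φ : ℝ) : (sphPoint θ φ).1 = sphVec θ φ := by
  ext i
  fin_cases i <;> simp [sphPoint, sphVec, rho, stdVec]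

theorem hasDerivAt_rho (φ : ℝ) : HasDerivAt rho (rhoPerp φ) φ :=
  ((Real.hasDerivAt_cos φ).smul_const _).add ((Real.hasDerivAt_sin φ).smul_const _)

theorem hasDerivAt_rhoPerp (φ : ℝ) : HasDerivAt rhoPerp (-rho φ) φ := by
  refine (((Real.hasDerivAt_sin φ).neg.smul_const _).add
    ((Real.hasDerivAt_cos φ).smul_const _)).congr_deriv ?_
  rw [rho]; module

theorem hasDerivAt_sphVec_theta (θ φ : ℝ) :
    HasDerivAt (fun θ => sphVec θ φ) (sphVecTheta θ φ) θ := by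
  refine (((Real.hasDerivAt_sin θ).smul_const _).add
    ((Real.hasDerivAt_cos θ).smul_const _)).congr_deriv ?_
  rw [sphVecTheta]; module

theorem hasDerivAt_sphVecTheta (θ φ : ℝ) :
    HasDerivAt (fun θ => sphVecTheta θ φ) (-sphVec θ φ) θ := by
  refine (((Real.hasDerivAt_cos θ).smul_const _).sub
    ((Real.hasDerivAt_sin θ).smul_const _)).congr_deriv ?_
  rw [sphVec]; module

theorem hasDerivAt_sphVec_phi (θ φ : ℝ) :
    HasDerivAt (fun φ => sphVec θ φ) (Real.sin θ • rhoPerp φ) φ :=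
  ((hasDerivAt_rho φ).const_smul (Real.sin θ)).add_const (Real.cos θ • stdVec 2)

theorem continuous_rho : Continuous rho := by unfold rho; fun_prop

theorem continuous_rhoPerp : Continuous rhoPerp := by unfold rhoPerp; fun_prop

theorem continuous_sphVec : Continuous fun p : ℝ × ℝ => sphVec p.1 p.2 := by
  have := continuous_rho
  unfold sphVec; fun_prop

theorem continuous_sphVecTheta : Continuous fun p : ℝ × ℝ => sphVecTheta p.1 p.2 := by
  have := continuous_rho
  unfold sphVecTheta; fun_prop

variable {ψ : E3 → ℝ} (hψ : ContDiff ℝ (⊤ : ℕ∞) ψ)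

include hψ in
theorem continuous_fderiv_of_smooth : Continuous (fderiv ℝ ψ) :=
  hψ.continuous_fderiv (by simp)

include hψ in
theorem contDiff_fderiv_of_smooth : ContDiff ℝ (⊤ : ℕ∞) (fderiv ℝ ψ) :=
  hψ.fderiv_right (by simp)

include hψ in
theorem continuous_fderiv_fderiv_of_smooth : Continuous (fderiv ℝ (fderiv ℝ ψ)) :=
  (contDiff_fderiv_of_smooth hψ).continuous_fderiv (by simp)

include hψ in
theorem hasDerivAt_comp_curve {γ : ℝ → E3} {v : E3} {t : ℝ} (hγ : HasDerivAt γ v t) :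
    HasDerivAt (fun t => ψ (γ t)) (fderiv ℝ ψ (γ t) v) t :=
  ((hψ.differentiable (by simp)) (γ t)).hasFDerivAt.comp_hasDerivAt t hγ

include hψ in
theorem hasDerivAt_fderiv_comp_curve {γ γ' : ℝ → E3} {w : E3} {t : ℝ}
    (hγ : HasDerivAt γ (γ' t) t) (hγ' : HasDerivAt γ' w t) :
    HasDerivAt (fun t => fderiv ℝ ψ (γ t) (γ' t))
      (fderiv ℝ (fderiv ℝ ψ) (γ t) (γ' t) (γ' t) + fderiv ℝ ψ (γ t) w) t := by
  have h := (((contDiff_fderiv_of_smooth hψ).differentiable (by simp))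
    (γ t)).hasFDerivAt.comp_hasDerivAt t hγ
  exact h.clm_apply hγ'

/-- The function `ψ` in spherical coordinates. -/
noncomputable def polarF (ψ : E3 → ℝ) (θ φ : ℝ) : ℝ := ψ (sphVec θ φ)

/-- The derivative of `polarF` in `θ`. -/
noncomputable def polarD (ψ : E3 → ℝ) (θ φ : ℝ) : ℝ := fderiv ℝ ψ (sphVec θ φ) (sphVecTheta θ φ)

/-- The second derivative of `polarF` in `θ`. -/
noncomputable def polarDD (ψ : E3 → ℝ) (θ φ : ℝ) : ℝ :=
  fderiv ℝ (fderiv ℝ ψ) (sphVec θ φ) (sphVecTheta θ φ) (sphVecTheta θ φ) -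
    fderiv ℝ ψ (sphVec θ φ) (sphVec θ φ)

/-- The derivative of `polarF` in `φ`. -/
noncomputable def polarE (ψ : E3 → ℝ) (θ φ : ℝ) : ℝ :=
  fderiv ℝ ψ (sphVec θ φ) (Real.sin θ • rhoPerp φ)

/-- The second derivative of `polarF` in `φ`, divided by `sin θ`. -/
noncomputable def polarEE (ψ : E3 → ℝ) (θ φ : ℝ) : ℝ :=
  Real.sin θ * fderiv ℝ (fderiv ℝ ψ) (sphVec θ φ) (rhoPerp φ) (rhoPerp φ) -
    fderiv ℝ ψ (sphVec θ φ) (rho φ)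

/-- The Laplace-Beltrami operator in Cartesian terms. -/
noncomputable def polarLap (ψ : E3 → ℝ) (θ φ : ℝ) : ℝ :=
  fderiv ℝ (fderiv ℝ ψ) (sphVec θ φ) (sphVecTheta θ φ) (sphVecTheta θ φ) +
    fderiv ℝ (fderiv ℝ ψ) (sphVec θ φ) (rhoPerp φ) (rhoPerp φ) -
      2 * fderiv ℝ ψ (sphVec θ φ) (sphVec θ φ)

include hψ

theorem hasDerivAt_polarF_theta (θ φ : ℝ) :
    HasDerivAt (fun θ => polarF ψ θ φ) (polarD ψ θ φ) θ :=
  hasDerivAt_comp_curve hψ (hasDerivAt_sphVec_theta θ φ)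

theorem hasDerivAt_polarD (θ φ : ℝ) :
    HasDerivAt (fun θ => polarD ψ θ φ) (polarDD ψ θ φ) θ := by
  refine (hasDerivAt_fderiv_comp_curve hψ (hasDerivAt_sphVec_theta θ φ)
    (hasDerivAt_sphVecTheta θ φ)).congr_deriv ?_
  rw [polarDD, map_neg]; ring

theorem hasDerivAt_polarF_phi (θ φ : ℝ) :
    HasDerivAt (fun φ => polarF ψ θ φ) (polarE ψ θ φ) φ :=
  hasDerivAt_comp_curve hψ (hasDerivAt_sphVec_phi θ φ)

theorem hasDerivAt_polarE (θ φ : ℝ) :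
    HasDerivAt (fun φ => polarE ψ θ φ) (Real.sin θ * polarEE ψ θ φ) φ := by
  refine (hasDerivAt_fderiv_comp_curve hψ (hasDerivAt_sphVec_phi θ φ)
    (γ' := fun φ => Real.sin θ • rhoPerp φ)
    ((hasDerivAt_rhoPerp φ).const_smul (Real.sin θ))).congr_deriv ?_
  simp only [polarEE, map_smul, map_neg, smul_neg, _root_.smul_apply, smul_eq_mul]
  ring

theorem continuous_polarF : Continuous fun p : ℝ × ℝ => polarF ψ p.1 p.2 :=
  hψ.continuous.comp continuous_sphVec

theorem continuous_polarD : Continuous fun p : ℝ × ℝ => polarD ψ p.1 p.2 :=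
  ((continuous_fderiv_of_smooth hψ).comp continuous_sphVec).clm_apply continuous_sphVecTheta

theorem continuous_polarDD : Continuous fun p : ℝ × ℝ => polarDD ψ p.1 p.2 :=
  ((((continuous_fderiv_fderiv_of_smooth hψ).comp continuous_sphVec).clm_apply
    continuous_sphVecTheta).clm_apply continuous_sphVecTheta).sub
    (((continuous_fderiv_of_smooth hψ).comp continuous_sphVec).clm_apply continuous_sphVec)

theorem continuous_polarEE : Continuous fun p : ℝ × ℝ => polarEE ψ p.1 p.2 :=
  ((Real.continuous_sin.comp continuous_fst).mul
    ((((continuous_fderiv_fderiv_of_smooth hψ).comp continuous_sphVec).clm_apply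
      (continuous_rhoPerp.comp continuous_snd)).clm_apply
        (continuous_rhoPerp.comp continuous_snd))).sub
    (((continuous_fderiv_of_smooth hψ).comp continuous_sphVec).clm_apply
      (continuous_rho.comp continuous_snd))

theorem continuous_polarLap : Continuous fun p : ℝ × ℝ => polarLap ψ p.1 p.2 :=
  (((((continuous_fderiv_fderiv_of_smooth hψ).comp continuous_sphVec).clm_apply
    continuous_sphVecTheta).clm_apply continuous_sphVecTheta).add
    ((((continuous_fderiv_fderiv_of_smooth hψ).comp continuous_sphVec).clm_apply
      (continuous_rhoPerp.comp continuous_snd)).clm_apply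
        (continuous_rhoPerp.comp continuous_snd))).sub
    ((((continuous_fderiv_of_smooth hψ).comp continuous_sphVec).clm_apply
      continuous_sphVec).const_mul 2)

omit hψ in
-- Decomposing `rho` into tangential and radial parts cancels the term `cos θ ∂_θ`, and what remains
-- is divisible by `sin θ`. Hence the coordinate singularity at the poles is removable and
-- `polarLap` is continuous.
theorem sin_mul_polarLap (ψ : E3 → ℝ) (θ φ : ℝ) : Real.sin θ * polarLap ψ θ φ =
    Real.cos θ * polarD ψ θ φ + Real.sin θ * polarDD ψ θ φ + polarEE ψ θ φ := by
  have h1 : fderiv ℝ ψ (sphVec θ φ) (rho φ) =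
      Real.cos θ * fderiv ℝ ψ (sphVec θ φ) (sphVecTheta θ φ) +
        Real.sin θ * fderiv ℝ ψ (sphVec θ φ) (sphVec θ φ) := by
    rw [← smul_eq_mul, ← smul_eq_mul, ← map_smul, ← map_smul, ← map_add]
    congr 1
    have h := Real.sin_sq_add_cos_sq θ
    have e : Real.cos θ • sphVecTheta θ φ + Real.sin θ • sphVec θ φ =
        (Real.sin θ ^ 2 + Real.cos θ ^ 2) • rho φ := by
      rw [sphVecTheta, sphVec]; module
    rw [e, h, one_smul]
  rw [polarLap, polarD, polarDD, polarEE, h1]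
  ring

theorem classicalLaplacian_eq {x : S2} (hx : colatitude x ∈ Set.Ioo 0 Real.pi) :
    classicalLaplacian (fun y : S2 => ψ y) x = polarLap ψ (colatitude x) (longitude x) := by
  have hs := (Real.sin_pos_of_mem_Ioo hx).ne'
  set θ := colatitude x
  set φ := longitude x
  have h1 : (fun θ => Real.sin θ * deriv (fun θ' => ψ (sphPoint θ' φ).1) θ) =
      fun θ => Real.sin θ * polarD ψ θ φ := by
    ext θ
    simp_rw [sphPoint_val]
    rw [← (hasDerivAt_polarF_theta hψ θ φ).deriv]
    rfl
  have h2 : iteratedDeriv 2 (fun φ => ψ (sphPoint θ φ).1) φ = Real.sin θ * polarEE ψ θ φ := by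
    simp_rw [sphPoint_val]
    rw [iteratedDeriv_succ, iteratedDeriv_one]
    have : deriv (fun φ => ψ (sphVec θ φ)) = fun φ => polarE ψ θ φ :=
      funext fun φ => (hasDerivAt_polarF_phi hψ θ φ).deriv
    rw [this, (hasDerivAt_polarE hψ θ φ).deriv]
  have h3 := ((Real.hasDerivAt_sin θ).mul (hasDerivAt_polarD hψ θ φ)).deriv
  rw [classicalLaplacian, h1, h2]
  have h4 : deriv (fun θ => Real.sin θ * polarD ψ θ φ) θ =
      Real.cos θ * polarD ψ θ φ + Real.sin θ * polarDD ψ θ φ := h3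
  rw [h4]
  change 1 / Real.sin θ * _ + (1 / Real.sin θ) ^ 2 * _ = _
  have h5 := sin_mul_polarLap ψ θ φ
  field_simp
  linarith

theorem ae_classicalLaplacian_eq : ∀ᵐ x ∂sphereMeasure,
    classicalLaplacian (fun y : S2 => ψ y) x = polarLap ψ (colatitude x) (longitude x) := by
  filter_upwards [ae_sin_colatitude_pos] with x hx
  exact classicalLaplacian_eq hψ hx

omit hψ in
theorem memLp_of_coord {G : ℝ → ℝ → ℝ} (hG : Continuous fun p : ℝ × ℝ => G p.1 p.2) :
    MemLp (fun x => G (colatitude x) (longitude x)) 2 sphereMeasure := by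
  have hK : IsCompact (Set.Icc (0 : ℝ) Real.pi ×ˢ Set.Icc (-Real.pi) Real.pi) :=
    isCompact_Icc.prod isCompact_Icc
  obtain ⟨C, hC⟩ := hK.exists_bound_of_continuousOn hG.continuousOn
  have hm : Measurable fun x : S2 => G (colatitude x) (longitude x) :=
    hG.measurable.comp (continuous_colatitude.measurable.prodMk measurable_longitude)
  exact MemLp.of_bound hm.aestronglyMeasurable C (ae_of_all _ fun x =>
    hC (colatitude x, longitude x)
      ⟨colatitude_mem x, Set.Ioc_subset_Icc_self (longitude_mem x)⟩)

theorem memLp_classicalLaplacian :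
    MemLp (classicalLaplacian (fun y : S2 => ψ y)) 2 sphereMeasure :=
  (memLp_congr_ae (ae_classicalLaplacian_eq hψ)).2 (memLp_of_coord (continuous_polarLap hψ))

end CartesianLaplacian

/-! ### Green's formula for spherical harmonics -/

section Green

/-- `sin θ R'(θ)` for `R(θ) = sinⁿ θ p(cos θ)`, where `p` is the `n`-th derivative of a Legendre
polynomial. -/
noncomputable def radFlux (l n : ℕ) (θ : ℝ) : ℝ :=
  n * Real.sin θ ^ n * Real.cos θ * (legD l n).eval (Real.cos θ) -
    Real.sin θ ^ (n + 2) * (legD l (n + 1)).eval (Real.cos θ)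

/-- The radial part `sinⁿ θ p(cos θ)` of a spherical harmonic. -/
noncomputable def radPart (l n : ℕ) (θ : ℝ) : ℝ :=
  Real.sin θ ^ n * (legD l n).eval (Real.cos θ)

theorem continuous_radPart (l n : ℕ) : Continuous (radPart l n) :=
  (Real.continuous_sin.pow _).mul ((legD l n).continuous.comp Real.continuous_cos)

theorem hasDerivAt_legD_cos (l n : ℕ) (θ : ℝ) :
    HasDerivAt (fun θ => (legD l n).eval (Real.cos θ))
      (-(Real.sin θ * (legD l (n + 1)).eval (Real.cos θ))) θ := by
  have h := ((legD l n).hasDerivAt (Real.cos θ)).comp θ (Real.hasDerivAt_cos θ)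
  rw [derivative_legD] at h
  refine h.congr_deriv ?_
  ring

/-- Only the flux `sin θ R'` enters Green's formula; the extra sine also absorbs the exponent `n -
1`. -/
theorem exists_hasDerivAt_radPart (l n : ℕ) (θ : ℝ) :
    ∃ r, HasDerivAt (radPart l n) r θ ∧ Real.sin θ * r = radFlux l n θ := by
  refine ⟨_, ((Real.hasDerivAt_sin θ).pow n).mul (hasDerivAt_legD_cos l n θ), ?_⟩
  rw [radFlux]
  simp only [Pi.pow_apply]
  rcases n with _ | n
  · simp; ring
  · rw [Nat.add_sub_cancel]; ring

/-- The derivative of `radFlux`. -/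
noncomputable def radFluxDeriv (l n : ℕ) (θ : ℝ) : ℝ :=
  n * (n * Real.sin θ ^ (n - 1) * Real.cos θ) * Real.cos θ * (legD l n).eval (Real.cos θ) -
    n * Real.sin θ ^ (n + 1) * (legD l n).eval (Real.cos θ) -
    (2 * n + 2) * Real.sin θ ^ (n + 1) * Real.cos θ * (legD l (n + 1)).eval (Real.cos θ) +
    Real.sin θ ^ (n + 3) * (legD l (n + 2)).eval (Real.cos θ)

theorem hasDerivAt_radFlux (l n : ℕ) (θ : ℝ) :
    HasDerivAt (radFlux l n) (radFluxDeriv l n θ) θ := by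
  have h1 := (((((Real.hasDerivAt_sin θ).pow n).const_mul (n : ℝ)).mul
    (Real.hasDerivAt_cos θ)).mul (hasDerivAt_legD_cos l n θ))
  have h2 := ((Real.hasDerivAt_sin θ).pow (n + 2)).mul (hasDerivAt_legD_cos l (n + 1) θ)
  refine (h1.sub h2).congr_deriv ?_
  simp only [radFluxDeriv, Pi.pow_apply, Pi.mul_apply]
  push_cast
  ring

theorem continuous_radFluxDeriv (l n : ℕ) : Continuous (radFluxDeriv l n) := by
  have h (k : ℕ) : Continuous fun θ => (legD l k).eval (Real.cos θ) :=
    (legD l k).continuous.comp Real.continuous_cos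
  have := h n
  have := h (n + 1)
  have := h (n + 2)
  unfold radFluxDeriv
  fun_prop

/-- The eigenvalue equation for the radial part of a spherical harmonic. -/
theorem sin_mul_radFluxDeriv (l n : ℕ) (θ : ℝ) :
    Real.sin θ * radFluxDeriv l n θ - n ^ 2 * radPart l n θ =
      -eigval l * Real.sin θ ^ 2 * radPart l n θ := by
  have ode := legD_ode l n (Real.cos θ)
  have hs := Real.sin_sq_add_cos_sq θ
  have hs' : Real.sin θ ^ 2 = 1 - Real.cos θ ^ 2 := by linarith
  rw [← hs'] at ode
  rw [radFluxDeriv, radPart, eigval]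
  rcases n with _ | n
  · simp only [Nat.cast_zero] at ode ⊢
    linear_combination Real.sin θ ^ 2 * ode
  · rw [Nat.add_sub_cancel]
    push_cast at ode ⊢
    linear_combination (Real.sin θ ^ (n + 3)) * ode +
      (((n : ℝ) + 1) ^ 2 * Real.sin θ ^ (n + 1) *
        (legD l (n + 1)).eval (Real.cos θ)) * hs

variable {ψ : E3 → ℝ} (hψ : ContDiff ℝ (⊤ : ℕ∞) ψ)

include hψ

/-- The integrands differ by the derivative of `sin θ f_θ R - f sin θ R'`. It vanishes at both
poles, the flux because of its factor `n` when `n = 0` and its sines otherwise. -/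
theorem integral_theta_by_parts (l n : ℕ) (φ : ℝ) :
    ∫ θ in (0 : ℝ)..Real.pi,
      (Real.cos θ * polarD ψ θ φ + Real.sin θ * polarDD ψ θ φ) * radPart l n θ =
    ∫ θ in (0 : ℝ)..Real.pi, polarF ψ θ φ * radFluxDeriv l n θ := by
  have hd : ∀ θ, HasDerivAt
      (fun θ => Real.sin θ * polarD ψ θ φ * radPart l n θ - polarF ψ θ φ * radFlux l n θ)
      ((Real.cos θ * polarD ψ θ φ + Real.sin θ * polarDD ψ θ φ) * radPart l n θ -
        polarF ψ θ φ * radFluxDeriv l n θ) θ := by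
    intro θ
    obtain ⟨r, hr, hr2⟩ := exists_hasDerivAt_radPart l n θ
    have h := (((Real.hasDerivAt_sin θ).mul (hasDerivAt_polarD hψ θ φ)).mul hr).sub
      ((hasDerivAt_polarF_theta hψ θ φ).mul (hasDerivAt_radFlux l n θ))
    refine h.congr_deriv ?_
    simp only [Pi.mul_apply]
    linear_combination (polarD ψ θ φ) * hr2
  have hφ : Continuous fun θ : ℝ => (θ, φ) := by fun_prop
  have c1 : Continuous fun θ => (Real.cos θ * polarD ψ θ φ + Real.sin θ * polarDD ψ θ φ) *
      radPart l n θ :=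
    ((Real.continuous_cos.mul ((continuous_polarD hψ).comp hφ)).add
      (Real.continuous_sin.mul ((continuous_polarDD hψ).comp hφ))).mul (continuous_radPart l n)
  have c2 : Continuous fun θ => polarF ψ θ φ * radFluxDeriv l n θ :=
    ((continuous_polarF hψ).comp hφ).mul (continuous_radFluxDeriv l n)
  have hF := intervalIntegral.integral_eq_sub_of_hasDerivAt (a := 0) (b := Real.pi)
    (fun θ _ => hd θ) ((c1.sub c2).intervalIntegrable _ _)
  rw [intervalIntegral.integral_sub (c1.intervalIntegrable _ _) (c2.intervalIntegrable _ _)] at hF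
  rw [← sub_eq_zero, hF]
  have e0 : radFlux l n 0 = 0 := by
    rw [radFlux]; rcases n with _ | n <;> simp
  have e1 : radFlux l n Real.pi = 0 := by
    rw [radFlux]; rcases n with _ | n <;> simp
  simp [e0, e1]

/-- Two integrations by parts; the boundary terms cancel by periodicity, which for the exponential
uses that `m` is an integer. -/
theorem integral_phi_by_parts (m : ℤ) (θ : ℝ) :
    ∫ φ in (-Real.pi)..Real.pi,
      ((Real.sin θ * polarEE ψ θ φ : ℝ) : ℂ) * Complex.exp (Complex.I * m * φ) =
    -(m : ℂ) ^ 2 * ∫ φ in (-Real.pi)..Real.pi,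
      (polarF ψ θ φ : ℂ) * Complex.exp (Complex.I * m * φ) := by
  have hexp : ∀ φ : ℝ, HasDerivAt (fun φ : ℝ => Complex.exp (Complex.I * m * φ))
      (Complex.I * m * Complex.exp (Complex.I * m * φ)) φ := by
    intro φ
    have h1 : HasDerivAt (fun φ : ℝ => Complex.I * m * (φ : ℂ)) (Complex.I * m) φ := by
      simpa using ((hasDerivAt_id φ).ofReal_comp).const_mul (Complex.I * (m : ℂ))
    refine h1.cexp.congr_deriv ?_
    ring
  have hd : ∀ φ, HasDerivAt
      (fun φ : ℝ => (polarE ψ θ φ : ℂ) * Complex.exp (Complex.I * m * φ) -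
        (polarF ψ θ φ : ℂ) * (Complex.I * m * Complex.exp (Complex.I * m * φ)))
      (((Real.sin θ * polarEE ψ θ φ : ℝ) : ℂ) * Complex.exp (Complex.I * m * φ) -
        -(m : ℂ) ^ 2 * ((polarF ψ θ φ : ℂ) * Complex.exp (Complex.I * m * φ))) φ := by
    intro φ
    have h := ((hasDerivAt_polarE hψ θ φ).ofReal_comp.mul (hexp φ)).sub
      ((hasDerivAt_polarF_phi hψ θ φ).ofReal_comp.mul ((hexp φ).const_mul (Complex.I * m)))
    refine h.congr_deriv ?_
    linear_combination (-(polarF ψ θ φ : ℂ) * m ^ 2 * Complex.exp (Complex.I * m * φ)) *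
      Complex.I_sq
  have hθ : Continuous fun φ : ℝ => (θ, φ) := by fun_prop
  have hE : Continuous fun φ : ℝ => Complex.exp (Complex.I * m * φ) := by fun_prop
  have c1 : Continuous fun φ : ℝ =>
      ((Real.sin θ * polarEE ψ θ φ : ℝ) : ℂ) * Complex.exp (Complex.I * m * φ) :=
    (Complex.continuous_ofReal.comp
      (((continuous_polarEE hψ).comp hθ).const_mul (Real.sin θ))).mul hE
  have c2 : Continuous fun φ : ℝ => (polarF ψ θ φ : ℂ) * Complex.exp (Complex.I * m * φ) :=
    (Complex.continuous_ofReal.comp ((continuous_polarF hψ).comp hθ)).mul hE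
  have hF := intervalIntegral.integral_eq_sub_of_hasDerivAt (a := -Real.pi) (b := Real.pi)
    (fun φ _ => hd φ) ((c1.sub (c2.const_mul _)).intervalIntegrable _ _)
  rw [intervalIntegral.integral_sub (c1.intervalIntegrable _ _)
    ((c2.const_mul _).intervalIntegrable _ _), intervalIntegral.integral_const_mul] at hF
  rw [← sub_eq_zero, hF]
  have hr : rho (-Real.pi) = rho Real.pi := by simp [rho]
  have hr' : rhoPerp (-Real.pi) = rhoPerp Real.pi := by simp [rhoPerp]
  have e1 : polarF ψ θ (-Real.pi) = polarF ψ θ Real.pi := by simp only [polarF, sphVec, hr]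
  have e2 : polarE ψ θ (-Real.pi) = polarE ψ θ Real.pi := by simp only [polarE, sphVec, hr, hr']
  have e3 : Complex.exp (Complex.I * m * ((-Real.pi : ℝ) : ℂ)) =
      Complex.exp (Complex.I * m * (Real.pi : ℂ)) := by
    rw [Complex.exp_eq_exp_iff_exists_int]
    exact ⟨-m, by push_cast; ring⟩
  rw [e1, e2, e3, sub_self]

end Green

section GreenFormula

theorem intervalIntegral_swap_of_continuous {a b c d : ℝ} (hab : a ≤ b) (hcd : c ≤ d)
    {f : ℝ → ℝ → ℂ} (hf : Continuous fun p : ℝ × ℝ => f p.1 p.2) :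
    ∫ x in a..b, ∫ y in c..d, f x y = ∫ y in c..d, ∫ x in a..b, f x y := by
  have hint : IntegrableOn (fun p : ℝ × ℝ => f p.1 p.2) (Set.Ioc a b ×ˢ Set.Ioc c d)
      (volume.prod volume) :=
    (hf.continuousOn.integrableOn_compact (isCompact_Icc.prod isCompact_Icc)).mono_set
      (Set.prod_mono Set.Ioc_subset_Icc_self Set.Ioc_subset_Icc_self)
  rw [IntegrableOn, ← Measure.prod_restrict] at hint
  simp_rw [intervalIntegral.integral_of_le hab, intervalIntegral.integral_of_le hcd]
  exact integral_integral_swap hint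

variable {ψ : E3 → ℝ} (hψ : ContDiff ℝ (⊤ : ℕ∞) ψ)

/-- The `φ`-integral of `polarF` against `exp(i m φ)`. -/
noncomputable def azimuthal (ψ : E3 → ℝ) (m : ℤ) (θ : ℝ) : ℂ :=
  ∫ φ in (-Real.pi)..Real.pi, (polarF ψ θ φ : ℂ) * Complex.exp (Complex.I * m * φ)

include hψ

theorem continuous_azimuthal (m : ℤ) : Continuous (azimuthal ψ m) := by
  refine intervalIntegral.continuous_parametric_intervalIntegral_of_continuous' ?_ _ _
  refine (Complex.continuous_ofReal.comp (continuous_polarF hψ)).mul ?_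
  fun_prop

theorem integral_polar_theta (l : ℕ) (m : ℤ) :
    ∫ θ in (0 : ℝ)..Real.pi, ∫ φ in (-Real.pi)..Real.pi,
      (((Real.cos θ * polarD ψ θ φ + Real.sin θ * polarDD ψ θ φ) *
        radPart l m.natAbs θ : ℝ) : ℂ) * Complex.exp (Complex.I * m * φ) =
    ∫ θ in (0 : ℝ)..Real.pi, (radFluxDeriv l m.natAbs θ : ℂ) * azimuthal ψ m θ := by
  have hpi : -Real.pi ≤ Real.pi := by linarith [Real.pi_pos]
  have hE : Continuous fun p : ℝ × ℝ => Complex.exp (Complex.I * m * p.2) := by fun_prop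
  have c1 : Continuous fun p : ℝ × ℝ =>
      (((Real.cos p.1 * polarD ψ p.1 p.2 + Real.sin p.1 * polarDD ψ p.1 p.2) *
        radPart l m.natAbs p.1 : ℝ) : ℂ) * Complex.exp (Complex.I * m * p.2) :=
    (Complex.continuous_ofReal.comp ((((Real.continuous_cos.comp continuous_fst).mul
      (continuous_polarD hψ)).add ((Real.continuous_sin.comp continuous_fst).mul
      (continuous_polarDD hψ))).mul ((continuous_radPart l m.natAbs).comp continuous_fst))).mul hE
  have c2 : Continuous fun p : ℝ × ℝ =>
      ((polarF ψ p.1 p.2 * radFluxDeriv l m.natAbs p.1 : ℝ) : ℂ) *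
        Complex.exp (Complex.I * m * p.2) :=
    (Complex.continuous_ofReal.comp ((continuous_polarF hψ).mul
      ((continuous_radFluxDeriv l m.natAbs).comp continuous_fst))).mul hE
  rw [intervalIntegral_swap_of_continuous Real.pi_pos.le hpi c1]
  simp_rw [intervalIntegral.integral_mul_const, intervalIntegral.integral_ofReal,
    integral_theta_by_parts hψ, ← intervalIntegral.integral_ofReal,
    ← intervalIntegral.integral_mul_const]
  rw [← intervalIntegral_swap_of_continuous Real.pi_pos.le hpi c2]
  refine intervalIntegral.integral_congr fun θ _ => ?_
  simp only [azimuthal]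
  rw [← intervalIntegral.integral_const_mul]
  refine intervalIntegral.integral_congr fun φ _ => ?_
  push_cast
  ring

theorem integral_polar_laplacian (l : ℕ) (m : ℤ) :
    ∫ θ in (0 : ℝ)..Real.pi, ∫ φ in (-Real.pi)..Real.pi,
      ((Real.sin θ * polarLap ψ θ φ * radPart l m.natAbs θ : ℝ) : ℂ) *
        Complex.exp (Complex.I * m * φ) =
    -(eigval l : ℂ) * ∫ θ in (0 : ℝ)..Real.pi, ∫ φ in (-Real.pi)..Real.pi,
      ((Real.sin θ * polarF ψ θ φ * radPart l m.natAbs θ : ℝ) : ℂ) *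
        Complex.exp (Complex.I * m * φ) := by
  have hE : Continuous fun p : ℝ × ℝ => Complex.exp (Complex.I * m * p.2) := by fun_prop
  have c1 : Continuous fun p : ℝ × ℝ =>
      (((Real.cos p.1 * polarD ψ p.1 p.2 + Real.sin p.1 * polarDD ψ p.1 p.2) *
        radPart l m.natAbs p.1 : ℝ) : ℂ) * Complex.exp (Complex.I * m * p.2) :=
    (Complex.continuous_ofReal.comp ((((Real.continuous_cos.comp continuous_fst).mul
      (continuous_polarD hψ)).add ((Real.continuous_sin.comp continuous_fst).mul
      (continuous_polarDD hψ))).mul ((continuous_radPart l m.natAbs).comp continuous_fst))).mul hE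
  have c2 : Continuous fun p : ℝ × ℝ =>
      ((polarEE ψ p.1 p.2 * radPart l m.natAbs p.1 : ℝ) : ℂ) *
        Complex.exp (Complex.I * m * p.2) :=
    (Complex.continuous_ofReal.comp ((continuous_polarEE hψ).mul
      ((continuous_radPart l m.natAbs).comp continuous_fst))).mul hE
  have hθ (θ : ℝ) : Continuous fun φ : ℝ => (θ, φ) := by fun_prop
  have i1 := intervalIntegral.continuous_parametric_intervalIntegral_of_continuous'
    (μ := volume) (f := fun θ φ => (((Real.cos θ * polarD ψ θ φ + Real.sin θ * polarDD ψ θ φ) *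
        radPart l m.natAbs θ : ℝ) : ℂ) * Complex.exp (Complex.I * m * φ)) c1 (-Real.pi) Real.pi
  have i2 := intervalIntegral.continuous_parametric_intervalIntegral_of_continuous'
    (μ := volume) (f := fun θ φ => ((polarEE ψ θ φ * radPart l m.natAbs θ : ℝ) : ℂ) *
        Complex.exp (Complex.I * m * φ)) c2 (-Real.pi) Real.pi
  have i3 : Continuous fun θ => (radFluxDeriv l m.natAbs θ : ℂ) * azimuthal ψ m θ :=
    (Complex.continuous_ofReal.comp (continuous_radFluxDeriv _ _)).mul (continuous_azimuthal hψ m)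
  have e1 : ∀ θ, ∫ φ in (-Real.pi)..Real.pi,
      ((Real.sin θ * polarLap ψ θ φ * radPart l m.natAbs θ : ℝ) : ℂ) *
        Complex.exp (Complex.I * m * φ) =
      (∫ φ in (-Real.pi)..Real.pi,
      (((Real.cos θ * polarD ψ θ φ + Real.sin θ * polarDD ψ θ φ) *
        radPart l m.natAbs θ : ℝ) : ℂ) * Complex.exp (Complex.I * m * φ)) +
      ∫ φ in (-Real.pi)..Real.pi, ((polarEE ψ θ φ * radPart l m.natAbs θ : ℝ) : ℂ) *
        Complex.exp (Complex.I * m * φ) := by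
    intro θ
    refine Eq.trans ?_ (intervalIntegral.integral_add ((c1.comp (hθ θ)).intervalIntegrable _ _)
      ((c2.comp (hθ θ)).intervalIntegrable _ _))
    refine intervalIntegral.integral_congr fun φ _ => ?_
    simp only [sin_mul_polarLap]
    push_cast
    ring
  have e2 : ∀ θ, ∫ φ in (-Real.pi)..Real.pi,
      ((Real.sin θ * polarF ψ θ φ * radPart l m.natAbs θ : ℝ) : ℂ) *
        Complex.exp (Complex.I * m * φ) =
      ((Real.sin θ * radPart l m.natAbs θ : ℝ) : ℂ) * azimuthal ψ m θ := by
    intro θ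
    rw [azimuthal, ← intervalIntegral.integral_const_mul]
    refine intervalIntegral.integral_congr fun φ _ => ?_
    push_cast
    ring
  simp_rw [e1, e2]
  rw [intervalIntegral.integral_add (i1.intervalIntegrable _ _) (i2.intervalIntegrable _ _),
    integral_polar_theta hψ,
    ← intervalIntegral.integral_add (i3.intervalIntegrable _ _) (i2.intervalIntegrable _ _),
    ← intervalIntegral.integral_const_mul, intervalIntegral.integral_of_le Real.pi_pos.le,
    intervalIntegral.integral_of_le Real.pi_pos.le, integral_Ioc_eq_integral_Ioo,
    integral_Ioc_eq_integral_Ioo]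
  -- The `φ`-integration by parts and the radial equation both carry a factor `sin θ`, so the
  -- integrands are compared after multiplying by it. Hence the passage to the open interval.
  refine setIntegral_congr_fun measurableSet_Ioo fun θ hθ' => ?_
  have hs : (Real.sin θ : ℂ) ≠ 0 := by exact_mod_cast (Real.sin_pos_of_mem_Ioo hθ').ne'
  have e3 : (Real.sin θ : ℂ) * ∫ φ in (-Real.pi)..Real.pi,
      ((polarEE ψ θ φ * radPart l m.natAbs θ : ℝ) : ℂ) * Complex.exp (Complex.I * m * φ) =
      (radPart l m.natAbs θ : ℂ) * (-(m : ℂ) ^ 2 * azimuthal ψ m θ) := by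
    rw [azimuthal, ← integral_phi_by_parts hψ, ← intervalIntegral.integral_const_mul,
      ← intervalIntegral.integral_const_mul]
    refine intervalIntegral.integral_congr fun φ _ => ?_
    push_cast
    ring
  have e4 : (Real.sin θ : ℂ) * radFluxDeriv l m.natAbs θ -
      (m : ℂ) ^ 2 * radPart l m.natAbs θ =
      -(eigval l : ℂ) * Real.sin θ ^ 2 * radPart l m.natAbs θ := by
    have h := sin_mul_radFluxDeriv l m.natAbs θ
    have hm : ((m.natAbs : ℝ)) ^ 2 = (m : ℝ) ^ 2 := by
      rw [← Int.cast_natCast, ← Int.cast_pow, Int.natAbs_sq, Int.cast_pow]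
    rw [hm] at h
    exact_mod_cast congrArg (fun r : ℝ => (r : ℂ)) h
  refine mul_left_cancel₀ hs ?_
  push_cast at e3 e4 ⊢
  linear_combination e3 + azimuthal ψ m θ * e4

/-- Green's formula: spherical harmonics are weak eigenfunctions of the Laplace-Beltrami
operator. -/
theorem integral_classicalLaplacian_mul_sphHarmonic (l : ℕ) (m : ℤ) :
    ∫ x, (classicalLaplacian (fun y : S2 => ψ y) x : ℂ) * sphHarmonic l m x ∂sphereMeasure =
      -(eigval l : ℂ) * ∫ x, (ψ (x : S2) : ℂ) * sphHarmonic l m x ∂sphereMeasure := by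
  have hE : Continuous fun p : ℝ × ℝ => Complex.exp (Complex.I * m * p.2) := by fun_prop
  have hL := (memLp_classicalLaplacian hψ).aestronglyMeasurable
  have m1 : AEStronglyMeasurable (fun x => (classicalLaplacian (fun y : S2 => ψ y) x : ℂ) *
      sphHarmonic l m x) sphereMeasure :=
    (Complex.continuous_ofReal.comp_aestronglyMeasurable hL).mul
      (measurable_sphHarmonic l m).aestronglyMeasurable
  have m2 : AEStronglyMeasurable (fun x => (ψ (x : S2) : ℂ) * sphHarmonic l m x) sphereMeasure :=
    (Complex.continuous_ofReal.comp (hψ.continuous.comp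
      continuous_subtype_val)).aestronglyMeasurable.mul
      (measurable_sphHarmonic l m).aestronglyMeasurable
  have key : ∀ {f : S2 → ℝ} {g : ℝ → ℝ → ℝ}, (Continuous fun p : ℝ × ℝ => g p.1 p.2) →
      (∀ p ∈ coordRect, f (sphPoint p.1 p.2) = g p.1 p.2) →
      AEStronglyMeasurable (fun x => (f x : ℂ) * sphHarmonic l m x) sphereMeasure →
      ∫ x, (f x : ℂ) * sphHarmonic l m x ∂sphereMeasure =
        ((harmNorm l m / (4 * Real.pi) : ℝ) : ℂ) *
          ∫ θ in (0 : ℝ)..Real.pi, ∫ φ in (-Real.pi)..Real.pi,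
            ((Real.sin θ * g θ φ * radPart l m.natAbs θ : ℝ) : ℂ) *
              Complex.exp (Complex.I * m * φ) := by
    intro f g hg hfg hmeas
    have hc : Continuous fun p : ℝ × ℝ => ((harmNorm l m / (4 * Real.pi) : ℝ) : ℂ) *
        (((Real.sin p.1 * g p.1 p.2 * radPart l m.natAbs p.1 : ℝ) : ℂ) *
          Complex.exp (Complex.I * m * p.2)) :=
      ((Complex.continuous_ofReal.comp (((Real.continuous_sin.comp continuous_fst).mul hg).mul
        ((continuous_radPart l m.natAbs).comp continuous_fst))).mul hE).const_mul _
    rw [integral_sphere_of_coord hmeas (G := fun θ φ =>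
      ((harmNorm l m / (4 * Real.pi) : ℝ) : ℂ) *
        (((Real.sin θ * g θ φ * radPart l m.natAbs θ : ℝ) : ℂ) *
          Complex.exp (Complex.I * m * φ))) hc]
    · simp_rw [intervalIntegral.integral_const_mul]
    · intro p hp
      rw [sphHarmonic_eq, sectorial_sphPoint _ _ hp, hfg p hp, Complex.real_smul, radPart]
      push_cast
      ring
  rw [key (continuous_polarLap hψ) (fun p hp => ?_) m1,
    key (f := fun x => ψ (x : S2)) (continuous_polarF hψ) (fun p hp => ?_) m2,
    integral_polar_laplacian hψ]
  · ring
  · rw [polarF, sphPoint_val]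
  · have h1 := colatitude_sphPoint (Set.Ioo_subset_Icc_self hp.1) p.2
    rw [classicalLaplacian_eq hψ (by rw [h1]; exact hp.1), h1, longitude_sphPoint hp.1 hp.2]

theorem integral_classicalLaplacian_mul_conj (l : ℕ) (m : ℤ) :
    ∫ x, (classicalLaplacian (fun y : S2 => ψ y) x : ℂ) *
        (starRingEnd ℂ) (sphHarmonic l m x) ∂sphereMeasure =
      -(eigval l : ℂ) *
        ∫ x, (ψ (x : S2) : ℂ) * (starRingEnd ℂ) (sphHarmonic l m x) ∂sphereMeasure := by
  have h := congrArg (starRingEnd ℂ) (integral_classicalLaplacian_mul_sphHarmonic hψ l m)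
  rw [map_mul, ← integral_conj, ← integral_conj] at h
  simpa only [map_mul, Complex.conj_ofReal, map_neg] using h

end GreenFormula

/-! ### The weak Laplacian in terms of Fourier coefficients -/

theorem integral_mul_eq_inner {f g : S2 → ℝ} (hf : MemLp f 2 sphereMeasure)
    (hg : MemLp g 2 sphereMeasure) :
    ((∫ x, f x * g x ∂sphereMeasure : ℝ) : ℂ) =
      inner ℂ (hf.ofReal (K := ℂ)).toLp (hg.ofReal (K := ℂ)).toLp := by
  rw [L2.inner_def, ← integral_complex_ofReal]
  refine integral_congr_ae ?_
  filter_upwards [(hf.ofReal (K := ℂ)).coeFn_toLp, (hg.ofReal (K := ℂ)).coeFn_toLp] with x h1 h2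
  rw [h1, h2, RCLike.inner_apply]
  simp [mul_comm]

/-- By Parseval both pairings are sums over the harmonics. Green's formula puts the real factor
`-λ_l` on the coefficients of `ψ`, and `h` moves it to those of `f`. -/
theorem isLaplacianOf_of_coeff {f g : S2 → ℝ} (hf : MemLp f 2 sphereMeasure)
    (hg : MemLp g 2 sphereMeasure)
    (h : ∀ i : HarmIdx,
      ∫ x, (g x : ℂ) * (starRingEnd ℂ) (sphHarmonic i.1 i.2 x) ∂sphereMeasure =
        -(eigval i.1 : ℂ) *
          ∫ x, (f x : ℂ) * (starRingEnd ℂ) (sphHarmonic i.1 i.2 x) ∂sphereMeasure) :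
    IsLaplacianOf g f := by
  refine ⟨hf, hg, fun ψ hψ => ?_⟩
  have hL := memLp_classicalLaplacian hψ
  have hψ' : MemLp (fun x : S2 => ψ x) 2 sphereMeasure := by
    have hc : Continuous fun x : S2 => ψ x := hψ.continuous.comp continuous_subtype_val
    obtain ⟨C, hC⟩ := isCompact_univ.exists_bound_of_continuousOn hc.continuousOn
    exact MemLp.of_bound hc.aestronglyMeasurable C (ae_of_all _ fun x => hC x trivial)
  have key : ∀ i : HarmIdx,
      inner ℂ (hf.ofReal (K := ℂ)).toLp (harmBasis i) *
        inner ℂ (harmBasis i) (hL.ofReal (K := ℂ)).toLp =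
      inner ℂ (hg.ofReal (K := ℂ)).toLp (harmBasis i) *
        inner ℂ (harmBasis i) (hψ'.ofReal (K := ℂ)).toLp := by
    intro i
    rw [← inner_conj_symm, ← inner_conj_symm (hg.ofReal (K := ℂ)).toLp, harmBasis_apply,
      inner_harmLp_left, inner_harmLp_left, inner_harmLp_left, inner_harmLp_left]
    have h1 := integral_classicalLaplacian_mul_conj hψ i.1 i.2
    have h2 := h i
    simp only [Complex.coe_algebraMap] at h1 h2 ⊢
    rw [h1, h2]
    simp only [map_mul, map_neg, Complex.conj_ofReal]
    ring
  have h1 := integral_mul_eq_inner hf hL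
  have h2 := integral_mul_eq_inner hg hψ'
  rw [← harmBasis.tsum_inner_mul_inner, tsum_congr key, harmBasis.tsum_inner_mul_inner, ← h2] at h1
  exact_mod_cast h1

/-! ### Square integrable fields and their Fourier coefficients -/

theorem eLpNorm_two_sq {X E : Type*} [MeasurableSpace X] [NormedAddCommGroup E] (f : X → E)
    (μ : Measure X) : eLpNorm f 2 μ ^ 2 = ∫⁻ x, ‖f x‖ₑ ^ 2 ∂μ := by
  have h := eLpNorm_nnreal_pow_eq_lintegral (f := f) (μ := μ) (p := 2) two_ne_zero
  simpa using h

section Slices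

variable {Ω : Type*} [MeasurableSpace Ω] {P : Measure Ω}

theorem lintegral_eLpNorm_slice {E : Type*} [NormedAddCommGroup E] {f : Ω × S2 → E}
    (hf : AEStronglyMeasurable f (P.prod sphereMeasure)) :
    ∫⁻ ω, eLpNorm (fun x => f (ω, x)) 2 sphereMeasure ^ 2 ∂P =
      eLpNorm f 2 (P.prod sphereMeasure) ^ 2 := by
  rw [eLpNorm_two_sq, lintegral_prod _ (hf.enorm.pow_const 2)]
  simp_rw [eLpNorm_two_sq]

theorem ae_memLp_slice {E : Type*} [NormedAddCommGroup E] {f : Ω × S2 → E} [SFinite P]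
    (hf : MemLp f 2 (P.prod sphereMeasure)) :
    ∀ᵐ ω ∂P, MemLp (fun x => f (ω, x)) 2 sphereMeasure := by
  have h1 := lintegral_eLpNorm_slice hf.1
  have h2 : ∫⁻ ω, eLpNorm (fun x => f (ω, x)) 2 sphereMeasure ^ 2 ∂P ≠ ∞ := by
    rw [h1]
    exact ENNReal.pow_ne_top hf.2.ne
  have hm : AEMeasurable (fun ω => eLpNorm (fun x => f (ω, x)) 2 sphereMeasure ^ 2) P := by
    simp_rw [eLpNorm_two_sq]
    exact (hf.1.enorm.pow_const 2).lintegral_prod_right'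
  filter_upwards [ae_lt_top' hm h2, hf.1.prodMk_left] with ω h3 h4
  exact ⟨h4, by simpa using h3⟩

theorem enorm_coeff_le {f : S2 → ℝ} (hf : AEStronglyMeasurable f sphereMeasure) (i : HarmIdx) :
    ‖∫ x, (f x : ℂ) * (starRingEnd ℂ) (sphHarmonic i.1 i.2 x) ∂sphereMeasure‖ₑ ^ 2 ≤
      eLpNorm f 2 sphereMeasure ^ 2 := by
  by_cases h : eLpNorm f 2 sphereMeasure = ∞
  · simp [h]
  have hf2 : MemLp f 2 sphereMeasure := ⟨hf, lt_top_iff_ne_top.2 h⟩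
  have hf3 := hf2.ofReal (K := ℂ)
  have h1 := inner_harmLp_left i hf3
  simp only [Complex.coe_algebraMap] at h1
  rw [← h1]
  have h2 := norm_inner_le_norm (𝕜 := ℂ) (harmLp i) hf3.toLp
  rw [orthonormal_harmLp.1 i, one_mul] at h2
  have h3 : ‖inner ℂ (harmLp i) hf3.toLp‖ₑ ≤ ‖hf3.toLp‖ₑ := enorm_le_iff_norm_le.2 h2
  rw [Lp.enorm_toLp] at h3
  have h4 : eLpNorm (fun x => ((f x : ℝ) : ℂ)) 2 sphereMeasure = eLpNorm f 2 sphereMeasure :=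
    eLpNorm_congr_norm_ae (ae_of_all _ fun x => Complex.norm_real _)
  exact pow_le_pow_left' (h3.trans_eq h4) 2

/-- Bessel's inequality on each realization. It makes the Fourier coefficient a contraction into
`L²(Ω)`, so coefficients pass to `L²` limits of fields. -/
theorem lintegral_fieldCoeff_le {f : Ω × S2 → ℝ}
    (hf : AEStronglyMeasurable f (P.prod sphereMeasure)) (i : HarmIdx) :
    ∫⁻ ω, ‖fieldCoeff f i.1 i.2 ω‖ₑ ^ 2 ∂P ≤ eLpNorm f 2 (P.prod sphereMeasure) ^ 2 := by
  rw [← lintegral_eLpNorm_slice hf]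
  refine lintegral_mono_ae ?_
  filter_upwards [hf.prodMk_left] with ω hω
  exact enorm_coeff_le hω i

theorem fieldCoeff_congr {f g : Ω × S2 → ℝ} (h : f =ᵐ[P.prod sphereMeasure] g) (l : ℕ) (m : ℤ) :
    ∀ᵐ ω ∂P, fieldCoeff f l m ω = fieldCoeff g l m ω := by
  filter_upwards [Measure.ae_ae_of_ae_prod h] with ω hω
  refine integral_congr_ae ?_
  filter_upwards [hω] with x hx
  rw [hx]

theorem integrable_mul_conj_sphHarmonic {f : S2 → ℝ} (hf : MemLp f 2 sphereMeasure) (l : ℕ)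
    (m : ℤ) :
    Integrable (fun x => (f x : ℂ) * (starRingEnd ℂ) (sphHarmonic l m x)) sphereMeasure :=
  (hf.ofReal (K := ℂ)).integrable_mul (memLp_sphHarmonic l m).star

variable [SFinite P]

theorem fieldCoeff_sub {f g : Ω × S2 → ℝ} (hf : MemLp f 2 (P.prod sphereMeasure))
    (hg : MemLp g 2 (P.prod sphereMeasure)) (l : ℕ) (m : ℤ) :
    ∀ᵐ ω ∂P, fieldCoeff (f - g) l m ω = fieldCoeff f l m ω - fieldCoeff g l m ω := by
  filter_upwards [ae_memLp_slice hf, ae_memLp_slice hg] with ω h1 h2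
  rw [fieldCoeff, fieldCoeff, fieldCoeff, ← integral_sub (integrable_mul_conj_sphHarmonic h1 l m)
    (integrable_mul_conj_sphHarmonic h2 l m)]
  refine integral_congr_ae (ae_of_all _ fun x => ?_)
  simp only [Pi.sub_apply]
  push_cast
  ring

omit [SFinite P] in
theorem measurable_fieldCoeff {f : Ω × S2 → ℝ} (hf : Measurable f) (l : ℕ) (m : ℤ) :
    Measurable (fieldCoeff f l m) := by
  have h : Measurable fun p : Ω × S2 => (f p : ℂ) * (starRingEnd ℂ) (sphHarmonic l m p.2) :=
    (Complex.measurable_ofReal.comp hf).mul (Complex.continuous_conj.measurable.comp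
      ((measurable_sphHarmonic l m).comp measurable_snd))
  exact (h.stronglyMeasurable.integral_prod_right' (ν := sphereMeasure)).measurable

end Slices

/-! ### The homogeneous components of a field -/

section Components

variable {Ω : Type*} [MeasurableSpace Ω]

/-- The component of degree `l` of a field. -/
noncomputable def degreePartC (ξ : Ω × S2 → ℝ) (l : ℕ) (p : Ω × S2) : ℂ :=
  ∑ m ∈ Finset.Icc (-(l : ℤ)) l, fieldCoeff ξ l m p.1 * sphHarmonic l m p.2

/-- The component of degree `l` of a field as a real field. -/
noncomputable def degreePart (ξ : Ω × S2 → ℝ) (l : ℕ) (p : Ω × S2) : ℝ := (degreePartC ξ l p).re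

omit [MeasurableSpace Ω] in
theorem fieldCoeff_neg (ξ : Ω × S2 → ℝ) (l : ℕ) (m : ℤ) (ω : Ω) :
    fieldCoeff ξ l (-m) ω = (-1) ^ m.natAbs * (starRingEnd ℂ) (fieldCoeff ξ l m ω) := by
  rw [fieldCoeff, fieldCoeff, ← integral_conj, ← integral_const_mul]
  refine integral_congr_ae (ae_of_all _ fun x => ?_)
  simp only [sphHarmonic_neg, map_mul, Complex.conj_conj, Complex.conj_ofReal, map_pow, map_neg,
    map_one]
  ring

omit [MeasurableSpace Ω] in
-- The exchange `m ↔ -m` conjugates each summand: the sign `(-1)^m` occurs once in the coefficient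
-- and once in the harmonic.
theorem ofReal_degreePart (ξ : Ω × S2 → ℝ) (l : ℕ) (p : Ω × S2) :
    (degreePart ξ l p : ℂ) = degreePartC ξ l p := by
  refine Complex.conj_eq_iff_re.1 ?_
  rw [degreePartC, map_sum]
  refine Finset.sum_equiv (Equiv.neg ℤ) (fun m => ?_) fun m _ => ?_
  · simp only [Finset.mem_Icc, Equiv.neg_apply]; omega
  · rw [Equiv.neg_apply, fieldCoeff_neg, sphHarmonic_neg, map_mul]
    have h1 : ((-1 : ℂ) ^ m.natAbs) * (-1) ^ m.natAbs = 1 := by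
      rw [← mul_pow]; simp
    linear_combination (-(starRingEnd ℂ) (fieldCoeff ξ l m p.1) *
      (starRingEnd ℂ) (sphHarmonic l m p.2)) * h1

variable {P : Measure Ω} {ξ : Ω × S2 → ℝ}

theorem memLp_fieldCoeff (hm : Measurable ξ) (hξ : MemLp ξ 2 (P.prod sphereMeasure))
    (i : HarmIdx) : MemLp (fieldCoeff ξ i.1 i.2) 2 P := by
  refine ⟨(measurable_fieldCoeff hm _ _).aestronglyMeasurable, ?_⟩
  have h := lintegral_fieldCoeff_le hξ.1 i
  rw [← eLpNorm_two_sq] at h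
  have h2 := h.trans_lt (ENNReal.pow_lt_top hξ.2)
  simpa using h2

theorem memLp_degreePartC (hm : Measurable ξ) (hξ : MemLp ξ 2 (P.prod sphereMeasure)) (l : ℕ) :
    MemLp (degreePartC ξ l) 2 (P.prod sphereMeasure) := by
  refine memLp_finsetSum _ fun m hml => ?_
  obtain ⟨C, hC⟩ := exists_norm_sphHarmonic_le l m
  refine ((memLp_fieldCoeff hm hξ ⟨l, m, hml⟩).comp_fst sphereMeasure).of_le_mul (c := C)
    (((measurable_fieldCoeff hm l m).comp measurable_fst).mul
      ((measurable_sphHarmonic l m).comp measurable_snd)).aestronglyMeasurable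
    (ae_of_all _ fun p => ?_)
  rw [norm_mul, mul_comm]
  exact mul_le_mul_of_nonneg_right (hC _) (norm_nonneg _)

theorem memLp_degreePart (hm : Measurable ξ) (hξ : MemLp ξ 2 (P.prod sphereMeasure)) (l : ℕ) :
    MemLp (degreePart ξ l) 2 (P.prod sphereMeasure) := (memLp_degreePartC hm hξ l).re

omit [MeasurableSpace Ω] in
theorem memLp_degreePart_slice (ξ : Ω × S2 → ℝ) (l : ℕ) (ω : Ω) :
    MemLp (fun x => degreePart ξ l (ω, x)) 2 sphereMeasure :=
  (memLp_finsetSum (Finset.Icc (-(l : ℤ)) l) fun m _ =>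
    (memLp_sphHarmonic l m).const_mul (fieldCoeff ξ l m ω)).re

omit [MeasurableSpace Ω] in
theorem fieldCoeff_degreePart (ξ : Ω × S2 → ℝ) (k : ℕ) (i : HarmIdx) (ω : Ω) :
    fieldCoeff (degreePart ξ k) i.1 i.2 ω = if k = i.1 then fieldCoeff ξ i.1 i.2 ω else 0 := by
  obtain ⟨l, m, hm⟩ := i
  have hint : ∀ m' : ℤ, Integrable (fun x => fieldCoeff ξ k m' ω *
      ((starRingEnd ℂ) (sphHarmonic l m x) * sphHarmonic k m' x)) sphereMeasure := fun m' =>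
    ((memLp_sphHarmonic l m).star.integrable_mul (memLp_sphHarmonic k m')).const_mul _
  have h1 : fieldCoeff (degreePart ξ k) l m ω = ∫ x, ∑ m' ∈ Finset.Icc (-(k : ℤ)) k,
      fieldCoeff ξ k m' ω * ((starRingEnd ℂ) (sphHarmonic l m x) * sphHarmonic k m' x)
        ∂sphereMeasure := by
    refine integral_congr_ae (ae_of_all _ fun x => ?_)
    simp only [ofReal_degreePart, degreePartC]
    rw [Finset.sum_mul]
    exact Finset.sum_congr rfl fun m' _ => by ring
  rw [h1, integral_finsetSum _ fun m' _ => hint m']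
  simp_rw [integral_const_mul, integral_conj_sphHarmonic_mul l k m _ (natAbs_le_of_mem hm)]
  split_ifs with hkl
  · subst hkl
    simp only [true_and, mul_ite, mul_one, mul_zero]
    rw [Finset.sum_ite_eq, if_pos hm]
  · simp [Ne.symm hkl]

omit [MeasurableSpace Ω] in
-- Orthogonality holds on every single realization; Fubini then gives it in `L²(Ω × S²)`.
theorem integral_degreePart_mul_slice (ξ : Ω × S2 → ℝ) {k l : ℕ} (hkl : k ≠ l) (ω : Ω) :
    ∫ x, degreePart ξ k (ω, x) * degreePart ξ l (ω, x) ∂sphereMeasure = 0 := by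
  have h1 : ((∫ x, degreePart ξ k (ω, x) * degreePart ξ l (ω, x) ∂sphereMeasure : ℝ) : ℂ) =
      ∑ m ∈ Finset.Icc (-(l : ℤ)) l, (starRingEnd ℂ) (fieldCoeff ξ l m ω) *
        fieldCoeff (degreePart ξ k) l m ω := by
    rw [← integral_complex_ofReal]
    simp_rw [fieldCoeff.eq_1 (degreePart ξ k), ← integral_const_mul]
    rw [← integral_finsetSum _ fun m _ => (integrable_mul_conj_sphHarmonic
      (memLp_degreePart_slice ξ k ω) l m).const_mul _]
    refine integral_congr_ae (ae_of_all _ fun x => ?_)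
    have h2 : (degreePart ξ l (ω, x) : ℂ) = (starRingEnd ℂ) (degreePartC ξ l (ω, x)) := by
      rw [← ofReal_degreePart, Complex.conj_ofReal]
    simp only [Complex.ofReal_mul, h2, degreePartC, map_sum, map_mul]
    rw [Finset.mul_sum]
    exact Finset.sum_congr rfl fun m _ => by ring
  rw [Finset.sum_eq_zero] at h1
  · exact_mod_cast h1
  · intro m hm
    rw [fieldCoeff_degreePart ξ k ⟨l, m, hm⟩ ω]
    simp [hkl]

/-- The component of degree `l` of a field as an element of `L²`. -/
noncomputable def degreeLp (hm : Measurable ξ) (hξ : MemLp ξ 2 (P.prod sphereMeasure)) (l : ℕ) :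
    L2Field P := (memLp_degreePart hm hξ l).toLp (degreePart ξ l)

variable [IsProbabilityMeasure P]

theorem inner_degreeLp (hm : Measurable ξ) (hξ : MemLp ξ 2 (P.prod sphereMeasure)) :
    Pairwise fun k l => inner ℝ (degreeLp hm hξ k) (degreeLp hm hξ l) = 0 := by
  intro k l hkl
  have h1 : inner ℝ (degreeLp hm hξ k) (degreeLp hm hξ l) =
      ∫ p, degreePart ξ k p * degreePart ξ l p ∂(P.prod sphereMeasure) := by
    rw [L2.inner_def]
    refine integral_congr_ae ?_
    filter_upwards [(memLp_degreePart hm hξ k).coeFn_toLp,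
      (memLp_degreePart hm hξ l).coeFn_toLp] with p h1 h2
    rw [degreeLp, degreeLp, h1, h2]
    simp [mul_comm]
  have h2 := integral_prod _
    ((memLp_degreePart hm hξ k).integrable_mul (memLp_degreePart hm hξ l))
  simp only [Pi.mul_apply] at h2
  rw [h1, h2]
  simp only [integral_degreePart_mul_slice ξ hkl, integral_zero]

end Components

/-! ### The expansion of a random field -/

section Expansion

variable {Ω : Type*} [MeasurableSpace Ω] {P : Measure Ω} {ξ : Ω × S2 → ℝ}

theorem tendsto_zero_of_sq {f : ℕ → ℝ≥0∞} (h : Tendsto (fun n => f n ^ 2) atTop (𝓝 0)) :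
    Tendsto f atTop (𝓝 0) := by
  have h2 := h.ennrpow_const (1 / 2)
  rw [ENNReal.zero_rpow_of_pos (by norm_num)] at h2
  refine h2.congr fun n => ?_
  rw [← ENNReal.rpow_natCast, ← ENNReal.rpow_mul]
  norm_num

/-- The truncations by degree are increasing and exhaust all indices, so they are cofinal among the
finite sets of the unconditional sum. -/
theorem tendsto_harm_partialSum (g : Lp ℂ 2 sphereMeasure) :
    Tendsto (fun n => ∑ i ∈ (Finset.range n).sigma fun l =>
      (Finset.univ : Finset (Finset.Icc (-(l : ℤ)) l)), inner ℂ (harmLp i) g • harmLp i)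
      atTop (𝓝 g) := by
  have h := harmBasis.hasSum_repr g
  simp only [HilbertBasis.repr_apply_apply, harmBasis_apply] at h
  refine Tendsto.comp (g := fun s : Finset HarmIdx => ∑ i ∈ s, inner ℂ (harmLp i) g • harmLp i)
    h (tendsto_atTop_finset_of_monotone (fun m n hmn => ?_) fun i => ⟨i.1 + 1, ?_⟩)
  · exact Finset.sigma_mono (Finset.range_mono hmn) fun _ => le_rfl
  · simp

theorem norm_harm_partialSum_le (g : Lp ℂ 2 sphereMeasure) (s : Finset HarmIdx) :
    ‖∑ i ∈ s, inner ℂ (harmLp i) g • harmLp i‖ ≤ ‖g‖ := by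
  refine (sq_le_sq₀ (norm_nonneg _) (norm_nonneg _)).1 ?_
  have h := orthonormal_harmLp.inner_sum (fun i => inner ℂ (harmLp i) g)
    (fun i => inner ℂ (harmLp i) g) s
  rw [inner_self_eq_norm_sq_to_K] at h
  simp_rw [RCLike.conj_mul] at h
  have h2 : ‖∑ i ∈ s, inner ℂ (harmLp i) g • harmLp i‖ ^ 2 =
      ∑ i ∈ s, ‖inner ℂ (harmLp i) g‖ ^ 2 := by exact_mod_cast h
  rw [h2]
  exact orthonormal_harmLp.sum_inner_products_le g

omit [MeasurableSpace Ω] in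
theorem eLpNorm_slice_partialSum {ω : Ω} (hω : MemLp (fun x => ξ (ω, x)) 2 sphereMeasure)
    (n : ℕ) :
    eLpNorm (fun x => ∑ l ∈ Finset.range n, degreePart ξ l (ω, x) - ξ (ω, x)) 2 sphereMeasure =
      ‖(∑ i ∈ (Finset.range n).sigma fun l => (Finset.univ : Finset (Finset.Icc (-(l : ℤ)) l)),
        inner ℂ (harmLp i) (hω.ofReal (K := ℂ)).toLp • harmLp i) -
          (hω.ofReal (K := ℂ)).toLp‖ₑ := by
  rw [Lp.enorm_def]
  refine eLpNorm_congr_norm_ae ?_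
  set g := (hω.ofReal (K := ℂ)).toLp with hg
  set s : Finset HarmIdx :=
    (Finset.range n).sigma fun l => (Finset.univ : Finset (Finset.Icc (-(l : ℤ)) l))
  have h3 : ∀ i : HarmIdx, ∀ᵐ x ∂sphereMeasure,
      (inner ℂ (harmLp i) g • harmLp i : Lp ℂ 2 sphereMeasure) x =
        fieldCoeff ξ i.1 i.2 ω * sphHarmonic i.1 i.2 x := by
    intro i
    filter_upwards [Lp.coeFn_smul (inner ℂ (harmLp i) g) (harmLp i),
      (memLp_sphHarmonic i.1 i.2).coeFn_toLp] with x h1 h2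
    rw [h1, Pi.smul_apply, harmLp, h2, smul_eq_mul, hg, ← harmLp, inner_harmLp_left]
    rfl
  filter_upwards [Lp.coeFn_sub (∑ i ∈ s, inner ℂ (harmLp i) g • harmLp i) g,
    Lp.coeFn_finsetSum s fun i => inner ℂ (harmLp i) g • harmLp i,
    (hω.ofReal (K := ℂ)).coeFn_toLp, ae_all_iff.2 h3] with x h4 h5 h6 h7
  rw [← hg] at h6
  rw [h4, Pi.sub_apply, h5, h6, ← Complex.norm_real]
  rw [Finset.sum_apply, Finset.sum_congr rfl fun i _ => h7 i]
  rw [Finset.sum_sigma]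
  push_cast
  simp only [ofReal_degreePart, degreePartC]
  congr 2
  refine Finset.sum_congr rfl fun l _ => ?_
  exact (Finset.sum_coe_sort (Finset.Icc (-(l : ℤ)) l)
    fun m => fieldCoeff ξ l m ω * sphHarmonic l m x).symm

variable [IsProbabilityMeasure P]

/-- Each realization converges in `L²(S²)` by completeness. Bessel's inequality supplies the
dominating function `(2 ‖ξ(ω, ·)‖)²` for the integral over `ω`. -/
theorem tendsto_eLpNorm_partialSum (hm : Measurable ξ) (hξ : MemLp ξ 2 (P.prod sphereMeasure)) :
    Tendsto (fun n => eLpNorm (fun p => ∑ l ∈ Finset.range n, degreePart ξ l p - ξ p) 2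
      (P.prod sphereMeasure)) atTop (𝓝 0) := by
  have hmeas : ∀ n, AEStronglyMeasurable
      (fun p => ∑ l ∈ Finset.range n, degreePart ξ l p - ξ p) (P.prod sphereMeasure) := fun n =>
    ((memLp_finsetSum _ fun l _ => memLp_degreePart hm hξ l).sub hξ).1
  have key : Tendsto (fun n => ∫⁻ ω, eLpNorm
      (fun x => ∑ l ∈ Finset.range n, degreePart ξ l (ω, x) - ξ (ω, x)) 2 sphereMeasure ^ 2 ∂P)
      atTop (𝓝 (∫⁻ _, 0 ∂P)) := by
    refine tendsto_lintegral_of_dominated_convergence'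
      (fun ω => (2 * eLpNorm (fun x => ξ (ω, x)) 2 sphereMeasure) ^ 2) (fun n => ?_)
      (fun n => ?_) ?_ ?_
    · simp_rw [eLpNorm_two_sq]
      exact ((hmeas n).enorm.pow_const 2).lintegral_prod_right'
    · filter_upwards [ae_memLp_slice hξ] with ω hω
      rw [eLpNorm_slice_partialSum hω]
      refine pow_le_pow_left' ?_ 2
      have h1 : eLpNorm (fun x => ξ (ω, x)) 2 sphereMeasure = ‖(hω.ofReal (K := ℂ)).toLp‖ₑ := by
        rw [Lp.enorm_toLp]
        exact eLpNorm_congr_norm_ae (ae_of_all _ fun x => (Complex.norm_real _).symm)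
      rw [h1, two_mul]
      refine (enorm_sub_le).trans (add_le_add ?_ le_rfl)
      exact enorm_le_iff_norm_le.2 (norm_harm_partialSum_le _ _)
    · simp_rw [mul_pow]
      rw [lintegral_const_mul' _ _ (by simp), lintegral_eLpNorm_slice hξ.1]
      exact ENNReal.mul_ne_top (by simp) (ENNReal.pow_ne_top hξ.2.ne)
    · filter_upwards [ae_memLp_slice hξ] with ω hω
      simp_rw [eLpNorm_slice_partialSum hω]
      have h := tendsto_harm_partialSum (hω.ofReal (K := ℂ)).toLp
      have h2 := (h.sub_const (hω.ofReal (K := ℂ)).toLp).enorm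
      rw [sub_self, enorm_zero] at h2
      simpa using ENNReal.Tendsto.pow (n := 2) h2
  simp_rw [lintegral_zero] at key
  exact tendsto_zero_of_sq (key.congr fun n => lintegral_eLpNorm_slice
    (f := fun p => ∑ l ∈ Finset.range n, degreePart ξ l p - ξ p) (hmeas n))

omit [IsProbabilityMeasure P] in
theorem coeFn_sum_smul_degreeLp (hm : Measurable ξ) (hξ : MemLp ξ 2 (P.prod sphereMeasure))
    (a : ℕ → ℝ) (s : Finset ℕ) :
    (∑ l ∈ s, a l • degreeLp hm hξ l : L2Field P) =ᵐ[P.prod sphereMeasure]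
      fun p => ∑ l ∈ s, a l * degreePart ξ l p := by
  have h : ∀ l, ∀ᵐ p ∂P.prod sphereMeasure,
      (a l • degreeLp hm hξ l : L2Field P) p = a l * degreePart ξ l p := fun l => by
    filter_upwards [Lp.coeFn_smul (a l) (degreeLp hm hξ l),
      (memLp_degreePart hm hξ l).coeFn_toLp] with p h1 h2
    rw [h1, Pi.smul_apply, degreeLp, h2, smul_eq_mul]
  filter_upwards [Lp.coeFn_finsetSum s fun l => a l • degreeLp hm hξ l, ae_all_iff.2 h]
    with p h1 h2
  rw [h1]
  simp only [Finset.sum_apply, h2]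

omit [IsProbabilityMeasure P] in
theorem enorm_sum_smul_degreeLp_sub (hm : Measurable ξ)
    (hξ : MemLp ξ 2 (P.prod sphereMeasure)) (a : ℕ → ℝ) (s : Finset ℕ) (V : L2Field P) :
    ‖∑ l ∈ s, a l • degreeLp hm hξ l - V‖ₑ =
      eLpNorm (fun p => ∑ l ∈ s, a l * degreePart ξ l p - V p) 2 (P.prod sphereMeasure) := by
  rw [Lp.enorm_def]
  refine eLpNorm_congr_ae ?_
  filter_upwards [Lp.coeFn_sub (∑ l ∈ s, a l • degreeLp hm hξ l) V,
    coeFn_sum_smul_degreeLp hm hξ a s] with p h1 h2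
  rw [h1, Pi.sub_apply, h2]

theorem tendsto_sum_degreeLp (hm : Measurable ξ) (hξ : MemLp ξ 2 (P.prod sphereMeasure)) :
    Tendsto (fun n => ∑ l ∈ Finset.range n, degreeLp hm hξ l) atTop (𝓝 (hξ.toLp ξ)) := by
  rw [tendsto_iff_edist_tendsto_0]
  refine (tendsto_eLpNorm_partialSum hm hξ).congr fun n => ?_
  have h := enorm_sum_smul_degreeLp_sub hm hξ (fun _ => 1) (Finset.range n) (hξ.toLp ξ)
  simp only [one_smul, one_mul] at h
  rw [edist_eq_enorm_sub, h]
  refine eLpNorm_congr_ae ?_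
  filter_upwards [hξ.coeFn_toLp] with p hp
  rw [hp]

/-- By orthogonality the partial sums are the squared norms of the truncations of `ξ`, which
converge to `‖ξ‖²`. -/
theorem summable_norm_sq_degreeLp (hm : Measurable ξ) (hξ : MemLp ξ 2 (P.prod sphereMeasure)) :
    Summable fun l => ‖degreeLp hm hξ l‖ ^ 2 := by
  have h := (tendsto_sum_degreeLp hm hξ).norm.pow 2
  refine HasSum.summable (a := ‖hξ.toLp ξ‖ ^ 2)
    ((hasSum_iff_tendsto_nat_of_nonneg (fun l => by positivity) _).2 (h.congr fun n => ?_))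
  have h2 := norm_sq_sum_smul_of_orthogonal (inner_degreeLp hm hξ) (fun _ => 1) (Finset.range n)
  simpa using h2

omit [MeasurableSpace Ω] in
theorem fieldCoeff_sum_degreePart (ξ : Ω × S2 → ℝ) (a : ℕ → ℝ) {n : ℕ} (i : HarmIdx)
    (hi : i.1 < n) (ω : Ω) :
    fieldCoeff (fun p => ∑ l ∈ Finset.range n, a l * degreePart ξ l p) i.1 i.2 ω =
      a i.1 * fieldCoeff ξ i.1 i.2 ω := by
  have h1 : fieldCoeff (fun p => ∑ l ∈ Finset.range n, a l * degreePart ξ l p) i.1 i.2 ω =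
      ∑ l ∈ Finset.range n, (a l : ℂ) * fieldCoeff (degreePart ξ l) i.1 i.2 ω := by
    simp_rw [fieldCoeff.eq_1 (degreePart ξ _), ← integral_const_mul]
    rw [← integral_finsetSum _ fun l _ => (integrable_mul_conj_sphHarmonic
      (memLp_degreePart_slice ξ l ω) i.1 i.2).const_mul _]
    refine integral_congr_ae (ae_of_all _ fun x => ?_)
    simp only
    push_cast
    rw [Finset.sum_mul]
    exact Finset.sum_congr rfl fun l _ => by ring
  rw [h1]
  simp_rw [fieldCoeff_degreePart, mul_ite, mul_zero]
  rw [Finset.sum_ite_eq', if_pos (Finset.mem_range.2 hi)]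

/-- Partial sums of more than `i.1` terms have exactly this coefficient, and
`lintegral_fieldCoeff_le` bounds the error by their distance to the limit. -/
theorem fieldCoeff_diagSum (hm : Measurable ξ) (hξ : MemLp ξ 2 (P.prod sphereMeasure))
    {a : ℕ → ℝ} {C : ℝ} (ha : ∀ l, |a l| ≤ C) (i : HarmIdx) :
    ∀ᵐ ω ∂P, fieldCoeff (diagSum (degreeLp hm hξ) a : L2Field P) i.1 i.2 ω =
      a i.1 * fieldCoeff ξ i.1 i.2 ω := by
  set V : L2Field P := diagSum (degreeLp hm hξ) a
  have hV : MemLp V 2 (P.prod sphereMeasure) := Lp.memLp V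
  have hlim : Tendsto (fun n => ‖∑ l ∈ Finset.range n, a l • degreeLp hm hξ l - V‖ₑ ^ 2) atTop
      (𝓝 0) := by
    have h := (hasSum_diagSum (inner_degreeLp hm hξ) (summable_norm_sq_degreeLp hm hξ)
      ha).tendsto_sum_nat
    have h2 := (h.sub_const V).enorm
    rw [sub_self, enorm_zero] at h2
    simpa using ENNReal.Tendsto.pow (n := 2) h2
  have hle : ∀ᶠ n in atTop, ∫⁻ ω, ‖a i.1 * fieldCoeff ξ i.1 i.2 ω -
      fieldCoeff V i.1 i.2 ω‖ₑ ^ 2 ∂P ≤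
        ‖∑ l ∈ Finset.range n, a l • degreeLp hm hξ l - V‖ₑ ^ 2 := by
    filter_upwards [eventually_gt_atTop i.1] with n hn
    have hS : MemLp (fun p => ∑ l ∈ Finset.range n, a l * degreePart ξ l p) 2
        (P.prod sphereMeasure) :=
      memLp_finsetSum _ fun l _ => (memLp_degreePart hm hξ l).const_mul _
    rw [enorm_sum_smul_degreeLp_sub]
    refine le_trans (le_of_eq (lintegral_congr_ae ?_)) (lintegral_fieldCoeff_le (hS.sub hV).1 i)
    filter_upwards [fieldCoeff_sub hS hV i.1 i.2] with ω hω
    rw [hω, fieldCoeff_sum_degreePart ξ a i hn]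
  have h0 : ∫⁻ ω, ‖a i.1 * fieldCoeff ξ i.1 i.2 ω - fieldCoeff V i.1 i.2 ω‖ₑ ^ 2 ∂P = 0 :=
    le_antisymm (ge_of_tendsto hlim hle) zero_le
  have hVm : AEMeasurable (fun ω => fieldCoeff V i.1 i.2 ω) P := by
    have h := measurable_fieldCoeff hV.1.measurable_mk i.1 i.2
    exact ⟨_, h, fieldCoeff_congr hV.1.ae_eq_mk i.1 i.2⟩
  have hmeas : AEMeasurable (fun ω => ‖a i.1 * fieldCoeff ξ i.1 i.2 ω -
      fieldCoeff V i.1 i.2 ω‖ₑ ^ 2) P :=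
    ((((measurable_fieldCoeff hm i.1 i.2).const_mul _).aemeasurable.sub hVm).enorm).pow_const 2
  filter_upwards [(lintegral_eq_zero_iff' hmeas).1 h0] with ω hω
  have h1 : a i.1 * fieldCoeff ξ i.1 i.2 ω - fieldCoeff V i.1 i.2 ω = 0 := by simpa using hω
  exact (sub_eq_zero.1 h1).symm

/-- The indices are countable, so a single null set serves all coefficients and
`isLaplacianOf_of_coeff` applies to each remaining realization. -/
theorem isFieldLaplacianOf_diagSum (hm : Measurable ξ) (hξ : MemLp ξ 2 (P.prod sphereMeasure))
    {a b : ℕ → ℝ} {C D : ℝ} (ha : ∀ l, |a l| ≤ C) (hb : ∀ l, |b l| ≤ D)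
    (hab : ∀ l, b l = -eigval l * a l) :
    IsFieldLaplacianOf P (diagSum (degreeLp hm hξ) b) (diagSum (degreeLp hm hξ) a) := by
  filter_upwards [ae_memLp_slice (Lp.memLp (diagSum (degreeLp hm hξ) a)),
    ae_memLp_slice (Lp.memLp (diagSum (degreeLp hm hξ) b)),
    ae_all_iff.2 (fieldCoeff_diagSum hm hξ ha), ae_all_iff.2 (fieldCoeff_diagSum hm hξ hb)]
    with ω h1 h2 h3 h4
  refine isLaplacianOf_of_coeff h1 h2 fun i => ?_
  have h5 := h3 i
  have h6 := h4 i
  rw [fieldCoeff] at h5 h6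
  rw [h5, h6, hab]
  push_cast
  ring

omit [MeasurableSpace Ω] in
theorem truncatedField_eq (ξ : Ω × S2 → ℝ) (α : ℝ) (L : ℕ) (t : ℝ) (p : Ω × S2) :
    truncatedField ξ α L t p = ((∑ l ∈ Finset.range (L + 1),
      mittagLeffler α 1 (-eigval l * t ^ α) * degreePart ξ l p : ℝ) : ℂ) := by
  rw [truncatedField]
  push_cast
  refine Finset.sum_congr rfl fun l _ => ?_
  rw [ofReal_degreePart, degreePartC, Finset.mul_sum]
  exact Finset.sum_congr rfl fun m _ => by ring

theorem eigval_nonneg (l : ℕ) : 0 ≤ eigval l := by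
  rw [eigval]; positivity

theorem tendsto_truncatedField (hm : Measurable ξ) (hξ : MemLp ξ 2 (P.prod sphereMeasure))
    {α t : ℝ} (hα : 0 < α) (hα₁ : α ≤ 1) (ht : 0 ≤ t) :
    Tendsto (fun L : ℕ => eLpNorm (fun p : Ω × S2 => truncatedField ξ α L t p -
      ((evol (degreeLp hm hξ) eigval α t p : ℝ) : ℂ)) 2 (P.prod sphereMeasure)) atTop (𝓝 0) := by
  -- Truncation at degree `L` has `L + 1` degrees, whence the shift of the sequence of partial sums
  -- by one.
  have h := ((hasSum_diagSum (inner_degreeLp hm hξ) (summable_norm_sq_degreeLp hm hξ)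
    (a := fun l => mittagLeffler α 1 (-eigval l * t ^ α)) (C := 1)
    fun l => abs_relaxation_le hα hα₁ (eigval_nonneg l) ht).tendsto_sum_nat).comp
      (tendsto_add_atTop_nat 1)
  have h2 := (h.sub_const (evol (degreeLp hm hξ) eigval α t)).enorm
  rw [← evol, sub_self, enorm_zero] at h2
  refine h2.congr fun L => ?_
  rw [Function.comp_apply, enorm_sum_smul_degreeLp_sub]
  refine eLpNorm_congr_norm_ae (ae_of_all _ fun p => ?_)
  rw [truncatedField_eq, ← Complex.ofReal_sub, Complex.norm_real]

theorem evol_degreeLp_zero (hm : Measurable ξ) (hξ : MemLp ξ 2 (P.prod sphereMeasure)) {α : ℝ}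
    (hα : 0 < α) : evol (degreeLp hm hξ) eigval α 0 = hξ.toLp ξ := by
  have h := (hasSum_diagSum (inner_degreeLp hm hξ) (summable_norm_sq_degreeLp hm hξ)
    (a := fun _ => 1) (C := 1) fun l => by simp).tendsto_sum_nat
  simp only [one_smul] at h
  rw [← tendsto_nhds_unique h (tendsto_sum_degreeLp hm hξ), evol]
  simp only [Real.zero_rpow hα.ne', mul_zero, mittagLeffler_zero]

end Expansion

end SphereField

/-! ### Assembly of the solution. -/

theorem proposition3p5 {Ω : Type*} [MeasurableSpace Ω] (P : Measure Ω) [IsProbabilityMeasure P]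
    (α : ℝ) (hα₀ : 0 < α) (hα₁ : α ≤ 1)
    (ξ : Ω × S2 → ℝ) (hξ : IsIsotropicGaussianField P ξ)
    (hC : Summable fun l : ℕ => (2 * (l : ℝ) + 1) * angularPowerSpectrum P ξ l) :
    ∃ U ΔU dU DΔU : ℝ → L2Field P,
      -- `U t` is the sum in `L²(Ω × S²)` of the series, for all `t ≥ 0`
      (∀ t, 0 ≤ t → Tendsto
        (fun L : ℕ => eLpNorm (fun p : Ω × S2 => truncatedField ξ α L t p - ((U t p : ℝ) : ℂ)) 2
          (P.prod sphereMeasure)) atTop (𝓝 0)) ∧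
      -- initial condition, also in the sense of a limit
      (U 0 : Ω × S2 → ℝ) =ᵐ[P.prod sphereMeasure] ξ ∧
      Tendsto U (𝓝[>] 0) (𝓝 (U 0)) ∧
      -- the terms of the equation exist in `L²(Ω × S²)` for all `t > 0`
      (∀ t, 0 < t → HasDerivAt U (dU t) t) ∧
      (∀ t, 0 < t → IsFieldLaplacianOf P (ΔU t) (U t)) ∧
      (∀ t, 0 < t → HasRLDerivAt (1 - α) ΔU (DΔU t) t) ∧
      (α < 1 → ∀ t, 0 < t → IntervalIntegrable (rlIntegrand (1 - α) ΔU t) volume 0 t) ∧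
      -- the equation
      (⨆ t ∈ Set.Ioi (0 : ℝ), ‖dU t - DΔU t‖ₑ ^ 2) = 0 ∧
      ∀ t₀ : ℝ, 0 < t₀ →
        (⨆ t ∈ Set.Ici t₀,
          ∫⁻ ω, ∫⁻ x, ‖(dU t - DΔU t : L2Field P) (ω, x)‖ₑ ^ 2 ∂sphereMeasure ∂P) = 0 := by
  have hm := hξ.measurable
  have hξ₂ := hξ.memLp
  have hort := inner_degreeLp hm hξ₂
  have hsum := summable_norm_sq_degreeLp hm hξ₂
  -- The same vector `evolDeriv` is the witness for the time derivative and for the fractional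
  -- derivative, so the residual vanishes identically and both suprema are those of `0`.
  refine ⟨evol (degreeLp hm hξ₂) eigval α, evolGen (degreeLp hm hξ₂) eigval α,
    evolDeriv (degreeLp hm hξ₂) eigval α, evolDeriv (degreeLp hm hξ₂) eigval α,
    fun t ht => tendsto_truncatedField hm hξ₂ hα₀ hα₁ ht, ?_,
    tendsto_evol_zero hort hsum eigval_nonneg hα₀ hα₁,
    fun t ht => hasDerivAt_evol hort hsum eigval_nonneg hα₀ hα₁ ht, fun t ht => ?_,
    fun t ht => hasRLDerivAt_evolGen hort hsum eigval_nonneg hα₀ hα₁ ht,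
    fun hα₂ t ht => intervalIntegrable_rlIntegrand_evolGen hort hsum eigval_nonneg hα₀ hα₁ hα₂ ht,
    by simp, fun t₀ _ => ?_⟩
  · rw [evol_degreeLp_zero hm hξ₂ hα₀]
    exact hξ₂.coeFn_toLp
  -- The multipliers of `U` are bounded by `1` and those of `ΔU` by `Γ(α + 1) t^(-α)`; the latter is
  -- where `t > 0` enters.
  · exact isFieldLaplacianOf_diagSum hm hξ₂
      (fun l => abs_relaxation_le hα₀ hα₁ (eigval_nonneg l) ht.le)
      (fun l => abs_mul_relaxation_le hα₀ hα₁ (eigval_nonneg l) ht) fun l => rfl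
  · simp
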